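/- Let $\Sigma$ be a countable set with the discrete topology, $\Omega=\Sigma^{\mathbb Z}$ with the left shift $S$, and ${\bf P}$ an $S$-invariant probability measure on $\Omega$ that is $\psi$-mixing with power law exponent $\alpha>2$: there is $C>0$ such that for all integers $k<l<m<n$ and all cylinder sets $A$ fixing the coordinates in $[k,l]$ and $B$ fixing the coordinates in $[m,n]$, $|{\bf P}(A\cap B)-{\bf P}(A){\bf P}(B)|\le C\,{\bf P}(A){\bf P}(B)\,(m-l)^{-\alpha}$. Let $V:\Omega\to{\mathbb R}$ be bounded, measurable, centered (${\bf E}V=0$) and quasi-local: for some $0<r<1$ and $C_V$, $|V(\omega)-V(\omega')|\le C_V r^{\min\{m,n\}}$ whenever $m,n\ge 1$ and $\omega,\omega'$ agree on $[-m,n]$. Let $D_V(k)=\sum_{n\in{\mathbb Z}}e^{\imath kn}\,{\bf E}(V\cdot V\circ S^n)$ be its spectral density, and let $$\gamma_\lambda(E)=\lim_{N\to\infty}\frac1N\,{\bf E}\log\Bigl\|\prod_{n=1}^N\begin{pmatrix}E-\lambda V(S^n\omega)&-1\\1&0\end{pmatrix}\Bigr\|$$ be the Lyapunov exponent of the Schrödinger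 operator $(H\psi)_n=\psi_{n+1}+\psi_{n-1}+\lambda V(S^n\omega)\psi_n$ (the limit exists). Assume $D_V(0)>0$, and for (i) also $D_V(\pi)>0$. Fix $\epsilon\in{\mathbb R}$; error terms are for $\lambda\downarrow 0$ with $\epsilon$ fixed. For real functions $p,q$ on ${\mathbb R}/\pi{\mathbb Z}$, call ground state a smooth, $\pi$-periodic, non-negative $\rho$ with $\int_0^\pi\rho\,d\theta=1$ and $\partial_\theta\bigl(\partial_\theta(p\rho)-q\rho\bigr)=0$. (i) For $p(\theta)=\frac12D_V(0)+\frac12D_V(\pi)\cos^2(2\theta)$ and $q(\theta)=-\frac12D_V(\pi)\sin(4\theta)-2\epsilon$ there is a unique ground state $\rho_\epsilon$, and $$\gamma_\lambda(\epsilon\lambda^2)=\lambda^2\,\frac{D_V(\pi)}8\int_0^\pi d\theta\,\rho_\epsilon(\theta)\,(1+\cos(4\theta))+{\cal O}\bigl(\lambda^{\frac{3\alpha+2}{\alpha+2}}\bigr).$$ (ii) For $p(\theta)=D_V(0)\cos^4(\theta)$ and $q(\theta)=-\epsilon-1+(1-\epsilon)\cos(2\theta)-2D_V(0)\cos^3(\theta)\sin(\theta)$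 there is a unique ground state $\rho_\epsilon$; explicitly, for $-\frac\pi2<\theta<\frac\pi2$ and a normalization constant $C>0$, $$\rho_\epsilon(\theta)=C\int_{-\pi/2}^\theta\frac{d\xi}{\cos^2(\xi)\cos^2(\theta)}\exp\Bigl(\frac{2}{3D_V(0)}\bigl(\tan^3\xi-\tan^3\theta+3\epsilon\tan\xi-3\epsilon\tan\theta\bigr)\Bigr).$$ At both band edges, that is for $E=2-\epsilon\lambda^{4/3}$ and for $E=-2+\epsilon\lambda^{4/3}$, $$\gamma_\lambda(E)=\lambda^{\frac23}\Bigl(\frac{1-\epsilon}2\int_0^\pi d\theta\,\rho_\epsilon(\theta)\sin(2\theta)+\frac{D_V(0)}8\int_0^\pi d\theta\,\rho_\epsilon(\theta)\bigl(1+2\cos(2\theta)+\cos(4\theta)\bigr)\Bigr)+{\cal O}\bigl(\lambda^{\frac{3\alpha+2}{3\alpha+6}}\bigr).$$ -/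

import Mathlib

open MeasureTheory Filter Topology Asymptotics

noncomputable section

namespace WeakDisorder

/-- The `n`-th power `S^n` of the left shift on `Ω = A^ℤ`. -/
def shift {A : Type*} (n : ℤ) (ω : ℤ → A) : ℤ → A := fun k => ω (k + n)

/-- The cylinder set fixing the coordinates `m ≤ k ≤ n` to the values `a k`. -/
def cylinder {A : Type*} (m n : ℤ) (a : ℤ → A) : Set (ℤ → A) :=
  {ω | ∀ k, m ≤ k → k ≤ n → ω k = a k}

/-- Power law `ψ`-mixing with exponent `α`. -/
def IsPsiMixing {A : Type*} [MeasurableSpace A] (P : Measure (ℤ → A)) (α : ℝ) : Prop :=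
  ∃ C : ℝ, 0 < C ∧ ∀ k l m n : ℤ, k < l → l < m → m < n → ∀ a b : ℤ → A,
    |P.real (cylinder k l a ∩ cylinder m n b)
        - P.real (cylinder k l a) * P.real (cylinder m n b)|
      ≤ C * P.real (cylinder k l a) * P.real (cylinder m n b) * ((m - l : ℤ) : ℝ) ^ (-α)

/-- Bounded measurable real functions whose variation on `[-m, n]` (the supremum of
`|g ω - g ω'|` over configurations that agree on `[-m, n]`) is at most `C r^{min m n}`
for all `m, n ≥ 1`. -/
structure IsQuasiLocal {A : Type*} [MeasurableSpace A] (r : ℝ) (g : (ℤ → A) → ℝ) : Prop where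
  measurable : Measurable g
  bounded : ∃ B : ℝ, ∀ ω, |g ω| ≤ B
  variation : ∃ C : ℝ, ∀ m n : ℕ, 1 ≤ m → 1 ≤ n → ∀ ω ω' : ℤ → A,
    (∀ k : ℤ, -(m : ℤ) ≤ k → k ≤ (n : ℤ) → ω k = ω' k) → |g ω - g ω'| ≤ C * r ^ (min m n)

/-- The spectral density `D_V(k) = ∑_{n ∈ ℤ} e^{ikn} E(V · V ∘ S^n)`. The sum is real, because
the correlation is even in `n`. -/
def spectralDensity {A : Type*} [MeasurableSpace A] (P : Measure (ℤ → A))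
    (V : (ℤ → A) → ℝ) (k : ℝ) : ℝ :=
  (∑' n : ℤ, Complex.exp (Complex.I * (k : ℂ) * (n : ℂ)) *
    ((∫ ω, V ω * V (shift n ω) ∂P : ℝ) : ℂ)).re

/-- The transfer matrix at energy `E` for the potential value `v`. -/
def transferMatrix (E v : ℝ) : Matrix (Fin 2) (Fin 2) ℝ := !![E - v, -1; 1, 0]

/-- The product of the transfer matrices at the sites `1, …, N`, later sites to the left. -/
def transferProduct {A : Type*} (V : (ℤ → A) → ℝ) (lam E : ℝ) (ω : ℤ → A) :
    ℕ → Matrix (Fin 2) (Fin 2) ℝ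
  | 0 => 1
  | N + 1 => transferMatrix E (lam * V (shift ((N : ℤ) + 1) ω)) * transferProduct V lam E ω N

/-- `(1/N) E log ‖T_N ⋯ T_1‖`, with the operator norm for the Euclidean norm of `ℝ²`. -/
def finiteLyapunov {A : Type*} [MeasurableSpace A] (P : Measure (ℤ → A))
    (V : (ℤ → A) → ℝ) (lam E : ℝ) (N : ℕ) : ℝ :=
  (1 / (N : ℝ)) *
    ∫ ω, Real.log ‖Matrix.toEuclideanCLM (n := Fin 2) (𝕜 := ℝ) (transferProduct V lam E ω N)‖ ∂P

/-- The Lyapunov exponent `γ_λ(E)`. -/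
def lyapunov {A : Type*} [MeasurableSpace A] (P : Measure (ℤ → A))
    (V : (ℤ → A) → ℝ) (lam E : ℝ) : ℝ :=
  limUnder atTop (finiteLyapunov P V lam E)

/-- The Fokker-Planck operator `∂_θ (∂_θ p - q)` applied to `ρ`. -/
def fokkerPlanck (p q ρ : ℝ → ℝ) (θ : ℝ) : ℝ :=
  deriv (fun t => deriv (fun s => p s * ρ s) t - q t * ρ t) θ

/-- `ρ` is a `π`-periodic smooth probability density in the kernel of the Fokker-Planck
operator. -/
structure IsGroundState (p q ρ : ℝ → ℝ) : Prop where
  smooth : ContDiff ℝ ((⊤ : ℕ∞) : WithTop ℕ∞) ρ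
  periodic : Function.Periodic ρ Real.pi
  nonneg : ∀ θ, 0 ≤ ρ θ
  normalized : ∫ θ in (0 : ℝ)..Real.pi, ρ θ = 1
  kernel : ∀ θ, fokkerPlanck p q ρ θ = 0

/-- Diffusion coefficient at the band center; `D0 = D_V(0)`, `Dpi = D_V(π)`. -/
def centerP (D0 Dpi θ : ℝ) : ℝ := D0 / 2 + Dpi / 2 * Real.cos (2 * θ) ^ 2

/-- Drift coefficient at the band center. -/
def centerQ (Dpi ε θ : ℝ) : ℝ := -(Dpi / 2) * Real.sin (4 * θ) - 2 * ε

/-- Diffusion coefficient at the band edges. -/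
def edgeP (D0 θ : ℝ) : ℝ := D0 * Real.cos θ ^ 4

/-- Drift coefficient at the band edges. -/
def edgeQ (D0 ε θ : ℝ) : ℝ :=
  -ε - 1 + (1 - ε) * Real.cos (2 * θ) - 2 * D0 * Real.cos θ ^ 3 * Real.sin θ

/-- The unnormalized ground state at the band edges, for `-π/2 < θ < π/2`. -/
def edgeDensity (D0 ε θ : ℝ) : ℝ :=
  ∫ ξ in (-(Real.pi / 2))..θ, 1 / (Real.cos ξ ^ 2 * Real.cos θ ^ 2) *
    Real.exp (2 / (3 * D0) *
      (Real.tan ξ ^ 3 - Real.tan θ ^ 3 + 3 * ε * Real.tan ξ - 3 * ε * Real.tan θ))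

/-- The coefficient of `λ^{2/3}` in the Lyapunov exponent near the band edges. -/
def edgeCoefficient (D0 ε : ℝ) (ρ : ℝ → ℝ) : ℝ :=
  (1 - ε) / 2 * (∫ θ in (0 : ℝ)..Real.pi, ρ θ * Real.sin (2 * θ))
    + D0 / 8 * ∫ θ in (0 : ℝ)..Real.pi,
        ρ θ * (1 + 2 * Real.cos (2 * θ) + Real.cos (4 * θ))

end WeakDisorder

end

namespace WeakDisorder

/-! ### Taylor expansions and the complex logarithm -/

/-! After a change of basis, a vector moved by the transfer matrices is written as e^{L+iθ}, and one
step multiplies it by 1+ζ with ζ of order δ. At the band center δ = λ, after the free rotation by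
π/2 is removed; at the band edge δ = λ^{1/3}, after the free Jordan block is rescaled. So θ performs
a slow walk with increments δ v s(θ) + O(δ²), L grows by Re log(1+ζ), and the Lyapunov exponent is
the mean growth of L per step.

To order δ² this growth depends on where θ sits. Instead of approximating the distribution of θ, a
corrector makes the dependence disappear. Let h have mean zero over a period and solve p h' + q h =
const - F, where F is the angle-dependent gain up to normalization, and let g' = h. Then the growth
plus the increment of g has mean 2δ²κ over two consecutive sites, wherever θ is, and the increments
of g telescope to a bounded quantity. Pairing the equation with the ground state ρ kills the flux of
ρ because h has mean zero, and identifies κ with the stated integral against ρ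
(`eq_integral_of_poisson`). At the band center p > 0 and variation of constants gives ρ and h
(`exists_groundState_of_pos`, `exists_poisson_of_pos`). At the band edge p vanishes at π/2; there ρ
and h are explicit combinations of Laplace integrals with a cubic phase, which are smooth through
the degenerate point (`exists_edge_groundState`, `exists_edge_poisson`).

The first order term δ v_{t+1} a(θ_t) does not average to zero, since θ_t remembers the recent
potential. Unwinding the walk over 3m steps turns its mean into δ² times a sum of correlations
(`DecorrelatedWalk.abs_integral_linear_sub_le`). Together with half the variance from the second
order term this sum is close to half a spectral density: D_V(0) for the site-independent part of s
and D_V(π) for its alternating part. The errors are δ m^{-α} from mixing and quasi-locality, m²δ³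
from the motion of the angle within a block, and δ² m^{1-α/2} from truncating the correlation sum.
The choice m ~ δ^{-2/(α+2)} makes all three equal to δ^{(3α+2)/(α+2)} (`exists_block_length`,
`StepData.IsCorrected.exists_growth_bound`).

It remains to pass from vectors to matrices. The growth of a single vector bounds the norm of the
product from below. For the upper bound, Jensen's formula shows that the average of the growth over
all initial angles controls the whole matrix up to a constant (`log_norm_add_norm_le_average`),
which is lost after division by N. The lower band edge follows from the upper one by the reflection
E → -E, V → -V. -/

lemma taylor_first {a a1 : ℝ → ℝ} {K : ℝ} (h : ∀ x, HasDerivAt a (a1 x) x)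
    (hL : ∀ x y, |a1 x - a1 y| ≤ K * |x - y|) (x y : ℝ) :
    |a y - a x - a1 x * (y - x)| ≤ K * |y - x| ^ 2 := by
  have hK : 0 ≤ K := by
    have := hL 1 0
    norm_num at this
    exact (abs_nonneg _).trans this
  have key := Convex.norm_image_sub_le_of_norm_hasDerivWithin_le
    (f := fun t => a t - a1 x * t) (f' := fun t => a1 t - a1 x) (s := Set.uIcc x y)
    (C := K * |y - x|) (x := x) (y := y)
    (fun t _ => by
      have h1 := (h t).sub ((hasDerivAt_id t).const_mul (a1 x))
      exact (h1.congr_deriv (by simp)).hasDerivWithinAt)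
    (fun t ht => by
      exact (hL t x).trans (mul_le_mul_of_nonneg_left (Set.abs_sub_left_of_mem_uIcc ht) hK))
    (convex_uIcc x y) Set.left_mem_uIcc Set.right_mem_uIcc
  simp only [Real.norm_eq_abs] at key
  calc _ = |a y - a1 x * y - (a x - a1 x * x)| := by congr 1; ring
    _ ≤ _ := key
    _ = _ := by ring

lemma taylor_second {g g1 g2 : ℝ → ℝ} {K : ℝ} (h : ∀ x, HasDerivAt g (g1 x) x)
    (h1 : ∀ x, HasDerivAt g1 (g2 x) x)
    (hL : ∀ x y, |g2 x - g2 y| ≤ K * |x - y|) (x y : ℝ) :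
    |g y - g x - g1 x * (y - x) - g2 x * (y - x) ^ 2 / 2| ≤ K * |y - x| ^ 3 := by
  have hK : 0 ≤ K := by
    have := hL 1 0
    norm_num at this
    exact (abs_nonneg _).trans this
  have key := Convex.norm_image_sub_le_of_norm_hasDerivWithin_le
    (f := fun t => g t - g1 x * t - g2 x * (t - x) ^ 2 / 2)
    (f' := fun t => g1 t - g1 x - g2 x * (t - x)) (s := Set.uIcc x y)
    (C := K * |y - x| ^ 2) (x := x) (y := y)
    (fun t _ => by
      have h2 := ((h t).sub ((hasDerivAt_id t).const_mul (g1 x))).sub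
        ((((hasDerivAt_id t).sub_const x).pow 2).const_mul (g2 x) |>.div_const 2)
      refine (h2.congr_deriv ?_).hasDerivWithinAt
      simp
      ring)
    (fun t ht => by
      refine (taylor_first h1 hL x t).trans ?_
      exact mul_le_mul_of_nonneg_left (pow_le_pow_left₀ (abs_nonneg _)
        (Set.abs_sub_left_of_mem_uIcc ht) 2) hK)
    (convex_uIcc x y) Set.left_mem_uIcc Set.right_mem_uIcc
  simp only [Real.norm_eq_abs] at key
  calc _ = |g y - g1 x * y - g2 x * (y - x) ^ 2 / 2
          - (g x - g1 x * x - g2 x * (x - x) ^ 2 / 2)| := by congr 1; ring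
    _ ≤ _ := key
    _ = _ := by ring

lemma norm_log_one_add_sub_quadratic_le {z : ℂ} (hz : ‖z‖ ≤ 1 / 2) :
    ‖Complex.log (1 + z) - (z - z ^ 2 / 2)‖ ≤ ‖z‖ ^ 3 := by
  have h := Complex.norm_log_sub_logTaylor_le 2 (z := z) (by linarith)
  have e : Complex.logTaylor (2 + 1) z = z - z ^ 2 / 2 := by
    simp [Complex.logTaylor_succ, Complex.logTaylor_zero]
    ring
  rw [e] at h
  refine h.trans ?_
  have : (1 - ‖z‖)⁻¹ ≤ 2 := by
    rw [inv_le_comm₀ (by linarith) (by norm_num)]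
    linarith
  have h0 : 0 ≤ ‖z‖ ^ 3 := by positivity
  norm_num
  have := mul_le_mul_of_nonneg_left this h0
  linarith

lemma norm_log_one_add_sub_le {z w : ℂ} (hz : ‖z‖ ≤ 1 / 2) (hw : ‖w‖ ≤ 1 / 2) :
    ‖Complex.log (1 + z) - Complex.log (1 + w)‖ ≤ 2 * ‖z - w‖ := by
  refine Convex.norm_image_sub_le_of_norm_hasDerivWithin_le
    (f := fun t : ℂ => Complex.log (1 + t)) (f' := fun t => (1 + t)⁻¹)
    (s := Metric.closedBall 0 (1 / 2)) (fun t ht => ?_) (fun t ht => ?_)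
    (convex_closedBall _ _) (by simpa using hw) (by simpa using hz)
  · have ht' : ‖t‖ ≤ 1 / 2 := by simpa using ht
    have hs : 1 + t ∈ Complex.slitPlane := Complex.mem_slitPlane_of_norm_lt_one (by linarith)
    have := ((hasDerivAt_id t).const_add 1).clog hs
    simpa using this.hasDerivWithinAt
  · have ht' : ‖t‖ ≤ 1 / 2 := by simpa using ht
    rw [norm_inv, inv_le_comm₀ _ (by norm_num)]
    · have := norm_sub_norm_le (1 : ℂ) (-t)
      simp at this
      linarith
    · have := norm_sub_norm_le (1 : ℂ) (-t)
      simp at this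
      linarith

/-- Jensen's formula for a polynomial of degree one with root -b/a. It is what converts an average
over initial directions into the size of a matrix. -/
lemma circleAverage_log_norm_mul_add {a b : ℂ} (hab : a ≠ 0 ∨ b ≠ 0) :
    Real.circleAverage (fun w => Real.log ‖a * w + b‖) 0 1 = Real.log (max ‖a‖ ‖b‖) := by
  by_cases ha : a = 0
  · subst ha
    simp [Real.circleAverage_const]
  · have hna : 0 < ‖a‖ := norm_pos_iff.mpr ha
    -- At the root itself the product rule fails because `Real.log 0 = 0`; circle averages ignore
    -- such isolated points.
    have h1 : ∀ᶠ w in codiscreteWithin (Metric.sphere (0 : ℂ) |1|),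
        Real.log ‖a * w + b‖ = Real.log ‖a‖ + Real.log ‖w - (-b / a)‖ := by
      have : {w : ℂ | w ≠ -b / a} ∈ codiscreteWithin (Metric.sphere (0 : ℂ) |1|) := by
        have : ({-b / a}ᶜ : Set ℂ) ∈ codiscreteWithin (Metric.sphere (0 : ℂ) |1|) := by
          apply codiscreteWithin_mono (Set.subset_univ _)
          exact (Set.finite_singleton _).compl_mem_codiscrete
        exact this
      filter_upwards [this] with w hw
      have hw' : w - (-b / a) ≠ 0 := sub_ne_zero.mpr hw
      rw [← Real.log_mul hna.ne' (norm_ne_zero_iff.mpr hw'), ← norm_mul]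
      congr 2
      field_simp
      ring
    rw [Real.circleAverage_congr_codiscreteWithin h1 one_ne_zero]
    have h2 := Real.circleAverage_fun_add (c := (0 : ℂ)) (R := 1)
      (f₁ := fun _ : ℂ => Real.log ‖a‖) (f₂ := fun w => Real.log ‖w - (-b / a)‖)
      (circleIntegrable_const _ _ _) (circleIntegrable_log_norm_sub_const 1)
    rw [h2, Real.circleAverage_const, circleAverage_log_norm_sub_const_eq_posLog, norm_div, norm_neg]
    rcases le_or_gt ‖b‖ ‖a‖ with h | h
    · rw [max_eq_left h, Real.posLog_eq_zero_iff _ |>.mpr, add_zero]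
      rw [abs_of_nonneg (by positivity)]
      exact div_le_one_of_le₀ h hna.le
    · rw [max_eq_right h.le, Real.posLog_eq_log, Real.log_div (by linarith) hna.ne']
      · ring
      · rw [abs_of_nonneg (by positivity), one_le_div hna]
        exact h.le

end WeakDisorder
section

open scoped ContDiff

namespace WeakDisorder

/-! ### Ground states and the Poisson equation -/

lemma hasDerivAt_primitive {f : ℝ → ℝ} (hf : Continuous f) (x : ℝ) :
    HasDerivAt (fun x => ∫ t in (0 : ℝ)..x, f t) (f x) x :=
  (hf.integral_hasStrictDerivAt 0 x).hasDerivAt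

lemma contDiff_primitive {f : ℝ → ℝ} (hf : ContDiff ℝ ∞ f) :
    ContDiff ℝ ∞ (fun x => ∫ t in (0 : ℝ)..x, f t) := by
  rw [contDiff_infty_iff_deriv]
  refine ⟨fun x => (hasDerivAt_primitive hf.continuous x).differentiableAt, ?_⟩
  have : deriv (fun x => ∫ t in (0 : ℝ)..x, f t) = f :=
    funext fun x => (hasDerivAt_primitive hf.continuous x).deriv
  rwa [this]

lemma periodic_primitive {h : ℝ → ℝ} (hc : Continuous h) (hp : Function.Periodic h Real.pi)
    (h0 : ∫ θ in (0 : ℝ)..Real.pi, h θ = 0) :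
    Function.Periodic (fun x => ∫ t in (0 : ℝ)..x, h t) Real.pi := by
  intro x
  have h1 := intervalIntegral.integral_add_adjacent_intervals
    (hc.intervalIntegrable (μ := volume) 0 x) (hc.intervalIntegrable x (x + Real.pi))
  have h2 := hp.intervalIntegral_add_eq x 0
  simp only [zero_add] at h2
  show ∫ t in (0 : ℝ)..(x + Real.pi), h t = _
  rw [← h1, h2, h0, add_zero]

lemma exists_bound_of_periodic {h : ℝ → ℝ} (hc : Continuous h)
    (hp : Function.Periodic h Real.pi) : ∃ K, 0 ≤ K ∧ ∀ x, |h x| ≤ K := by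
  obtain ⟨K, hK⟩ := (isCompact_Icc (a := (0 : ℝ)) (b := Real.pi)).exists_bound_of_continuousOn
    hc.continuousOn
  refine ⟨K, (norm_nonneg _).trans (hK 0 ⟨le_rfl, Real.pi_pos.le⟩), fun x => ?_⟩
  obtain ⟨y, hy, hxy⟩ := hp.exists_mem_Ico₀ Real.pi_pos x
  rw [hxy]
  exact hK y ⟨hy.1, hy.2.le⟩

/-- The kernel equation is an exact derivative, so the probability flux is a constant `c`. This
first order form is the one used in all later arguments. -/
lemma exists_flux {p q ρ : ℝ → ℝ} (hp : ContDiff ℝ ∞ p) (hq : ContDiff ℝ ∞ q)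
    (hρ : IsGroundState p q ρ) :
    ∃ c, ∀ θ, HasDerivAt (fun s => p s * ρ s) (q θ * ρ θ + c) θ := by
  have hpρ : ContDiff ℝ ∞ (fun s => p s * ρ s) := hp.mul hρ.smooth
  have hd : ContDiff ℝ ∞ (fun t => deriv (fun s => p s * ρ s) t - q t * ρ t) :=
    (contDiff_infty_iff_deriv.mp hpρ).2.sub (hq.mul hρ.smooth)
  have hconst := is_const_of_deriv_eq_zero (hd.differentiable (by simp)) hρ.kernel
  refine ⟨deriv (fun s => p s * ρ s) 0 - q 0 * ρ 0, fun θ => ?_⟩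
  have h1 := (hpρ.differentiable (by simp) θ).hasDerivAt
  refine h1.congr_deriv ?_
  rw [← hconst θ 0]
  ring

lemma isGroundState_of_flux {p q ρ : ℝ → ℝ} {c : ℝ} (h1 : ContDiff ℝ ∞ ρ)
    (h2 : Function.Periodic ρ Real.pi) (h3 : ∀ θ, 0 ≤ ρ θ)
    (h4 : ∫ θ in (0 : ℝ)..Real.pi, ρ θ = 1)
    (h5 : ∀ θ, HasDerivAt (fun s => p s * ρ s) (q θ * ρ θ + c) θ) : IsGroundState p q ρ := by
  refine ⟨h1, h2, h3, h4, fun θ => ?_⟩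
  have : (fun t => deriv (fun s => p s * ρ s) t - q t * ρ t) = fun _ => c := by
    funext t
    rw [(h5 t).deriv]
    ring
  rw [fokkerPlanck, this, deriv_const]

/-- Solvability condition: the right-hand side of the Poisson equation has `ρ`-mean zero. -/
lemma eq_integral_of_poisson {p q ρ h h' F : ℝ → ℝ} {κ : ℝ}
    (hp : ContDiff ℝ ∞ p) (hq : ContDiff ℝ ∞ q) (hpp : Function.Periodic p Real.pi)
    (hρ : IsGroundState p q ρ) (hh : ∀ θ, HasDerivAt h (h' θ) θ) (hh' : Continuous h')
    (hper : Function.Periodic h Real.pi) (hmean : ∫ θ in (0 : ℝ)..Real.pi, h θ = 0)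
    (hF : Continuous F) (heq : ∀ θ, p θ * h' θ + q θ * h θ = κ - F θ) :
    κ = ∫ θ in (0 : ℝ)..Real.pi, ρ θ * F θ := by
  obtain ⟨c, hc⟩ := exists_flux hp hq hρ
  have hcont : Continuous h := continuous_iff_continuousAt.mpr fun θ => (hh θ).continuousAt
  have cρ := hρ.smooth.continuous
  -- The integrand is the derivative of the periodic function p ρ h. After substitution of the
  -- Poisson equation the flux enters only through c times the mean of h, which is zero.
  have e1 : ∫ θ in (0 : ℝ)..Real.pi, ((q θ * ρ θ + c) * h θ + (p θ * ρ θ) * h' θ) = 0 := by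
    rw [intervalIntegral.integral_eq_sub_of_hasDerivAt (f := fun s => p s * ρ s * h s)
      (fun θ _ => (hc θ).mul (hh θ))]
    · have a1 := hpp 0
      have a2 := hρ.periodic 0
      have a3 := hper 0
      simp only [zero_add] at a1 a2 a3
      simp only [a1, a2, a3, sub_self]
    · apply Continuous.intervalIntegrable
      have := hq.continuous
      have := hp.continuous
      fun_prop
  have e2 : ∀ θ, (q θ * ρ θ + c) * h θ + (p θ * ρ θ) * h' θ
      = κ * ρ θ - ρ θ * F θ + c * h θ := by
    intro θ
    have := heq θ
    linear_combination ρ θ * this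
  simp_rw [e2] at e1
  rw [intervalIntegral.integral_add, intervalIntegral.integral_sub,
    intervalIntegral.integral_const_mul, intervalIntegral.integral_const_mul, hmean,
    hρ.normalized] at e1
  · linarith
  all_goals exact Continuous.intervalIntegrable (by fun_prop) _ _

/-- The difference of two normalized densities has mean zero, hence a zero, and by periodicity
another one a period later. Multiplied by p and by the integrating factor, the difference has a
derivative of constant sign, proportional to the difference of the fluxes. Two zeros force equal
fluxes, and then the difference vanishes identically. -/
lemma groundState_unique_of_pos {p q ρ ρ' : ℝ → ℝ} (hp : ContDiff ℝ ∞ p) (hq : ContDiff ℝ ∞ q)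
    (hpp : Function.Periodic p Real.pi) (hpos : ∀ θ, 0 < p θ)
    (hρ : IsGroundState p q ρ) (hρ' : IsGroundState p q ρ') : ρ' = ρ := by
  obtain ⟨c, hc⟩ := exists_flux hp hq hρ
  obtain ⟨c', hc'⟩ := exists_flux hp hq hρ'
  have cρ := hρ.smooth.continuous
  have cρ' := hρ'.smooth.continuous
  have hqp : Continuous fun t => q t / p t :=
    hq.continuous.div hp.continuous fun t => (hpos t).ne'
  set m : ℝ → ℝ := fun x => ∫ t in (0 : ℝ)..x, q t / p t with hm
  have hmd : ∀ x, HasDerivAt m (q x / p x) x := hasDerivAt_primitive hqp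
  have mcont : Continuous m := continuous_iff_continuousAt.mpr fun θ => (hmd θ).continuousAt
  set w : ℝ → ℝ := fun x => Real.exp (-m x) * (p x * ρ' x - p x * ρ x) with hw
  have hwd : ∀ x, HasDerivAt w ((c' - c) * Real.exp (-m x)) x := by
    intro x
    have h1 := ((hmd x).neg.exp).mul ((hc' x).sub (hc x))
    refine h1.congr_deriv ?_
    have := (hpos x).ne'
    simp only [Pi.neg_apply, Pi.sub_apply]
    field_simp
    ring
  -- a zero of the difference
  obtain ⟨θ₀, hθ₀⟩ : ∃ θ, ρ' θ - ρ θ = 0 := by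
    by_contra! hne
    have hi : ∫ θ in (0 : ℝ)..Real.pi, (ρ' θ - ρ θ) = 0 := by
      rw [intervalIntegral.integral_sub (cρ'.intervalIntegrable _ _) (cρ.intervalIntegrable _ _),
        hρ.normalized, hρ'.normalized, sub_self]
    obtain ⟨x, hx⟩ : ∃ x, 0 < ρ' x - ρ x := by
      by_contra! hle
      have : ∫ θ in (0 : ℝ)..Real.pi, -(ρ' θ - ρ θ) > 0 :=
        intervalIntegral.intervalIntegral_pos_of_pos
          (Continuous.intervalIntegrable (by fun_prop) _ _)
          (fun x => by have := lt_of_le_of_ne (hle x) (hne x); linarith) Real.pi_pos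
      rw [intervalIntegral.integral_neg, hi] at this
      simp at this
    obtain ⟨y, hy⟩ : ∃ y, ρ' y - ρ y < 0 := by
      by_contra! hle
      have : ∫ θ in (0 : ℝ)..Real.pi, (ρ' θ - ρ θ) > 0 :=
        intervalIntegral.intervalIntegral_pos_of_pos
          (Continuous.intervalIntegrable (by fun_prop) _ _)
          (fun x => lt_of_le_of_ne (hle x) (hne x).symm) Real.pi_pos
      rw [hi] at this
      simp at this
    obtain ⟨z, hz⟩ := mem_range_of_exists_le_of_exists_ge (f := fun t => ρ' t - ρ t) (c := 0)
      (by fun_prop) ⟨y, hy.le⟩ ⟨x, hx.le⟩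
    exact hne z hz
  have w0 : w θ₀ = 0 := by
    simp only [hw]
    linear_combination (Real.exp (-m θ₀) * p θ₀) * hθ₀
  have w1 : w (θ₀ + Real.pi) = 0 := by
    simp only [hw, hρ.periodic θ₀, hρ'.periodic θ₀, hpp θ₀]
    linear_combination (Real.exp (-m (θ₀ + Real.pi)) * p θ₀) * hθ₀
  have hint : ∫ x in θ₀..(θ₀ + Real.pi), (c' - c) * Real.exp (-m x) = 0 := by
    rw [intervalIntegral.integral_eq_sub_of_hasDerivAt (fun x _ => hwd x)
      (Continuous.intervalIntegrable (by fun_prop) _ _), w0, w1, sub_zero]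
  rw [intervalIntegral.integral_const_mul] at hint
  have hpos' : 0 < ∫ x in θ₀..(θ₀ + Real.pi), Real.exp (-m x) :=
    intervalIntegral.intervalIntegral_pos_of_pos
      (Continuous.intervalIntegrable (by fun_prop) _ _) (fun x => Real.exp_pos _)
      (by linarith [Real.pi_pos])
  have hcc : c' - c = 0 := by
    rcases mul_eq_zero.mp hint with h | h
    · exact h
    · exact absurd h hpos'.ne'
  have hwc : ∀ x, w x = 0 := by
    intro x
    rw [← w0]
    exact is_const_of_deriv_eq_zero (fun x => (hwd x).differentiableAt)
      (fun x => by rw [(hwd x).deriv, hcc, zero_mul]) x θ₀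
  funext x
  have h1 := hwc x
  simp only [hw, ← mul_sub] at h1
  rcases mul_eq_zero.mp h1 with h | h
  · exact absurd h (Real.exp_pos _).ne'
  · rcases mul_eq_zero.mp h with h | h
    · exact absurd h (hpos x).ne'
    · linarith

/-- Variation of constants: with m' = q/p and J' = e^{-m}, the functions e^m (1 + cJ)/p solve the
flux equation with flux c. It remains to choose c so that the solution is periodic, and to check
positivity. -/
lemma exists_groundState_of_pos {p q : ℝ → ℝ} (hp : ContDiff ℝ ∞ p) (hq : ContDiff ℝ ∞ q)
    (hpp : Function.Periodic p Real.pi) (hqq : Function.Periodic q Real.pi)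
    (hpos : ∀ θ, 0 < p θ) : ∃ ρ, IsGroundState p q ρ := by
  have hqps : ContDiff ℝ ∞ fun t => q t / p t := hq.div hp fun t => (hpos t).ne'
  have hqp := hqps.continuous
  set m : ℝ → ℝ := fun x => ∫ t in (0 : ℝ)..x, q t / p t with hm
  have hmd : ∀ x, HasDerivAt m (q x / p x) x := hasDerivAt_primitive hqp
  have hms : ContDiff ℝ ∞ m := contDiff_primitive hqps
  have mcont := hms.continuous
  set W := m Real.pi with hW
  have hmper : ∀ x, m (x + Real.pi) = m x + W := by
    intro x
    have h1 := intervalIntegral.integral_add_adjacent_intervals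
      (hqp.intervalIntegrable (μ := volume) 0 x) (hqp.intervalIntegrable x (x + Real.pi))
    have h2 := (hqq.div hpp).intervalIntegral_add_eq x 0
    simp only [zero_add, Pi.div_apply] at h2
    rw [h2] at h1
    exact h1.symm
  have hes : ContDiff ℝ ∞ fun x => Real.exp (-m x) := hms.neg.exp
  have hec := hes.continuous
  set J : ℝ → ℝ := fun x => ∫ t in (0 : ℝ)..x, Real.exp (-m t) with hJ
  have hJd : ∀ x, HasDerivAt J (Real.exp (-m x)) x := hasDerivAt_primitive hec
  have hJs : ContDiff ℝ ∞ J := contDiff_primitive hes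
  have hJpos : 0 < J Real.pi := intervalIntegral.intervalIntegral_pos_of_pos
      (hec.intervalIntegrable _ _) (fun x => Real.exp_pos _) Real.pi_pos
  have hJper : ∀ x, J (x + Real.pi) = J Real.pi + Real.exp (-W) * J x := by
    intro x
    have h1 := intervalIntegral.integral_add_adjacent_intervals
      (hec.intervalIntegrable (μ := volume) 0 Real.pi)
      (hec.intervalIntegrable Real.pi (x + Real.pi))
    have h2 : ∫ t in Real.pi..(x + Real.pi), Real.exp (-m t) = Real.exp (-W) * J x := by
      have := intervalIntegral.integral_comp_add_right (a := 0) (b := x)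
        (fun t => Real.exp (-m t)) Real.pi
      rw [zero_add] at this
      rw [← this, hJ, ← intervalIntegral.integral_const_mul]
      refine intervalIntegral.integral_congr fun t _ => ?_
      simp only [hmper]
      rw [← Real.exp_add]
      ring_nf
    rw [h2] at h1
    exact h1.symm
  -- Periodicity requires 1 + c J(π) = e^{-W}, where W is the increment of m over a period.
  set c := (Real.exp (-W) - 1) / J Real.pi with hc
  have hcJ : c * J Real.pi = Real.exp (-W) - 1 := by rw [hc]; field_simp
  set ρ₀ : ℝ → ℝ := fun x => Real.exp (m x) * (1 + c * J x) / p x with hρ₀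
  have hs : ContDiff ℝ ∞ ρ₀ :=
    (hms.exp.mul (contDiff_const.add (contDiff_const.mul hJs))).div hp fun t => (hpos t).ne'
  have hρper : Function.Periodic ρ₀ Real.pi := by
    intro x
    simp only [hρ₀, hmper, hJper, hpp x, Real.exp_add]
    congr 1
    have e : Real.exp W * Real.exp (-W) = 1 := by rw [← Real.exp_add]; simp
    have e2 : 1 + c * (J Real.pi + Real.exp (-W) * J x) = Real.exp (-W) * (1 + c * J x) := by
      linear_combination hcJ
    rw [e2]
    linear_combination Real.exp (m x) * (1 + c * J x) * e
  have hρpos : ∀ x, 0 < ρ₀ x := by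
    intro x
    obtain ⟨y, hy, hxy⟩ := hρper.exists_mem_Ico₀ Real.pi_pos x
    rw [hxy]
    simp only [hρ₀]
    have hJ0 : 0 ≤ J y := intervalIntegral.integral_nonneg hy.1 fun t _ => (Real.exp_pos _).le
    have hJ1 : J y ≤ J Real.pi := by
      have h1 := intervalIntegral.integral_add_adjacent_intervals
        (hec.intervalIntegrable (μ := volume) 0 y) (hec.intervalIntegrable y Real.pi)
      have h2 : 0 ≤ ∫ t in y..Real.pi, Real.exp (-m t) :=
        intervalIntegral.integral_nonneg hy.2.le fun t _ => (Real.exp_pos _).le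
      simp only [hJ]
      linarith
    have : 0 < 1 + c * J y := by
      have hE := Real.exp_pos (-W)
      have : 0 < (1 + c * J y) * J Real.pi := by
        -- Up to the factor J(π), the value 1 + cJ(y) interpolates between 1 at y = 0 and e^{-W} at
        -- y = π, both of them positive.
        have e : (1 + c * J y) * J Real.pi = (J Real.pi - J y) + Real.exp (-W) * J y := by
          linear_combination J y * hcJ
        rw [e]
        rcases hJ1.lt_or_eq with h | h
        · have := mul_nonneg hE.le hJ0
          linarith
        · rw [h]
          have := mul_pos hE hJpos
          linarith
      exact pos_of_mul_pos_left this hJpos.le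
    have := hpos y
    positivity
  have hZ : 0 < ∫ θ in (0 : ℝ)..Real.pi, ρ₀ θ := intervalIntegral.intervalIntegral_pos_of_pos
      (hs.continuous.intervalIntegrable _ _) hρpos Real.pi_pos
  set Z := ∫ θ in (0 : ℝ)..Real.pi, ρ₀ θ with hZd
  refine ⟨fun x => Z⁻¹ * ρ₀ x, isGroundState_of_flux (c := Z⁻¹ * c) (contDiff_const.mul hs)
    (fun x => by simp only [hρper x]) (fun θ => mul_nonneg (inv_nonneg.mpr hZ.le) (hρpos θ).le)
    ?_ fun θ => ?_⟩
  · rw [intervalIntegral.integral_const_mul, ← hZd, inv_mul_cancel₀ hZ.ne']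
  · have h1 := (((hmd θ).exp).mul (((hJd θ).const_mul c).const_add 1)).const_mul Z⁻¹
    have e1 : (fun s => p s * (Z⁻¹ * ρ₀ s)) = fun s => Z⁻¹ * (Real.exp (m s) * (1 + c * J s)) := by
      funext s
      have := (hpos s).ne'
      simp only [hρ₀]
      field_simp
    rw [e1]
    refine h1.congr_deriv ?_
    have := (hpos θ).ne'
    have e : Real.exp (m θ) * Real.exp (-m θ) = 1 := by rw [← Real.exp_add]; simp
    simp only [hρ₀]
    field_simp
    linear_combination c * p θ * e

/-- For `p > 0` the Poisson equation for the generator has a periodic solution; `h` is the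
derivative of the solution. -/
lemma exists_poisson_of_pos {p q ρ F : ℝ → ℝ} (hp : ContDiff ℝ ∞ p) (hq : ContDiff ℝ ∞ q)
    (hpp : Function.Periodic p Real.pi) (hqq : Function.Periodic q Real.pi)
    (hpos : ∀ θ, 0 < p θ) (hρ : IsGroundState p q ρ) (hF : ContDiff ℝ ∞ F)
    (hFp : Function.Periodic F Real.pi) :
    ∃ h : ℝ → ℝ, ContDiff ℝ ∞ h ∧ Function.Periodic h Real.pi ∧
      (∫ θ in (0 : ℝ)..Real.pi, h θ = 0) ∧
      ∀ θ, p θ * deriv h θ + q θ * h θ = (∫ t in (0 : ℝ)..Real.pi, ρ t * F t) - F θ := by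
  have hqps : ContDiff ℝ ∞ fun t => q t / p t := hq.div hp fun t => (hpos t).ne'
  set m : ℝ → ℝ := fun x => ∫ t in (0 : ℝ)..x, q t / p t with hm
  have hmd : ∀ x, HasDerivAt m (q x / p x) x := hasDerivAt_primitive hqps.continuous
  have hms : ContDiff ℝ ∞ m := contDiff_primitive hqps
  have hm0 : m 0 = 0 := by simp [hm]
  -- solutions of the linear equation with right-hand side `G` and initial value `a`
  have hsol : ∀ (G : ℝ → ℝ), ContDiff ℝ ∞ G → ∀ a : ℝ, ∃ y : ℝ → ℝ,
      ContDiff ℝ ∞ y ∧ y 0 = a ∧ ∀ θ, HasDerivAt y ((G θ - q θ * y θ) / p θ) θ := by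
    intro G hG a
    have hfs : ContDiff ℝ ∞ fun t => Real.exp (m t) * G t / p t :=
      (hms.exp.mul hG).div hp fun t => (hpos t).ne'
    refine ⟨fun x => Real.exp (-m x) * (a + ∫ t in (0 : ℝ)..x, Real.exp (m t) * G t / p t),
      hms.neg.exp.mul (contDiff_const.add (contDiff_primitive hfs)), by simp [hm0], fun θ => ?_⟩
    have h1 := ((hmd θ).neg.exp).mul ((hasDerivAt_primitive hfs.continuous θ).const_add a)
    refine h1.congr_deriv ?_
    have := (hpos θ).ne'
    have e : Real.exp (-m θ) * Real.exp (m θ) = 1 := by rw [← Real.exp_add]; simp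
    simp only [Pi.neg_apply]
    field_simp
    linear_combination G θ * e
  have huniq : ∀ (G y z : ℝ → ℝ), y 0 = z 0 →
      (∀ θ, HasDerivAt y ((G θ - q θ * y θ) / p θ) θ) →
      (∀ θ, HasDerivAt z ((G θ - q θ * z θ) / p θ) θ) → y = z := by
    intro G y z h0 hy hz
    have hd : ∀ θ, HasDerivAt (fun x => Real.exp (m x) * (y x - z x)) 0 θ := by
      intro θ
      refine ((hmd θ).exp.mul ((hy θ).sub (hz θ))).congr_deriv ?_
      have := (hpos θ).ne'
      simp only [Pi.sub_apply]
      field_simp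
      ring
    funext x
    have := is_const_of_deriv_eq_zero (fun x => (hd x).differentiableAt) (fun x => (hd x).deriv) x 0
    simp only [h0, sub_self, mul_zero] at this
    rcases mul_eq_zero.mp this with h | h
    · exact absurd h (Real.exp_pos _).ne'
    · linarith
  have hperiodic : ∀ (G y : ℝ → ℝ), Function.Periodic G Real.pi → y Real.pi = y 0 →
      (∀ θ, HasDerivAt y ((G θ - q θ * y θ) / p θ) θ) → Function.Periodic y Real.pi := by
    intro G y hG h0 hy
    have := huniq G (fun x => y (x + Real.pi)) y (by simpa using h0) (fun θ => by
      have h1 := (hy (θ + Real.pi)).comp_add_const θ Real.pi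
      simp only [hG θ, hpp θ, hqq θ] at h1
      exact h1) hy
    exact fun x => congrFun this x
  obtain ⟨y1, hy1s, hy10, hy1⟩ := hsol (fun _ => 0) contDiff_const 1
  obtain ⟨y2, hy2s, hy20, hy2⟩ := hsol (fun _ => 1) contDiff_const 0
  obtain ⟨y3, hy3s, hy30, hy3⟩ := hsol F hF 0
  have hcomb : ∀ a κ b : ℝ, ∀ θ, HasDerivAt (fun x => a * y1 x + κ * y2 x - b * y3 x)
      ((κ - b * F θ - q θ * (a * y1 θ + κ * y2 θ - b * y3 θ)) / p θ) θ := by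
    intro a κ b θ
    refine ((((hy1 θ).const_mul a).add ((hy2 θ).const_mul κ)).sub
      ((hy3 θ).const_mul b)).congr_deriv ?_
    have := (hpos θ).ne'
    field_simp
    ring
  have c1 := hy1s.continuous
  have c2 := hy2s.continuous
  have c3 := hy3s.continuous
  have hmean : ∀ a κ b : ℝ, ∫ θ in (0 : ℝ)..Real.pi, (a * y1 θ + κ * y2 θ - b * y3 θ)
      = a * (∫ θ in (0 : ℝ)..Real.pi, y1 θ) + κ * (∫ θ in (0 : ℝ)..Real.pi, y2 θ)
        - b * (∫ θ in (0 : ℝ)..Real.pi, y3 θ) := by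
    intro a κ b
    rw [intervalIntegral.integral_sub, intervalIntegral.integral_add,
      intervalIntegral.integral_const_mul, intervalIntegral.integral_const_mul,
      intervalIntegral.integral_const_mul]
    all_goals exact Continuous.intervalIntegrable (by fun_prop) _ _
  have hsm : ∀ a κ b : ℝ, ContDiff ℝ ∞ (fun x => a * y1 x + κ * y2 x - b * y3 x) :=
    fun a κ b => ((contDiff_const.mul hy1s).add (contDiff_const.mul hy2s)).sub
      (contDiff_const.mul hy3s)
  -- Periodicity at one point and mean zero suffice for a global periodic solution, and the
  -- solvability condition then dictates κ. The parameter b covers both uses: b = 1 for the equation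
  -- itself and b = 0 for injectivity of the linear system.
  have hkap : ∀ a κ b : ℝ, a * y1 Real.pi + κ * y2 Real.pi - b * y3 Real.pi = a →
      a * (∫ θ in (0 : ℝ)..Real.pi, y1 θ) + κ * (∫ θ in (0 : ℝ)..Real.pi, y2 θ)
        - b * (∫ θ in (0 : ℝ)..Real.pi, y3 θ) = 0 →
      Function.Periodic (fun x => a * y1 x + κ * y2 x - b * y3 x) Real.pi ∧
      (∀ θ, p θ * deriv (fun x => a * y1 x + κ * y2 x - b * y3 x) θ
        + q θ * (a * y1 θ + κ * y2 θ - b * y3 θ) = κ - b * F θ) ∧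
      κ = ∫ θ in (0 : ℝ)..Real.pi, ρ θ * (b * F θ) := by
    intro a κ b h1 h2
    have hP : Function.Periodic (fun x => a * y1 x + κ * y2 x - b * y3 x) Real.pi :=
      hperiodic (fun θ => κ - b * F θ) _ (fun x => by simp only [hFp x])
        (by simp [h1, hy10, hy20, hy30]) (hcomb a κ b)
    have hE : ∀ θ, p θ * deriv (fun x => a * y1 x + κ * y2 x - b * y3 x) θ
        + q θ * (a * y1 θ + κ * y2 θ - b * y3 θ) = κ - b * F θ := by
      intro θ
      rw [(hcomb a κ b θ).deriv]
      have := (hpos θ).ne'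
      field_simp
      ring
    refine ⟨hP, hE, eq_integral_of_poisson hp hq hpp hρ
      (fun θ => ((hsm a κ b).differentiable (by simp) θ).hasDerivAt)
      ((hsm a κ b).continuous_deriv (by simp)) hP (by rw [hmean]; exact h2)
      (by have := hF.continuous; fun_prop) hE⟩
  -- the linear system for the initial value and the constant
  let L : (ℝ × ℝ) →ₗ[ℝ] (ℝ × ℝ) :=
    { toFun := fun v => (v.1 * y1 Real.pi + v.2 * y2 Real.pi - v.1,
        v.1 * (∫ θ in (0 : ℝ)..Real.pi, y1 θ) + v.2 * (∫ θ in (0 : ℝ)..Real.pi, y2 θ))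
      map_add' := fun v w => by ext <;> simp <;> ring
      map_smul' := fun r v => by ext <;> simp <;> ring }
  -- The system is square, so uniqueness gives existence. A homogeneous solution has κ = 0 by the
  -- solvability condition, hence is a multiple of the positive function e^{-m}; mean zero makes it
  -- vanish.
  have hLinj : Function.Injective L := by
    rw [injective_iff_map_eq_zero]
    rintro ⟨a, κ⟩ hv
    have hv1 : a * y1 Real.pi + κ * y2 Real.pi - a = 0 := congrArg Prod.fst hv
    have hv2 : a * (∫ θ in (0 : ℝ)..Real.pi, y1 θ) + κ * (∫ θ in (0 : ℝ)..Real.pi, y2 θ) = 0 :=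
      congrArg Prod.snd hv
    obtain ⟨-, -, h3⟩ := hkap a κ 0 (by linarith) (by linarith)
    have hκ : κ = 0 := by simpa using h3
    subst hκ
    have hy1e : y1 = fun x => Real.exp (-m x) := by
      refine huniq (fun _ => 0) _ _ (by simp [hy10, hm0]) hy1 fun θ => ?_
      refine (hmd θ).neg.exp.congr_deriv ?_
      simp only [Pi.neg_apply]
      ring
    have hy1pos : 0 < ∫ θ in (0 : ℝ)..Real.pi, y1 θ := by
      rw [hy1e]
      exact intervalIntegral.intervalIntegral_pos_of_pos
        (hms.neg.exp.continuous.intervalIntegrable _ _) (fun x => Real.exp_pos _) Real.pi_pos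
    have ha : a = 0 := by
      rcases mul_eq_zero.mp (by linarith : a * (∫ θ in (0 : ℝ)..Real.pi, y1 θ) = 0) with h | h
      · exact h
      · exact absurd h hy1pos.ne'
    simp [ha]
  obtain ⟨⟨a, κ⟩, hv⟩ := (LinearMap.injective_iff_surjective.mp hLinj)
    (y3 Real.pi, ∫ θ in (0 : ℝ)..Real.pi, y3 θ)
  have hv1 : a * y1 Real.pi + κ * y2 Real.pi - a = y3 Real.pi := congrArg Prod.fst hv
  have hv2 : a * (∫ θ in (0 : ℝ)..Real.pi, y1 θ) + κ * (∫ θ in (0 : ℝ)..Real.pi, y2 θ)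
      = ∫ θ in (0 : ℝ)..Real.pi, y3 θ := congrArg Prod.snd hv
  obtain ⟨h1, h2, h3⟩ := hkap a κ 1 (by linarith) (by linarith)
  refine ⟨_, hsm a κ 1, h1, ?_, fun θ => ?_⟩
  · rw [hmean]
    linarith
  · rw [h2 θ]
    simp only [one_mul] at h3 ⊢
    rw [← h3]

end WeakDisorder
end

section

open scoped ContDiff

namespace WeakDisorder

/-! ### Laplace moments with a cubic phase -/

/-- Cubic phases with smooth coefficients for which `exp (-(e1 τ + e2 τ² + e3 τ³))` decays
exponentially in `τ`, uniformly in the parameter. -/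
structure IsCubicPhase (e1 e2 e3 : ℝ → ℝ) : Prop where
  smooth1 : ContDiff ℝ ∞ e1
  smooth2 : ContDiff ℝ ∞ e2
  smooth3 : ContDiff ℝ ∞ e3
  periodic1 : Function.Periodic e1 Real.pi
  periodic2 : Function.Periodic e2 Real.pi
  periodic3 : Function.Periodic e3 Real.pi
  decay : ∃ K c : ℝ, 0 < c ∧ ∀ θ τ, 0 ≤ τ →
    Real.exp (-(e1 θ * τ + e2 θ * τ ^ 2 + e3 θ * τ ^ 3)) ≤ K * Real.exp (-(c * τ))

/-- At the band edge the substitution tan ξ = tan θ ∓ τ cos²θ turns the variation-of-constants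
integrals, which are singular at π/2, into such moments. The phase then has coefficients smooth and
periodic in θ, so nothing degenerates at π/2. -/
noncomputable def cubicMoment (e1 e2 e3 : ℝ → ℝ) (k : ℕ) (θ : ℝ) : ℝ :=
  ∫ τ in Set.Ioi (0 : ℝ), τ ^ k * Real.exp (-(e1 θ * τ + e2 θ * τ ^ 2 + e3 θ * τ ^ 3))

lemma integrableOn_pow_mul_exp_neg {c : ℝ} (hc : 0 < c) (k : ℕ) :
    IntegrableOn (fun τ : ℝ => τ ^ k * Real.exp (-(c * τ))) (Set.Ioi 0) := by
  have h := integrableOn_rpow_mul_exp_neg_mul_rpow (p := 1) (s := k) (b := c)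
    (by have : (0 : ℝ) ≤ k := k.cast_nonneg
        linarith) one_pos hc
  refine h.congr_fun (fun τ _ => ?_) measurableSet_Ioi
  simp [Real.rpow_natCast, Real.rpow_one]

lemma IsCubicPhase.integrableOn {e1 e2 e3 : ℝ → ℝ} (h : IsCubicPhase e1 e2 e3) (k : ℕ) (θ : ℝ) :
    IntegrableOn (fun τ => τ ^ k * Real.exp (-(e1 θ * τ + e2 θ * τ ^ 2 + e3 θ * τ ^ 3)))
      (Set.Ioi 0) := by
  obtain ⟨K, c, hc, hK⟩ := h.decay
  refine Integrable.mono' ((integrableOn_pow_mul_exp_neg hc k).const_mul K)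
    (Continuous.aestronglyMeasurable (by fun_prop)) ?_
  filter_upwards [ae_restrict_mem measurableSet_Ioi] with τ hτ
  have hτ' : (0 : ℝ) < τ := hτ
  rw [Real.norm_eq_abs, abs_of_nonneg (by positivity)]
  calc _ ≤ τ ^ k * (K * Real.exp (-(c * τ))) := by
        gcongr
        exact hK θ τ hτ'.le
    _ = _ := by ring

lemma IsCubicPhase.hasDerivAt {e1 e2 e3 : ℝ → ℝ} (h : IsCubicPhase e1 e2 e3) (k : ℕ) (θ : ℝ) :
    HasDerivAt (cubicMoment e1 e2 e3 k)
      (-(deriv e1 θ * cubicMoment e1 e2 e3 (k + 1) θ + deriv e2 θ * cubicMoment e1 e2 e3 (k + 2) θ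
        + deriv e3 θ * cubicMoment e1 e2 e3 (k + 3) θ)) θ := by
  obtain ⟨K, c, hc, hK⟩ := h.decay
  have bd : ∀ e : ℝ → ℝ, ContDiff ℝ ∞ e → Function.Periodic e Real.pi →
      ∃ D, 0 ≤ D ∧ ∀ x, |deriv e x| ≤ D := by
    intro e he hp
    refine exists_bound_of_periodic (he.continuous_deriv (by simp)) fun x => ?_
    rw [← deriv_comp_add_const]
    congr 1
    exact funext hp
  obtain ⟨D1, hD1, b1⟩ := bd e1 h.smooth1 h.periodic1
  obtain ⟨D2, hD2, b2⟩ := bd e2 h.smooth2 h.periodic2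
  obtain ⟨D3, hD3, b3⟩ := bd e3 h.smooth3 h.periodic3
  have key := hasDerivAt_integral_of_dominated_loc_of_deriv_le
    (μ := volume.restrict (Set.Ioi (0 : ℝ))) (s := Set.univ) (x₀ := θ)
    (F := fun θ τ => τ ^ k * Real.exp (-(e1 θ * τ + e2 θ * τ ^ 2 + e3 θ * τ ^ 3)))
    (F' := fun θ τ => -(deriv e1 θ * (τ ^ (k + 1) *
        Real.exp (-(e1 θ * τ + e2 θ * τ ^ 2 + e3 θ * τ ^ 3)))
      + deriv e2 θ * (τ ^ (k + 2) * Real.exp (-(e1 θ * τ + e2 θ * τ ^ 2 + e3 θ * τ ^ 3)))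
      + deriv e3 θ * (τ ^ (k + 3) * Real.exp (-(e1 θ * τ + e2 θ * τ ^ 2 + e3 θ * τ ^ 3)))))
    (bound := fun τ => D1 * K * (τ ^ (k + 1) * Real.exp (-(c * τ)))
      + D2 * K * (τ ^ (k + 2) * Real.exp (-(c * τ))) + D3 * K * (τ ^ (k + 3) * Real.exp (-(c * τ))))
    Filter.univ_mem (Eventually.of_forall fun x => (h.integrableOn k x).aestronglyMeasurable)
    (h.integrableOn k θ) (Continuous.aestronglyMeasurable (by fun_prop)) ?_
    ((((integrableOn_pow_mul_exp_neg hc _).const_mul _).add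
      ((integrableOn_pow_mul_exp_neg hc _).const_mul _)).add
      ((integrableOn_pow_mul_exp_neg hc _).const_mul _)) ?_
  · refine key.2.congr_deriv ?_
    rw [integral_neg, integral_add, integral_add, integral_const_mul, integral_const_mul,
      integral_const_mul]
    · rfl
    · exact (h.integrableOn _ θ).const_mul _
    · exact (h.integrableOn _ θ).const_mul _
    · exact ((h.integrableOn _ θ).const_mul _).add ((h.integrableOn _ θ).const_mul _)
    · exact (h.integrableOn _ θ).const_mul _
  · filter_upwards [ae_restrict_mem measurableSet_Ioi] with τ hτ x _
    have hτ' : (0 : ℝ) < τ := hτ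
    have hE := hK x τ hτ'.le
    set E := Real.exp (-(e1 x * τ + e2 x * τ ^ 2 + e3 x * τ ^ 3)) with hEd
    have hE0 : 0 < E := Real.exp_pos _
    have t : ∀ (d D : ℝ) (j : ℕ), |d| ≤ D → 0 ≤ D →
        |d * (τ ^ j * E)| ≤ D * K * (τ ^ j * Real.exp (-(c * τ))) := by
      intro d D j hd hD
      rw [abs_mul, abs_of_nonneg (by positivity : 0 ≤ τ ^ j * E)]
      calc |d| * (τ ^ j * E) ≤ D * (τ ^ j * (K * Real.exp (-(c * τ)))) := by gcongr
        _ = _ := by ring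
    rw [norm_neg]
    refine (norm_add_le _ _).trans (add_le_add ((norm_add_le _ _).trans (add_le_add ?_ ?_)) ?_)
    · exact t _ _ _ (b1 x) hD1
    · exact t _ _ _ (b2 x) hD2
    · exact t _ _ _ (b3 x) hD3
  · refine Eventually.of_forall fun τ x _ => ?_
    have d1 := (h.smooth1.differentiable (by simp) x).hasDerivAt
    have d2 := (h.smooth2.differentiable (by simp) x).hasDerivAt
    have d3 := (h.smooth3.differentiable (by simp) x).hasDerivAt
    refine ((((d1.mul_const τ).add (d2.mul_const (τ ^ 2))).add
      (d3.mul_const (τ ^ 3))).neg.exp.const_mul (τ ^ k)).congr_deriv ?_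
    simp only [Pi.add_apply, Pi.neg_apply]
    ring

/-- The derivative of a moment is a combination of higher moments with smooth coefficients, so the
induction on the order of differentiability runs over all k at once. -/
lemma IsCubicPhase.contDiff_moment {e1 e2 e3 : ℝ → ℝ} (h : IsCubicPhase e1 e2 e3) (k : ℕ) :
    ContDiff ℝ ∞ (cubicMoment e1 e2 e3 k) := by
  rw [contDiff_infty]
  intro n
  induction n generalizing k with
  | zero =>
    exact contDiff_zero.mpr (continuous_iff_continuousAt.mpr fun θ => (h.hasDerivAt k θ).continuousAt)
  | succ n ih =>
    rw [show ((n + 1 : ℕ) : WithTop ℕ∞) = (n : WithTop ℕ∞) + 1 by push_cast; rfl,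
      contDiff_succ_iff_deriv]
    refine ⟨fun θ => (h.hasDerivAt k θ).differentiableAt, by simp, ?_⟩
    rw [funext fun θ => (h.hasDerivAt k θ).deriv]
    have hd : ∀ e : ℝ → ℝ, ContDiff ℝ ∞ e → ContDiff ℝ n (deriv e) := fun e he =>
      (contDiff_infty_iff_deriv.mp he).2.of_le (by exact_mod_cast le_top)
    exact ((((hd _ h.smooth1).mul (ih _)).add ((hd _ h.smooth2).mul (ih _))).add
      ((hd _ h.smooth3).mul (ih _))).neg

lemma IsCubicPhase.periodic_moment {e1 e2 e3 : ℝ → ℝ} (h : IsCubicPhase e1 e2 e3) (k : ℕ) :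
    Function.Periodic (cubicMoment e1 e2 e3 k) Real.pi := by
  intro x
  simp only [cubicMoment, h.periodic1 x, h.periodic2 x, h.periodic3 x]

lemma IsCubicPhase.moment_zero_pos {e1 e2 e3 : ℝ → ℝ} (h : IsCubicPhase e1 e2 e3) (θ : ℝ) :
    0 < cubicMoment e1 e2 e3 0 θ := by
  rw [cubicMoment, setIntegral_pos_iff_support_of_nonneg_ae]
  · have : (Function.support fun τ => τ ^ 0 *
        Real.exp (-(e1 θ * τ + e2 θ * τ ^ 2 + e3 θ * τ ^ 3))) = Set.univ := by
      ext τ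
      simp [Real.exp_ne_zero]
    rw [this, Set.univ_inter]
    simp
  · exact Eventually.of_forall fun τ => by simp [Real.exp_nonneg]
  · exact h.integrableOn 0 θ

lemma IsCubicPhase.tendsto_pow_mul_exp {e1 e2 e3 : ℝ → ℝ} (h : IsCubicPhase e1 e2 e3) (k : ℕ)
    (θ : ℝ) : Tendsto
      (fun τ => τ ^ k * Real.exp (-(e1 θ * τ + e2 θ * τ ^ 2 + e3 θ * τ ^ 3))) atTop (𝓝 0) := by
  obtain ⟨K, c, hc, hK⟩ := h.decay
  have h1 : Tendsto (fun τ : ℝ => K * (τ ^ k * Real.exp (-(c * τ)))) atTop (𝓝 (K * 0)) := by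
    refine Tendsto.const_mul K ?_
    have := tendsto_rpow_mul_exp_neg_mul_atTop_nhds_zero k c hc
    refine this.congr fun τ => ?_
    rw [Real.rpow_natCast, neg_mul]
  rw [mul_zero] at h1
  refine squeeze_zero' ?_ ?_ h1
  · filter_upwards [eventually_ge_atTop 0] with τ hτ
    positivity
  · filter_upwards [eventually_ge_atTop 0] with τ hτ
    calc _ ≤ τ ^ k * (K * Real.exp (-(c * τ))) := by
          gcongr
          exact hK θ τ hτ
      _ = _ := by ring

/-- Integration of the τ-derivative of τ^k exp(-phase) over the half line. The term 0^k is the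
boundary value at τ = 0; for k = 0 the truncated index k - 1 is multiplied by zero. -/
lemma IsCubicPhase.moment_recursion {e1 e2 e3 : ℝ → ℝ} (h : IsCubicPhase e1 e2 e3) (k : ℕ)
    (θ : ℝ) :
    e1 θ * cubicMoment e1 e2 e3 k θ + 2 * e2 θ * cubicMoment e1 e2 e3 (k + 1) θ
      + 3 * e3 θ * cubicMoment e1 e2 e3 (k + 2) θ
      = (k : ℝ) * cubicMoment e1 e2 e3 (k - 1) θ + 0 ^ k := by
  have hd : ∀ τ ∈ Set.Ici (0 : ℝ), HasDerivAt
      (fun τ => τ ^ k * Real.exp (-(e1 θ * τ + e2 θ * τ ^ 2 + e3 θ * τ ^ 3)))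
      ((k : ℝ) * (τ ^ (k - 1) * Real.exp (-(e1 θ * τ + e2 θ * τ ^ 2 + e3 θ * τ ^ 3)))
        - (e1 θ * (τ ^ k * Real.exp (-(e1 θ * τ + e2 θ * τ ^ 2 + e3 θ * τ ^ 3)))
        + 2 * e2 θ * (τ ^ (k + 1) * Real.exp (-(e1 θ * τ + e2 θ * τ ^ 2 + e3 θ * τ ^ 3)))
        + 3 * e3 θ * (τ ^ (k + 2) * Real.exp (-(e1 θ * τ + e2 θ * τ ^ 2 + e3 θ * τ ^ 3))))) τ := by
    intro τ _
    have h1 := (((hasDerivAt_id τ).const_mul (e1 θ)).add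
      (((hasDerivAt_id τ).pow 2).const_mul (e2 θ))).add (((hasDerivAt_id τ).pow 3).const_mul (e3 θ))
    refine ((hasDerivAt_pow k τ).mul h1.neg.exp).congr_deriv ?_
    simp
    ring
  have hi1 := (h.integrableOn (k - 1) θ).const_mul (k : ℝ)
  have hi2 := (h.integrableOn k θ).const_mul (e1 θ)
  have hi3 := (h.integrableOn (k + 1) θ).const_mul (2 * e2 θ)
  have hi4 := (h.integrableOn (k + 2) θ).const_mul (3 * e3 θ)
  have hi := integral_Ioi_of_hasDerivAt_of_tendsto' hd (hi1.sub ((hi2.add hi3).add hi4))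
    (h.tendsto_pow_mul_exp k θ)
  have e1 := integral_sub hi1 ((hi2.add hi3).add hi4)
  have e2 := integral_add (hi2.add hi3) hi4
  have e3 := integral_add hi2 hi3
  simp only [Pi.add_apply, integral_const_mul] at e1 e2 e3
  rw [e1, e2, e3] at hi
  simp only [cubicMoment]
  simp only [mul_zero, zero_pow (two_ne_zero), zero_pow (three_ne_zero), add_zero, neg_zero,
    Real.exp_zero, mul_one, zero_sub] at hi
  linarith

/-! ### The band edge -/

/-- In the variables s and x = c³τ the form s² + σsx + x²/3 is positive definite, so only a negative
ε c² can hurt. If c² is small it is dominated by s² = 1 - c²; if c² is bounded below, the cubic term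
wins for large τ and the constant K pays for bounded τ. -/
lemma edge_exponent_bound (ε : ℝ) : ∃ K : ℝ, ∀ (σ : ℝ), σ ^ 2 = 1 → ∀ s c τ : ℝ, s ^ 2 + c ^ 2 = 1 →
    0 ≤ τ → τ / 64 - K ≤ (s ^ 2 + ε * c ^ 2) * τ + σ * s * c ^ 3 * τ ^ 2 + c ^ 6 / 3 * τ ^ 3 := by
  set a := |ε| + 1 with ha
  have ha1 : 1 ≤ a := by have := abs_nonneg ε; linarith
  -- The lower bound for c⁶ in the case c² a > 3/64. The constant K below comes from the threshold
  -- τ² = 16a/d, beyond which the cubic term is dominant.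
  set d := (3 / (64 * a)) ^ 3 with hd
  have hd0 : 0 < d := by positivity
  refine ⟨a * (1 + 16 * a / d), fun σ hσ s c τ hsc hτ => ?_⟩
  have hC0 : 0 ≤ c ^ 2 := sq_nonneg c
  have hC1 : c ^ 2 ≤ 1 := by nlinarith [sq_nonneg s]
  have hε : -(a - 1) ≤ ε := by rw [ha]; have := neg_abs_le ε; linarith
  have hlow : (3 / 64 - c ^ 2 * a + (c ^ 2) ^ 3 * τ ^ 2 / 16) * τ + τ / 64
      ≤ (s ^ 2 + ε * c ^ 2) * τ + σ * s * c ^ 3 * τ ^ 2 + c ^ 6 / 3 * τ ^ 3 := by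
    have h1 : (3 / 64 - c ^ 2 * a + (c ^ 2) ^ 3 * τ ^ 2 / 16) + 1 / 64
        ≤ (s ^ 2 + ε * c ^ 2) + σ * s * (c ^ 3 * τ) + (c ^ 3 * τ) ^ 2 / 3 := by
      have h2 : (s ^ 2 + (c ^ 3 * τ) ^ 2) / 16
          ≤ s ^ 2 + σ * s * (c ^ 3 * τ) + (c ^ 3 * τ) ^ 2 / 3 := by
        have e : s ^ 2 = (σ * s) ^ 2 := by rw [mul_pow, hσ, one_mul]
        rw [e]
        nlinarith [sq_nonneg (15 * (σ * s) + 8 * (c ^ 3 * τ)), sq_nonneg (c ^ 3 * τ)]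
      have h3 : -(a - 1) * c ^ 2 ≤ ε * c ^ 2 := by gcongr
      have h4 : s ^ 2 = 1 - c ^ 2 := by linarith
      nlinarith
    calc _ = ((3 / 64 - c ^ 2 * a + (c ^ 2) ^ 3 * τ ^ 2 / 16) + 1 / 64) * τ := by ring
      _ ≤ _ := mul_le_mul_of_nonneg_right h1 hτ
      _ = _ := by ring
  refine le_trans ?_ hlow
  suffices -(a * (1 + 16 * a / d)) ≤ (3 / 64 - c ^ 2 * a + (c ^ 2) ^ 3 * τ ^ 2 / 16) * τ by linarith
  have hK : 0 ≤ a * (1 + 16 * a / d) := by positivity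
  rcases le_or_gt (c ^ 2 * a) (3 / 64) with h | h
  · have : 0 ≤ (3 / 64 - c ^ 2 * a + (c ^ 2) ^ 3 * τ ^ 2 / 16) * τ := by
      apply mul_nonneg _ hτ
      have : 0 ≤ (c ^ 2) ^ 3 * τ ^ 2 / 16 := by positivity
      linarith
    linarith
  · have hδ : 3 / (64 * a) ≤ c ^ 2 := by
      rw [div_le_iff₀ (by positivity)]
      linarith
    have hd' : d ≤ (c ^ 2) ^ 3 := pow_le_pow_left₀ (by positivity) hδ 3
    have h1 : (d * τ ^ 2 / 16 - a) * τ ≤ (3 / 64 - c ^ 2 * a + (c ^ 2) ^ 3 * τ ^ 2 / 16) * τ := by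
      apply mul_le_mul_of_nonneg_right _ hτ
      have : d * τ ^ 2 ≤ (c ^ 2) ^ 3 * τ ^ 2 := by gcongr
      nlinarith
    refine le_trans ?_ h1
    rcases le_or_gt (16 * a / d) (τ ^ 2) with h2 | h2
    · rw [div_le_iff₀ hd0] at h2
      have : 0 ≤ (d * τ ^ 2 / 16 - a) * τ := mul_nonneg (by linarith) hτ
      linarith
    · have h3 : τ ≤ 1 + τ ^ 2 := by nlinarith [sq_nonneg (τ - 1)]
      have h4 : τ ≤ 1 + 16 * a / d := by linarith
      have h5 : a * τ ≤ a * (1 + 16 * a / d) := by gcongr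
      have h6 : 0 ≤ d * τ ^ 2 / 16 * τ := by positivity
      nlinarith

lemma isCubicPhase_edge {D : ℝ} (hD : 0 < D) (ε σ : ℝ) (hσ : σ ^ 2 = 1) :
    IsCubicPhase (fun θ => 2 / D * (Real.sin θ ^ 2 + ε * Real.cos θ ^ 2))
      (fun θ => 2 / D * (σ * Real.sin θ * Real.cos θ ^ 3))
      (fun θ => 2 / D * (Real.cos θ ^ 6 / 3)) := by
  refine ⟨by fun_prop, by fun_prop, by fun_prop, fun θ => ?_, fun θ => ?_, fun θ => ?_, ?_⟩
  · simp [Real.sin_add_pi, Real.cos_add_pi]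
  · simp only [Real.sin_add_pi, Real.cos_add_pi]; ring
  · simp only [Real.cos_add_pi]; ring
  · obtain ⟨K, hK⟩ := edge_exponent_bound ε
    refine ⟨Real.exp (2 / D * K), 2 / D / 64, by positivity, fun θ τ hτ => ?_⟩
    rw [← Real.exp_add, Real.exp_le_exp]
    have h1 := mul_le_mul_of_nonneg_left
      (hK σ hσ (Real.sin θ) (Real.cos θ) τ (Real.sin_sq_add_cos_sq θ) hτ)
      (by positivity : 0 ≤ 2 / D)
    linarith

end WeakDisorder
end

section

open scoped ContDiff

namespace WeakDisorder

/-- Moments of the band edge phase; `σ = -1` gives the ground state and `σ = 1` the Poisson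
equation. -/
noncomputable def edgeMoment (D ε σ : ℝ) : ℕ → ℝ → ℝ :=
  cubicMoment (fun θ => 2 / D * (Real.sin θ ^ 2 + ε * Real.cos θ ^ 2))
    (fun θ => 2 / D * (σ * Real.sin θ * Real.cos θ ^ 3)) (fun θ => 2 / D * (Real.cos θ ^ 6 / 3))

lemma hasDerivAt_edgeMoment {D : ℝ} (hD : 0 < D) (ε σ : ℝ) (hσ : σ ^ 2 = 1) (k : ℕ) (θ : ℝ) :
    HasDerivAt (edgeMoment D ε σ k)
      (-(2 / D) * (2 * (1 - ε) * Real.sin θ * Real.cos θ * edgeMoment D ε σ (k + 1) θ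
        + σ * (Real.cos θ ^ 4 - 3 * Real.sin θ ^ 2 * Real.cos θ ^ 2) * edgeMoment D ε σ (k + 2) θ
        - 2 * Real.cos θ ^ 5 * Real.sin θ * edgeMoment D ε σ (k + 3) θ)) θ := by
  have hs := Real.hasDerivAt_sin θ
  have hc := Real.hasDerivAt_cos θ
  refine ((isCubicPhase_edge hD ε σ hσ).hasDerivAt k θ).congr_deriv ?_
  have d1 := (((hs.pow 2).add ((hc.pow 2).const_mul ε)).const_mul (2 / D)).deriv
  have d2 := (((hs.const_mul σ).mul (hc.pow 3)).const_mul (2 / D)).deriv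
  have d3 := (((hc.pow 6).div_const 3).const_mul (2 / D)).deriv
  simp only [Pi.add_def, Pi.mul_def, Pi.pow_def] at d1 d2 d3
  rw [d1, d2, d3]
  simp only [edgeMoment]
  push_cast
  ring

lemma edgeMoment_recursion {D : ℝ} (hD : 0 < D) (ε σ : ℝ) (hσ : σ ^ 2 = 1) (k : ℕ) (θ : ℝ) :
    2 * ((Real.sin θ ^ 2 + ε * Real.cos θ ^ 2) * edgeMoment D ε σ k θ
      + 2 * (σ * Real.sin θ * Real.cos θ ^ 3) * edgeMoment D ε σ (k + 1) θ
      + Real.cos θ ^ 6 * edgeMoment D ε σ (k + 2) θ)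
      = D * ((k : ℝ) * edgeMoment D ε σ (k - 1) θ + 0 ^ k) := by
  have h := (isCubicPhase_edge hD ε σ hσ).moment_recursion k θ
  simp only [edgeMoment]
  rw [← h]
  field_simp

lemma edgeQ_eq (D ε θ : ℝ) : edgeQ D ε θ
    = -2 * Real.sin θ ^ 2 - 2 * ε * Real.cos θ ^ 2 - 2 * D * Real.cos θ ^ 3 * Real.sin θ := by
  rw [edgeQ, Real.cos_two_mul]
  linear_combination 2 * Real.sin_sq_add_cos_sq θ

lemma hasDerivAt_edgeP (D θ : ℝ) :
    HasDerivAt (edgeP D) (-4 * D * Real.cos θ ^ 3 * Real.sin θ) θ := by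
  refine (((Real.hasDerivAt_cos θ).pow 4).const_mul D).congr_deriv ?_
  push_cast
  ring

lemma contDiff_edgeP (D : ℝ) : ContDiff ℝ ∞ (edgeP D) := by
  unfold edgeP
  fun_prop

lemma contDiff_edgeQ (D ε : ℝ) : ContDiff ℝ ∞ (edgeQ D ε) := by
  unfold edgeQ
  fun_prop

lemma periodic_edgeP (D : ℝ) : Function.Periodic (edgeP D) Real.pi := by
  intro θ
  simp only [edgeP, Real.cos_add_pi]
  ring

/-- The flux of the unnormalized band edge ground state is `D`. -/
lemma edge_flux {D : ℝ} (hD : 0 < D) (ε θ : ℝ) :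
    HasDerivAt (fun s => edgeP D s * edgeMoment D ε (-1) 0 s)
      (edgeQ D ε θ * edgeMoment D ε (-1) 0 θ + D) θ := by
  refine ((hasDerivAt_edgeP D θ).mul
    (hasDerivAt_edgeMoment hD ε (-1) (by norm_num) 0 θ)).congr_deriv ?_
  have r0 := edgeMoment_recursion hD ε (-1) (by norm_num) 0 θ
  have r1 := edgeMoment_recursion hD ε (-1) (by norm_num) 1 θ
  have hs := Real.sin_sq_add_cos_sq θ
  rw [edgeQ_eq, edgeP]
  norm_num at r0 r1 ⊢
  generalize edgeMoment D ε (-1) 0 θ = φ0 at *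
  generalize edgeMoment D ε (-1) 1 θ = φ1 at *
  generalize edgeMoment D ε (-1) 2 θ = φ2 at *
  generalize edgeMoment D ε (-1) 3 θ = φ3 at *
  generalize Real.sin θ = s at *
  generalize Real.cos θ = c at *
  field_simp
  -- Differentiation raises the moments to order three; the recursions for k = 0 and k = 1 bring
  -- them back to order zero.
  linear_combination r0 + 2 * s * c ^ 3 * r1 +
    (-4 * s * c ^ 3 * φ1 + 2 * c ^ 6 * φ2) * hs

/-- The integrating factor turns the flux equation into an exact derivative. -/
lemma hasDerivAt_edge_integrated {D ε c : ℝ} (hD : 0 < D) {ρ : ℝ → ℝ}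
    (hρ : Differentiable ℝ ρ)
    (hfl : ∀ θ, HasDerivAt (fun s => edgeP D s * ρ s) (edgeQ D ε θ * ρ θ + c) θ)
    {θ : ℝ} (h : Real.cos θ ≠ 0) :
    HasDerivAt (fun x => ρ x * Real.cos x ^ 2 *
        Real.exp (2 / (3 * D) * (Real.tan x ^ 3 + 3 * ε * Real.tan x)))
      (c / D * (Real.exp (2 / (3 * D) * (Real.tan θ ^ 3 + 3 * ε * Real.tan θ))
        / Real.cos θ ^ 2)) θ := by
  have e1 := (hfl θ).unique ((hasDerivAt_edgeP D θ).mul (hρ θ).hasDerivAt)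
  have ht := Real.hasDerivAt_tan h
  have h1 := (((hρ θ).hasDerivAt.mul ((Real.hasDerivAt_cos θ).pow 2)).mul
    (((ht.pow 3).add (ht.const_mul (3 * ε))).const_mul (2 / (3 * D))).exp)
  refine h1.congr_deriv ?_
  rw [edgeQ_eq, edgeP] at e1
  simp only [Pi.add_apply, Pi.pow_apply, Pi.mul_apply, Real.tan_eq_sin_div_cos]
  generalize Real.exp _ = E
  generalize deriv ρ θ = ρ' at *
  generalize ρ θ = r at *
  generalize Real.sin θ = s at *
  generalize Real.cos θ = x at *
  push_cast
  field_simp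
  linear_combination -E * e1

/-- As x tends to -π/2 the cubic tan³x dominates and tends to -∞, so the integrating factor stays
bounded on the left part of the interval. This gives the vanishing boundary value in the integrated
flux equation. -/
lemma exists_exp_tan_le {D : ℝ} (hD : 0 < D) (ε : ℝ) {b : ℝ} (hb : b < Real.pi / 2) :
    ∃ L : ℝ, ∀ x, -(Real.pi / 2) < x → x ≤ b →
      Real.exp (2 / (3 * D) * (Real.tan x ^ 3 + 3 * ε * Real.tan x)) ≤ L := by
  refine ⟨Real.exp (2 / (3 * D) * ((|Real.tan b| + 3 * |ε| + 1) ^ 3 +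
      3 * |ε| * (|Real.tan b| + 3 * |ε| + 1))), fun x hx hxb => ?_⟩
  have hmono : Real.tan x ≤ |Real.tan b| := by
    refine le_trans ?_ (le_abs_self _)
    rcases hxb.lt_or_eq with h | h
    · exact (Real.tan_lt_tan_of_lt_of_lt_pi_div_two hx hb h).le
    · rw [h]
  apply Real.exp_le_exp.mpr
  apply mul_le_mul_of_nonneg_left _ (by positivity)
  set t := Real.tan x
  set B := |Real.tan b|
  have hB : 0 ≤ B := abs_nonneg _
  have hE : 0 ≤ |ε| := abs_nonneg _
  have hε := abs_le.mp (le_refl |ε|)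
  have hR : 0 ≤ (B + 3 * |ε| + 1) ^ 3 + 3 * |ε| * (B + 3 * |ε| + 1) := by positivity
  rcases le_or_gt 0 t with h | h
  · have h1 : t ≤ B + 3 * |ε| + 1 := by linarith
    have h2 : t ^ 3 ≤ (B + 3 * |ε| + 1) ^ 3 := pow_le_pow_left₀ h h1 3
    have h3 : 3 * ε * t ≤ 3 * |ε| * (B + 3 * |ε| + 1) := by
      have : ε * t ≤ |ε| * (B + 3 * |ε| + 1) := by
        calc ε * t ≤ |ε| * t := by gcongr; exact hε.2
          _ ≤ _ := by gcongr
      linarith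
    linarith
  · rcases le_or_gt (t ^ 2 + 3 * ε) 0 with h4 | h4
    · -- here `t` is bounded by `3 |ε| + 1`
      have h5 : -t ≤ 3 * |ε| + 1 := by nlinarith [sq_nonneg (t + 1)]
      have h6 : t ^ 3 + 3 * ε * t ≤ 3 * |ε| * (-t) := by
        have : t ^ 3 ≤ 0 := by nlinarith [sq_nonneg t]
        nlinarith
      have h7 : 3 * |ε| * (-t) ≤ 3 * |ε| * (B + 3 * |ε| + 1) := by
        apply mul_le_mul_of_nonneg_left _ (by positivity)
        linarith
      have : 0 ≤ (B + 3 * |ε| + 1) ^ 3 := by positivity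
      linarith
    · nlinarith

/-- A bounded solution of the flux equation is a multiple of the explicit integral. -/
lemma edge_integrated_eq {D ε c : ℝ} (hD : 0 < D) {ρ : ℝ → ℝ}
    (hρ : Differentiable ℝ ρ) (hper : Function.Periodic ρ Real.pi)
    (hfl : ∀ θ, HasDerivAt (fun s => edgeP D s * ρ s) (edgeQ D ε θ * ρ θ + c) θ)
    {θ : ℝ} (h1 : -(Real.pi / 2) < θ) (h2 : θ < Real.pi / 2) :
    c / D * edgeDensity D ε θ = ρ θ := by
  obtain ⟨L, hL⟩ := exists_exp_tan_le hD ε h2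
  have hcos : ∀ x, -(Real.pi / 2) < x → x ≤ θ → 0 < Real.cos x := fun x hx hxθ =>
    Real.cos_pos_of_mem_Ioo ⟨hx, lt_of_le_of_lt hxθ h2⟩
  have hFTC : ∀ (ρ : ℝ → ℝ) (c : ℝ), Differentiable ℝ ρ → Function.Periodic ρ Real.pi →
    (∀ θ, HasDerivAt (fun s => edgeP D s * ρ s) (edgeQ D ε θ * ρ θ + c) θ) → 0 ≤ c →
    ∫ ξ in (-(Real.pi / 2))..θ, (c / D * (Real.exp (2 / (3 * D) *
        (Real.tan ξ ^ 3 + 3 * ε * Real.tan ξ)) / Real.cos ξ ^ 2))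
      = ρ θ * Real.cos θ ^ 2 * Real.exp (2 / (3 * D) * (Real.tan θ ^ 3 + 3 * ε * Real.tan θ)) := by
    intro ρ c hρ hper hfl hc
    obtain ⟨B, hB0, hB⟩ := exists_bound_of_periodic hρ.continuous hper
    -- The factor cos² gives Ψ the limit 0 at -π/2. The value there is also 0, whatever the
    -- conventional value of `Real.tan` at that point.
    set Ψ : ℝ → ℝ := fun x => ρ x * Real.cos x ^ 2 *
        Real.exp (2 / (3 * D) * (Real.tan x ^ 3 + 3 * ε * Real.tan x)) with hΨ
    have hd : ∀ x ∈ Set.Ioo (-(Real.pi / 2)) θ, HasDerivAt Ψ _ x := fun x hx =>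
      hasDerivAt_edge_integrated hD hρ hfl (hcos x hx.1 hx.2.le).ne'
    have h0 : Ψ (-(Real.pi / 2)) = 0 := by simp [hΨ]
    have hcont : ContinuousOn Ψ (Set.Icc (-(Real.pi / 2)) θ) := by
      intro x hx
      rcases hx.1.eq_or_lt with h | h
      · rw [← h]
        have hlim : Tendsto (fun x => B * Real.cos x ^ 2 * L)
            (𝓝[Set.Icc (-(Real.pi / 2)) θ] (-(Real.pi / 2))) (𝓝 0) := by
          have : Continuous fun x => B * Real.cos x ^ 2 * L := by fun_prop
          have := this.tendsto (-(Real.pi / 2))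
          simp only [Real.cos_neg, Real.cos_pi_div_two] at this
          norm_num at this
          exact this.mono_left nhdsWithin_le_nhds
        rw [ContinuousWithinAt, h0]
        refine squeeze_zero_norm' ?_ hlim
        filter_upwards [self_mem_nhdsWithin] with y hy
        rcases hy.1.eq_or_lt with h' | h'
        · rw [← h', h0]
          simp
        · simp only [hΨ, Real.norm_eq_abs, abs_mul, abs_pow, Real.abs_exp, sq_abs]
          have e1 := hL y h' hy.2
          gcongr
          exact hB y
      · exact (hasDerivAt_edge_integrated hD hρ hfl
          (hcos x h hx.2).ne').continuousAt.continuousWithinAt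
    -- For c ≥ 0 the derivative is nonnegative, so its integrability comes for free from the
    -- continuity of Ψ. Negative c is reduced to this case at the end.
    have hint := intervalIntegral.integrableOn_deriv_of_nonneg hcont hd (fun x hx => by positivity)
    rw [intervalIntegral.integral_eq_sub_of_hasDerivAt_of_le h1.le hcont hd
      ((intervalIntegrable_iff_integrableOn_Ioc_of_le h1.le).mpr hint), h0, sub_zero]
  have hmain : ∀ (ρ : ℝ → ℝ) (c : ℝ), Differentiable ℝ ρ → Function.Periodic ρ Real.pi →
    (∀ θ, HasDerivAt (fun s => edgeP D s * ρ s) (edgeQ D ε θ * ρ θ + c) θ) → 0 ≤ c →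
    c / D * edgeDensity D ε θ = ρ θ := by
    intro ρ c hρ hper hfl hc
    have h3 := hFTC ρ c hρ hper hfl hc
    have hc := (hcos θ h1 le_rfl).ne'
    have hden : edgeDensity D ε θ = (∫ ξ in (-(Real.pi / 2))..θ, (Real.exp (2 / (3 * D) *
        (Real.tan ξ ^ 3 + 3 * ε * Real.tan ξ)) / Real.cos ξ ^ 2)) *
        (Real.exp (-(2 / (3 * D) * (Real.tan θ ^ 3 + 3 * ε * Real.tan θ))) / Real.cos θ ^ 2) := by
      rw [edgeDensity, ← intervalIntegral.integral_mul_const]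
      refine intervalIntegral.integral_congr fun ξ _ => ?_
      have : Real.exp (2 / (3 * D) * (Real.tan ξ ^ 3 - Real.tan θ ^ 3 + 3 * ε * Real.tan ξ
          - 3 * ε * Real.tan θ)) = Real.exp (2 / (3 * D) * (Real.tan ξ ^ 3 + 3 * ε * Real.tan ξ)) *
          Real.exp (-(2 / (3 * D) * (Real.tan θ ^ 3 + 3 * ε * Real.tan θ))) := by
        rw [← Real.exp_add]
        ring_nf
      rw [this]
      ring
    rw [intervalIntegral.integral_const_mul] at h3
    rw [hden, ← mul_assoc, h3, Real.exp_neg]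
    have := (Real.exp_pos (2 / (3 * D) * (Real.tan θ ^ 3 + 3 * ε * Real.tan θ))).ne'
    field_simp
  -- The flux equation is linear: for c < 0 it is applied to -ρ and -c. No positivity of ρ was used.
  rcases le_total 0 c with hc | hc
  · exact hmain ρ c hρ hper hfl hc
  · have := hmain (fun x => -ρ x) (-c) hρ.neg (fun x => by simp only [hper x])
      (fun θ => by
        have h3 := (hfl θ).neg
        refine (h3.congr_deriv ?_).congr_of_eventuallyEq (Eventually.of_forall fun x => ?_)
        · ring
        · simp) (by linarith)
    linear_combination -this

lemma edge_eq_of_eqOn {f g : ℝ → ℝ} (hf : Continuous f) (hg : Continuous g)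
    (hfp : Function.Periodic f Real.pi) (hgp : Function.Periodic g Real.pi)
    (h : ∀ θ, -(Real.pi / 2) < θ → θ < Real.pi / 2 → f θ = g θ) : f = g := by
  have h1 : Set.EqOn f g (closure (Set.Ioo (-(Real.pi / 2)) (Real.pi / 2))) :=
    Set.EqOn.closure (fun θ hθ => h θ hθ.1 hθ.2) hf hg
  rw [closure_Ioo (by linarith [Real.pi_pos])] at h1
  funext x
  have hd : Function.Periodic (fun x => f x - g x) Real.pi := fun x => by
    simp only [hfp x, hgp x]
  obtain ⟨y, hy, hxy⟩ := hd.exists_mem_Ico Real.pi_pos x (-(Real.pi / 2))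
  have := h1 ⟨hy.1, by linarith [hy.2]⟩
  linarith

lemma periodic_edgeMoment {D : ℝ} (hD : 0 < D) (ε σ : ℝ) (hσ : σ ^ 2 = 1) (k : ℕ) :
    Function.Periodic (edgeMoment D ε σ k) Real.pi :=
  (isCubicPhase_edge hD ε σ hσ).periodic_moment k

lemma contDiff_edgeMoment {D : ℝ} (hD : 0 < D) (ε σ : ℝ) (hσ : σ ^ 2 = 1) (k : ℕ) :
    ContDiff ℝ ∞ (edgeMoment D ε σ k) :=
  (isCubicPhase_edge hD ε σ hσ).contDiff_moment k

/-- The zeroth moment with σ = -1 is positive, smooth and satisfies the flux equation, so it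
normalizes to a ground state. Any other ground state equals, on the open interval, a multiple of the
same explicit integral; continuity extends this across π/2 and normalization fixes the multiple. -/
lemma exists_edge_groundState {D : ℝ} (hD : 0 < D) (ε : ℝ) :
    ∃ ρ : ℝ → ℝ, IsGroundState (edgeP D) (edgeQ D ε) ρ ∧
      (∀ ρ', IsGroundState (edgeP D) (edgeQ D ε) ρ' → ρ' = ρ) ∧
      ∃ C : ℝ, 0 < C ∧ ∀ θ, -(Real.pi / 2) < θ → θ < Real.pi / 2 → ρ θ = C * edgeDensity D ε θ := by
  have hper := periodic_edgeMoment hD ε (-1) (by norm_num) 0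
  have hs := contDiff_edgeMoment hD ε (-1) (by norm_num) 0
  have hpos : ∀ θ, 0 < edgeMoment D ε (-1) 0 θ :=
    (isCubicPhase_edge hD ε (-1) (by norm_num)).moment_zero_pos
  have hden : ∀ θ, -(Real.pi / 2) < θ → θ < Real.pi / 2 →
      edgeDensity D ε θ = edgeMoment D ε (-1) 0 θ := by
    intro θ h1 h2
    -- The integrated flux equation applied to the moment itself, whose flux is D, so that the
    -- prefactor is D/D.
    rw [← edge_integrated_eq hD (hs.differentiable (by simp)) hper (edge_flux hD ε) h1 h2,
      div_self hD.ne', one_mul]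
  set Z := ∫ θ in (0 : ℝ)..Real.pi, edgeMoment D ε (-1) 0 θ with hZ
  have hZpos : 0 < Z := intervalIntegral.intervalIntegral_pos_of_pos
    (hs.continuous.intervalIntegrable _ _) hpos Real.pi_pos
  refine ⟨fun θ => Z⁻¹ * edgeMoment D ε (-1) 0 θ, ?_, fun ρ' hρ' => ?_, Z⁻¹, by positivity,
    fun θ h1 h2 => by rw [hden θ h1 h2]⟩
  · refine isGroundState_of_flux (c := Z⁻¹ * D) (contDiff_const.mul hs)
      (fun x => by simp only [hper x]) (fun θ => (mul_pos (inv_pos.mpr hZpos) (hpos θ)).le) ?_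
      fun θ => ?_
    · rw [intervalIntegral.integral_const_mul, inv_mul_cancel₀ hZpos.ne']
    · refine (((edge_flux hD ε θ).const_mul Z⁻¹).congr_deriv (by ring)).congr_of_eventuallyEq
        (Eventually.of_forall fun x => ?_)
      simp only
      ring
  · obtain ⟨c, hc⟩ := exists_flux (contDiff_edgeP D) (contDiff_edgeQ D ε) hρ'
    have h3 : ρ' = fun θ => c / D * edgeMoment D ε (-1) 0 θ := by
      refine edge_eq_of_eqOn hρ'.smooth.continuous (continuous_const.mul hs.continuous)
        hρ'.periodic (fun x => by simp only [hper x]) fun θ h1 h2 => ?_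
      rw [← hden θ h1 h2, edge_integrated_eq hD (hρ'.smooth.differentiable (by simp))
        hρ'.periodic hc h1 h2]
    have h4 := hρ'.normalized
    rw [h3, intervalIntegral.integral_const_mul, ← hZ] at h4
    rw [h3, eq_inv_of_mul_eq_one_left h4]

/-- The Poisson equation at the band edge; `h` is the derivative of its solution. -/
lemma exists_edge_poisson {D : ℝ} (hD : 0 < D) (ε : ℝ) {ρ : ℝ → ℝ}
    (hρ : IsGroundState (edgeP D) (edgeQ D ε) ρ) :
    ∃ h : ℝ → ℝ, ContDiff ℝ ∞ h ∧ Function.Periodic h Real.pi ∧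
      (∫ θ in (0 : ℝ)..Real.pi, h θ = 0) ∧
      ∀ θ, edgeP D θ * deriv h θ + edgeQ D ε θ * h θ = 2 * (edgeCoefficient D ε ρ -
        ((1 - ε) / 2 * Real.sin (2 * θ)
          + D / 8 * (1 + 2 * Real.cos (2 * θ) + Real.cos (4 * θ)))) := by
  have h1 : (1 : ℝ) ^ 2 = 1 := by norm_num
  set φ := edgeMoment D ε 1 with hφ
  have hper : ∀ k, Function.Periodic (φ k) Real.pi := periodic_edgeMoment hD ε 1 h1
  have hs : ∀ k, ContDiff ℝ ∞ (φ k) := contDiff_edgeMoment hD ε 1 h1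
  have hpos : ∀ θ, 0 < φ 0 θ := (isCubicPhase_edge hD ε 1 h1).moment_zero_pos
  -- This is -tan θ + (2/D)(tan θ φ₀ + cos²θ φ₁), with the pole at π/2 cancelled by the recursion
  -- for k = 0. The summand -tan θ, the derivative of log|cos θ|, passes from the growth of the
  -- vector to that of its first coordinate and reduces the inhomogeneity to a multiple of tan θ.
  -- The rest is the bounded solution for that inhomogeneity, obtained by integrating from tan θ to
  -- +∞.
  set H : ℝ → ℝ := fun θ => 2 / D * (Real.sin θ * Real.cos θ * (1 - ε) * φ 0 θ
    + (Real.cos θ ^ 2 - 2 * Real.sin θ ^ 2 * Real.cos θ ^ 2) * φ 1 θ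
    - Real.sin θ * Real.cos θ ^ 5 * φ 2 θ) with hH
  have hHs : ContDiff ℝ ∞ H := by
    have := hs 0
    have := hs 1
    have := hs 2
    fun_prop
  have hHper : Function.Periodic H Real.pi := by
    intro θ
    simp only [hH, hper 0 θ, hper 1 θ, hper 2 θ, Real.sin_add_pi, Real.cos_add_pi]
    ring
  set Z := ∫ θ in (0 : ℝ)..Real.pi, φ 0 θ with hZ
  have hZpos : 0 < Z := intervalIntegral.intervalIntegral_pos_of_pos
    ((hs 0).continuous.intervalIntegrable _ _) hpos Real.pi_pos
  -- (2/D)φ₀ is minus the solution with right-hand side 2; its multiple κ is chosen so that h has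
  -- mean zero.
  set κ := (∫ θ in (0 : ℝ)..Real.pi, H θ) / (2 / D * Z) with hκ
  set h : ℝ → ℝ := fun θ => H θ - κ * (2 / D) * φ 0 θ with hh
  have hhs : ContDiff ℝ ∞ h := by
    have := hs 0
    fun_prop
  have hhper : Function.Periodic h Real.pi := fun θ => by simp only [hh, hHper θ, hper 0 θ]
  have hmean : ∫ θ in (0 : ℝ)..Real.pi, h θ = 0 := by
    have c0 := (hs 0).continuous
    rw [hh, intervalIntegral.integral_sub (hHs.continuous.intervalIntegrable _ _)
      (Continuous.intervalIntegrable (by fun_prop) _ _),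
      intervalIntegral.integral_const_mul (κ * (2 / D)), ← hZ, hκ]
    field_simp
    ring
  have heq : ∀ θ, edgeP D θ * deriv h θ + edgeQ D ε θ * h θ = 2 * κ - 2 *
        ((1 - ε) / 2 * Real.sin (2 * θ)
          + D / 8 * (1 + 2 * Real.cos (2 * θ) + Real.cos (4 * θ))) := by
    intro θ
    have hsin := Real.hasDerivAt_sin θ
    have hcos := Real.hasDerivAt_cos θ
    have d0 := hasDerivAt_edgeMoment hD ε 1 h1 0 θ
    have d1 := hasDerivAt_edgeMoment hD ε 1 h1 1 θ
    have d2 := hasDerivAt_edgeMoment hD ε 1 h1 2 θ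
    have hd := (((((hsin.mul hcos).mul_const (1 - ε)).mul d0).add
      (((hcos.pow 2).sub (((hsin.pow 2).const_mul 2).mul (hcos.pow 2))).mul d1)).sub
      ((hsin.mul (hcos.pow 5)).mul d2)).const_mul (2 / D) |>.sub (d0.const_mul (κ * (2 / D)))
    have hd' : deriv h θ = _ := HasDerivAt.deriv (f := h) hd
    rw [hd', hh, hH, edgeQ_eq, edgeP]
    have r0 := edgeMoment_recursion hD ε 1 h1 0 θ
    have r1 := edgeMoment_recursion hD ε 1 h1 1 θ
    have r2 := edgeMoment_recursion hD ε 1 h1 2 θ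
    have r3 := edgeMoment_recursion hD ε 1 h1 3 θ
    have c4 : Real.cos (4 * θ) = 2 * (2 * Real.cos θ ^ 2 - 1) ^ 2 - 1 := by
      rw [show 4 * θ = 2 * (2 * θ) by ring, Real.cos_two_mul (2 * θ), Real.cos_two_mul θ]
    rw [c4, Real.cos_two_mul, Real.sin_two_mul]
    have hsc := Real.sin_sq_add_cos_sq θ
    clear_value κ
    simp only [← hφ, Pi.mul_apply, Pi.pow_apply, Pi.sub_apply] at r0 r1 r2 r3 ⊢
    norm_num at r0 r1 r2 r3 ⊢
    clear hd hd' d0 d1 d2 hcos hsin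
    generalize φ 0 θ = f0 at *
    generalize φ 1 θ = f1 at *
    generalize φ 2 θ = f2 at *
    generalize φ 3 θ = f3 at *
    generalize φ 4 θ = f4 at *
    generalize φ 5 θ = f5 at *
    generalize Real.sin θ = s at *
    generalize Real.cos θ = c at *
    have s2 : s ^ 2 = 1 - c ^ 2 := by linarith
    have s3 : s ^ 3 = s * (1 - c ^ 2) := by rw [← s2]; ring
    have s4 : s ^ 4 = (1 - c ^ 2) ^ 2 := by rw [← s2]; ring
    have s5 : s ^ 5 = s * (1 - c ^ 2) ^ 2 := by rw [← s2]; ring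
    -- The derivative of H contains moments up to order five, which the recursions for k = 0, …, 3
    -- eliminate; even powers of the sine are then expressed through the cosine.
    linear_combination (norm := skip) -(2 / D) * ((s * c * (1 - ε) - κ) * r0
      + (c ^ 2 - 2 * s ^ 2 * c ^ 2 - 2 * s * c ^ 3 * (s * c * (1 - ε) - κ)) * r1
      + (-s * c ^ 5 - 2 * s * c ^ 3 * (c ^ 2 - 2 * s ^ 2 * c ^ 2)) * r2
      + 2 * s ^ 2 * c ^ 8 * r3) - c ^ 2 * (2 * c ^ 2 - 1) * r0
    field_simp
    ring_nf
    simp only [s2, s3, s4, s5]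
    ring
  have hk := eq_integral_of_poisson (κ := 2 * κ) (contDiff_edgeP D) (contDiff_edgeQ D ε)
    (periodic_edgeP D) hρ (fun θ => (hhs.differentiable (by simp) θ).hasDerivAt)
    (hhs.continuous_deriv (by simp)) hhper hmean (F := fun θ => 2 *
        ((1 - ε) / 2 * Real.sin (2 * θ)
          + D / 8 * (1 + 2 * Real.cos (2 * θ) + Real.cos (4 * θ)))) (by fun_prop) heq
  have hκ' : 2 * κ = 2 * edgeCoefficient D ε ρ := by
    have cρ := hρ.smooth.continuous
    rw [hk, edgeCoefficient, mul_add, ← intervalIntegral.integral_const_mul,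
      ← intervalIntegral.integral_const_mul, ← intervalIntegral.integral_const_mul,
      ← intervalIntegral.integral_const_mul, ← intervalIntegral.integral_add]
    · congr 1
      funext θ
      ring
    all_goals exact Continuous.intervalIntegrable (by fun_prop) _ _
  refine ⟨h, hhs, hhper, hmean, fun θ => ?_⟩
  rw [heq θ, hκ']
  ring

end WeakDisorder
end

namespace WeakDisorder

/-! ### Decorrelation of quasi-local observables -/

/-- The variation of `f` over configurations that agree on `[k, l]` is at most `e`. -/
def VariesBy {A : Type*} (e : ℝ) (k l : ℤ) (f : (ℤ → A) → ℝ) : Prop :=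
  ∀ ω ω' : ℤ → A, (∀ j, k ≤ j → j ≤ l → ω j = ω' j) → |f ω - f ω'| ≤ e

/-- The quantitative form of `IsPsiMixing`. -/
def PsiMixingWith {A : Type*} [MeasurableSpace A] (P : Measure (ℤ → A)) (α C : ℝ) : Prop :=
  ∀ k l m n : ℤ, k < l → l < m → m < n → ∀ a b : ℤ → A,
    |P.real (cylinder k l a ∩ cylinder m n b)
        - P.real (cylinder k l a) * P.real (cylinder m n b)|
      ≤ C * P.real (cylinder k l a) * P.real (cylinder m n b) * ((m - l : ℤ) : ℝ) ^ (-α)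

/-- The error is relative to the mass of each atom, so summing over countably many atoms costs only
the total mass one. -/
lemma abs_integral_sub_le_of_countable {X : Type*} [Countable X] [MeasurableSpace X]
    [MeasurableSingletonClass X] {μ ν : Measure X} [IsProbabilityMeasure μ]
    [IsProbabilityMeasure ν] {η B : ℝ} (h : ∀ x, |μ.real {x} - ν.real {x}| ≤ η * ν.real {x})
    {F : X → ℝ} (hF : ∀ x, |F x| ≤ B) :
    |∫ x, F x ∂μ - ∫ x, F x ∂ν| ≤ η * B := by
  have hint : ∀ (ρ : Measure X) [IsProbabilityMeasure ρ] (G : X → ℝ) (K : ℝ), (∀ x, |G x| ≤ K) →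
      Integrable G ρ := fun ρ _ G K hG =>
    Integrable.of_bound (measurable_of_countable G).aestronglyMeasurable K
      (Eventually.of_forall hG)
  have hsum : ∀ (ρ : Measure X) [IsProbabilityMeasure ρ] (G : X → ℝ) (K : ℝ), (∀ x, |G x| ≤ K) →
      HasSum (fun x => ρ.real {x} * G x) (∫ x, G x ∂ρ) := fun ρ _ G K hG => by
    have := hasSum_integral_iUnion (μ := ρ) (f := G) (s := fun x : X => ({x} : Set X))
      (fun x => measurableSet_singleton x)
      (fun x y hxy => by simpa using hxy) (hint ρ G K hG).integrableOn
    rw [Set.iUnion_of_singleton, setIntegral_univ] at this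
    simpa [Measure.real] using this
  have h1 := hsum μ F B hF
  have h2 := hsum ν F B hF
  have h3 := (hsum ν (fun _ => 1) 1 (by simp)).mul_left (η * B)
  simp only [integral_const, probReal_univ, smul_eq_mul, mul_one] at h3
  have h4 := h1.sub h2
  have h5 : ∀ x, ‖μ.real {x} * F x - ν.real {x} * F x‖ ≤ η * B * ν.real {x} := by
    intro x
    rw [← sub_mul, Real.norm_eq_abs, abs_mul]
    calc _ ≤ η * ν.real {x} * B :=
          mul_le_mul (h x) (hF x) (abs_nonneg _) ((abs_nonneg _).trans (h x))
      _ = _ := by ring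
  rw [← h4.tsum_eq]
  exact tsum_of_norm_bounded h3 h5

/-- Replace the coordinates of `ω₀` in `[k, l]` by `x`. -/
noncomputable def extendWindow {A : Type*} (k l : ℤ) (ω₀ : ℤ → A) (x : Finset.Icc k l → A) : ℤ → A :=
  fun j => if h : j ∈ Finset.Icc k l then x ⟨j, h⟩ else ω₀ j

/-- Freezing the coordinates outside the windows replaces f and g by functions of finitely many
coordinates, hence on countable spaces whose atoms are cylinders. There ψ-mixing compares the joint
law with the product law atom by atom. The freezing error enters twice, in the integral of the
product and in the product of the integrals. -/
lemma abs_cov_le {A : Type*} [Countable A] [MeasurableSpace A] [MeasurableSingletonClass A]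
    {P : Measure (ℤ → A)} [IsProbabilityMeasure P] {α C : ℝ} (hmix : PsiMixingWith P α C)
    {k l m n : ℤ} (hkl : k < l) (hlm : l < m) (hmn : m < n) {f g : (ℤ → A) → ℝ}
    (hf : Measurable f) (hg : Measurable g) {B₁ B₂ e₁ e₂ : ℝ}
    (hfB : ∀ ω, |f ω| ≤ B₁) (hgB : ∀ ω, |g ω| ≤ B₂)
    (hfv : VariesBy e₁ k l f) (hgv : VariesBy e₂ m n g) :
    |∫ ω, f ω * g ω ∂P - (∫ ω, f ω ∂P) * ∫ ω, g ω ∂P|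
      ≤ C * ((m - l : ℤ) : ℝ) ^ (-α) * (B₁ * B₂) + 2 * (e₁ * B₂ + B₁ * e₂) := by
  obtain ⟨ω₀⟩ : Nonempty (ℤ → A) := P.nonempty_of_neZero
  have hB₁ : 0 ≤ B₁ := (abs_nonneg _).trans (hfB ω₀)
  have hB₂ : 0 ≤ B₂ := (abs_nonneg _).trans (hgB ω₀)
  set π₁ : (ℤ → A) → (Finset.Icc k l → A) := fun ω j => ω j with hπ₁
  set π₂ : (ℤ → A) → (Finset.Icc m n → A) := fun ω j => ω j with hπ₂
  have m₁ : Measurable π₁ := by fun_prop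
  have m₂ : Measurable π₂ := by fun_prop
  set μ := P.map (fun ω => (π₁ ω, π₂ ω)) with hμ
  have : IsProbabilityMeasure μ := Measure.isProbabilityMeasure_map (m₁.prodMk m₂).aemeasurable
  have : IsProbabilityMeasure (P.map π₁) := Measure.isProbabilityMeasure_map m₁.aemeasurable
  have : IsProbabilityMeasure (P.map π₂) := Measure.isProbabilityMeasure_map m₂.aemeasurable
  set ν := (P.map π₁).prod (P.map π₂) with hν
  have hc₁ : ∀ x, π₁ ⁻¹' {x} = cylinder k l (extendWindow k l ω₀ x) := by
    intro x
    ext ω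
    simp only [Set.mem_preimage, Set.mem_singleton_iff, cylinder, Set.mem_ofPred_eq]
    constructor
    · rintro rfl j h1 h2
      simp [extendWindow, h1, h2, hπ₁]
    · intro h
      funext ⟨j, hj⟩
      have hj' := Finset.mem_Icc.mp hj
      rw [hπ₁]
      simp only
      rw [h j hj'.1 hj'.2, extendWindow, dif_pos hj]
  have hc₂ : ∀ x, π₂ ⁻¹' {x} = cylinder m n (extendWindow m n ω₀ x) := by
    intro x
    ext ω
    simp only [Set.mem_preimage, Set.mem_singleton_iff, cylinder, Set.mem_ofPred_eq]
    constructor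
    · rintro rfl j h1 h2
      simp [extendWindow, h1, h2, hπ₂]
    · intro h
      funext ⟨j, hj⟩
      have hj' := Finset.mem_Icc.mp hj
      rw [hπ₂]
      simp only
      rw [h j hj'.1 hj'.2, extendWindow, dif_pos hj]
  have hpt : ∀ z, |μ.real {z} - ν.real {z}| ≤ C * ((m - l : ℤ) : ℝ) ^ (-α) * ν.real {z} := by
    rintro ⟨x, y⟩
    have e1 : ν.real {(x, y)} = P.real (cylinder k l (extendWindow k l ω₀ x))
        * P.real (cylinder m n (extendWindow m n ω₀ y)) := by
      rw [← Set.singleton_prod_singleton, hν, measureReal_prod_prod,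
        map_measureReal_apply m₁ (measurableSet_singleton x),
        map_measureReal_apply m₂ (measurableSet_singleton y), hc₁, hc₂]
    have e2 : μ.real {(x, y)} = P.real (cylinder k l (extendWindow k l ω₀ x)
        ∩ cylinder m n (extendWindow m n ω₀ y)) := by
      rw [hμ, map_measureReal_apply (m₁.prodMk m₂) (measurableSet_singleton _), ← hc₁, ← hc₂]
      congr 1
      ext ω
      simp
    rw [e1, e2]
    refine (hmix k l m n hkl hlm hmn _ _).trans (le_of_eq (by ring))
  set f' : (Finset.Icc k l → A) → ℝ := fun x => f (extendWindow k l ω₀ x) with hf'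
  set g' : (Finset.Icc m n → A) → ℝ := fun x => g (extendWindow m n ω₀ x) with hg'
  have mf' : Measurable f' := measurable_of_countable _
  have mg' : Measurable g' := measurable_of_countable _
  have hff : ∀ ω, |f ω - f' (π₁ ω)| ≤ e₁ := fun ω => hfv _ _ fun j h1 h2 => by
    simp [extendWindow, h1, h2, hπ₁]
  have hgg : ∀ ω, |g ω - g' (π₂ ω)| ≤ e₂ := fun ω => hgv _ _ fun j h1 h2 => by
    simp [extendWindow, h1, h2, hπ₂]
  have he₁ : 0 ≤ e₁ := (abs_nonneg _).trans (hff ω₀)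
  have he₂ : 0 ≤ e₂ := (abs_nonneg _).trans (hgg ω₀)
  have hfB' : ∀ x, |f' x| ≤ B₁ := fun x => hfB _
  have hgB' : ∀ x, |g' x| ≤ B₂ := fun x => hgB _
  have key := abs_integral_sub_le_of_countable hpt (F := fun z => f' z.1 * g' z.2)
    (B := B₁ * B₂) fun z => by
      rw [abs_mul]
      exact mul_le_mul (hfB' _) (hgB' _) (abs_nonneg _) hB₁
  rw [hν, integral_prod_mul f' g', hμ, integral_map (m₁.prodMk m₂).aemeasurable
    (measurable_of_countable _).aestronglyMeasurable, integral_map m₁.aemeasurable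
    mf'.aestronglyMeasurable, integral_map m₂.aemeasurable mg'.aestronglyMeasurable] at key
  simp only at key
  have ib : ∀ (h : (ℤ → A) → ℝ) (K : ℝ), Measurable h → (∀ ω, |h ω| ≤ K) → Integrable h P :=
    fun h K hm hb => Integrable.of_bound hm.aestronglyMeasurable K (Eventually.of_forall hb)
  have mfp : Measurable fun ω => f' (π₁ ω) := mf'.comp m₁
  have mgp : Measurable fun ω => g' (π₂ ω) := mg'.comp m₂
  have bound : ∀ (h : (ℤ → A) → ℝ) (K : ℝ), (∀ ω, |h ω| ≤ K) → |∫ ω, h ω ∂P| ≤ K := by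
    intro h K hb
    have := norm_integral_le_of_norm_le_const (μ := P) (f := h) (C := K) (Eventually.of_forall hb)
    simpa using this
  have i1 := ib f B₁ hf hfB
  have i2 := ib g B₂ hg hgB
  have i3 := ib _ B₁ mfp fun ω => hfB' _
  have i4 := ib _ B₂ mgp fun ω => hgB' _
  have i5 := ib (fun ω => f ω * g ω) (B₁ * B₂) (hf.mul hg) fun ω => by
    rw [abs_mul]; exact mul_le_mul (hfB _) (hgB _) (abs_nonneg _) hB₁
  have i6 := ib (fun ω => f' (π₁ ω) * g' (π₂ ω)) (B₁ * B₂) (mfp.mul mgp) fun ω => by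
    rw [abs_mul]; exact mul_le_mul (hfB' _) (hgB' _) (abs_nonneg _) hB₁
  have d1 : |∫ ω, f ω * g ω ∂P - ∫ ω, f' (π₁ ω) * g' (π₂ ω) ∂P| ≤ e₁ * B₂ + B₁ * e₂ := by
    rw [← integral_sub i5 i6]
    refine bound _ _ fun ω => ?_
    have : f ω * g ω - f' (π₁ ω) * g' (π₂ ω)
        = (f ω - f' (π₁ ω)) * g ω + f' (π₁ ω) * (g ω - g' (π₂ ω)) := by ring
    rw [this]
    refine (abs_add_le _ _).trans (add_le_add ?_ ?_)
    · rw [abs_mul]; exact mul_le_mul (hff _) (hgB _) (abs_nonneg _) he₁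
    · rw [abs_mul]; exact mul_le_mul (hfB' _) (hgg _) (abs_nonneg _) hB₁
  have d2 : |∫ ω, f ω ∂P - ∫ ω, f' (π₁ ω) ∂P| ≤ e₁ := by
    rw [← integral_sub i1 i3]
    exact bound _ _ hff
  have d3 : |∫ ω, g ω ∂P - ∫ ω, g' (π₂ ω) ∂P| ≤ e₂ := by
    rw [← integral_sub i2 i4]
    exact bound _ _ hgg
  have b1 := bound _ _ hgB
  have b2 := bound _ _ (fun ω => hfB' (π₁ ω))
  set If := ∫ ω, f ω ∂P
  set Ig := ∫ ω, g ω ∂P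
  set If' := ∫ ω, f' (π₁ ω) ∂P
  set Ig' := ∫ ω, g' (π₂ ω) ∂P
  have d4 : |If * Ig - If' * Ig'| ≤ e₁ * B₂ + B₁ * e₂ := by
    have : If * Ig - If' * Ig' = (If - If') * Ig + If' * (Ig - Ig') := by ring
    rw [this]
    refine (abs_add_le _ _).trans (add_le_add ?_ ?_)
    · rw [abs_mul]; exact mul_le_mul d2 b1 (abs_nonneg _) he₁
    · rw [abs_mul]; exact mul_le_mul b2 d3 (abs_nonneg _) hB₁
  rw [abs_le] at *
  constructor <;> linarith [d1.1, d1.2, d4.1, d4.2, key.1, key.2]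

/-! ### The potential along the shift -/

lemma measurable_shift {A : Type*} [MeasurableSpace A] (n : ℤ) :
    Measurable (shift (A := A) n) := by
  unfold shift
  fun_prop

lemma shift_shift {A : Type*} (m n : ℤ) (ω : ℤ → A) : shift m (shift n ω) = shift (m + n) ω := by
  funext k
  simp [shift, add_assoc]

lemma measurePreserving_shift_nat {A : Type*} [MeasurableSpace A] {P : Measure (ℤ → A)}
    (hS : MeasurePreserving (shift (1 : ℤ)) P P) (n : ℕ) :
    MeasurePreserving (shift (n : ℤ)) P P := by
  induction n with
  | zero =>
    have : shift (A := A) ((0 : ℕ) : ℤ) = id := by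
      funext ω k
      simp [shift]
    rw [this]
    exact MeasurePreserving.id P
  | succ n ih =>
    have := hS.comp ih
    have e : shift (A := A) (1 : ℤ) ∘ shift (n : ℤ) = shift ((n + 1 : ℕ) : ℤ) := by
      funext ω
      rw [Function.comp, shift_shift]
      push_cast
      rw [add_comm]
    rwa [e] at this

/-- The value of the potential at the site `n`. -/
def potential {A : Type*} (V : (ℤ → A) → ℝ) (ω : ℤ → A) (n : ℕ) : ℝ := V (shift (n : ℤ) ω)

lemma integral_comp_shift {A : Type*} [MeasurableSpace A] {P : Measure (ℤ → A)}
    (hS : MeasurePreserving (shift (1 : ℤ)) P P) {f : (ℤ → A) → ℝ} (hf : Measurable f) (n : ℕ) :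
    ∫ ω, f (shift (n : ℤ) ω) ∂P = ∫ ω, f ω ∂P := by
  have h := measurePreserving_shift_nat hS n
  conv_rhs => rw [← h.map_eq]
  rw [integral_map h.measurable.aemeasurable hf.aestronglyMeasurable]

/-- The autocorrelation of the potential. -/
noncomputable def correlation {A : Type*} [MeasurableSpace A] (P : Measure (ℤ → A))
    (V : (ℤ → A) → ℝ) (n : ℤ) : ℝ := ∫ ω, V ω * V (shift n ω) ∂P

lemma correlation_neg {A : Type*} [MeasurableSpace A] {P : Measure (ℤ → A)}
    (hS : MeasurePreserving (shift (1 : ℤ)) P P) {V : (ℤ → A) → ℝ} (hV : Measurable V) (n : ℕ) :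
    correlation P V (-(n : ℤ)) = correlation P V n := by
  have h := integral_comp_shift hS (f := fun ω => V ω * V (shift (-(n : ℤ)) ω))
    (hV.mul (hV.comp (measurable_shift _))) n
  simp only [correlation]
  rw [← h]
  congr 1
  funext ω
  rw [shift_shift]
  have : shift (-(n : ℤ) + n) ω = ω := by
    funext k
    simp [shift]
  rw [this, mul_comm]

lemma integral_potential_mul {A : Type*} [MeasurableSpace A] {P : Measure (ℤ → A)}
    (hS : MeasurePreserving (shift (1 : ℤ)) P P) {V : (ℤ → A) → ℝ} (hV : Measurable V)
    (k n : ℕ) : ∫ ω, potential V ω k * potential V ω (k + n) ∂P = correlation P V n := by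
  rw [correlation, ← integral_comp_shift hS (f := fun ω => V ω * V (shift n ω))
    (hV.mul (hV.comp (measurable_shift _))) k]
  congr 1
  funext ω
  rw [shift_shift, potential, potential]
  congr 3
  push_cast
  ring

end WeakDisorder

/-! ### Power law decay of correlations and the spectral density -/

namespace WeakDisorder

lemma exists_pow_le_rpow_neg {r : ℝ} (hr0 : 0 < r) (hr1 : r < 1) (α : ℝ) :
    ∃ R : ℝ, 0 ≤ R ∧ ∀ m : ℕ, 1 ≤ m → r ^ m ≤ R * (m : ℝ) ^ (-α) := by
  obtain ⟨k, hk⟩ := exists_nat_ge α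
  have ht := tendsto_pow_const_mul_const_pow_of_lt_one k hr0.le hr1
  obtain ⟨R, hR⟩ := ht.bddAbove_range
  have hR' : ∀ m : ℕ, (m : ℝ) ^ k * r ^ m ≤ R := fun m => hR ⟨m, rfl⟩
  refine ⟨R, le_trans (by positivity) (hR' 1), fun m hm => ?_⟩
  have hm' : (1 : ℝ) ≤ m := by exact_mod_cast hm
  have hm0 : (0 : ℝ) < m := by linarith
  rw [Real.rpow_neg hm0.le, ← div_eq_mul_inv, le_div_iff₀ (by positivity)]
  calc r ^ m * (m : ℝ) ^ α ≤ r ^ m * (m : ℝ) ^ (k : ℝ) := by gcongr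
    _ = (m : ℝ) ^ k * r ^ m := by rw [Real.rpow_natCast, mul_comm]
    _ ≤ R := hR' m

/-- A bounded measurable potential whose variation decays like `K r^m`. -/
structure PotentialBound {A : Type*} [MeasurableSpace A] (r K : ℝ) (V : (ℤ → A) → ℝ) : Prop where
  measurable : Measurable V
  bound : ∀ ω, |V ω| ≤ K
  variation : ∀ m : ℕ, 1 ≤ m → VariesBy (K * r ^ m) (-(m : ℤ)) m V

lemma IsQuasiLocal.exists_bound {A : Type*} [MeasurableSpace A] {r : ℝ} (hr0 : 0 < r)
    {V : (ℤ → A) → ℝ} (hV : IsQuasiLocal r V) : ∃ K, 1 ≤ K ∧ PotentialBound r K V := by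
  obtain ⟨B, hB⟩ := hV.bounded
  obtain ⟨C, hC⟩ := hV.variation
  refine ⟨|B| + |C| + 1, by linarith [abs_nonneg B, abs_nonneg C], hV.measurable,
    fun ω => (hB ω).trans ?_, fun m hm ω ω' h => (hC m m hm hm ω ω' h).trans ?_⟩
  · linarith [le_abs_self B, abs_nonneg C]
  · rw [min_self]
    gcongr
    linarith [le_abs_self C, abs_nonneg B]

section potential

variable {A : Type*} [MeasurableSpace A] {r K : ℝ} {V : (ℤ → A) → ℝ}

lemma PotentialBound.measurable_potential (hV : PotentialBound r K V) (n : ℕ) :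
    Measurable fun ω => potential V ω n := hV.measurable.comp (measurable_shift _)

lemma PotentialBound.abs_potential_le (hV : PotentialBound r K V) (n : ℕ) (ω : ℤ → A) :
    |potential V ω n| ≤ K := hV.bound _

lemma PotentialBound.variesBy_potential (hV : PotentialBound r K V) {m : ℕ} (hm : 1 ≤ m) (n : ℕ)
    {k l : ℤ} (hk : k ≤ n - m) (hl : n + m ≤ l) :
    VariesBy (K * r ^ m) k l fun ω => potential V ω n := by
  intro ω ω' h
  refine hV.variation m hm _ _ fun j h1 h2 => ?_
  simp only [shift]
  exact h _ (by omega) (by omega)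

end potential

/-- Observables of the past are nearly uncorrelated with the potential at later sites. -/
lemma exists_decorrelation {A : Type*} [Countable A] [MeasurableSpace A]
    [MeasurableSingletonClass A] {P : Measure (ℤ → A)} [IsProbabilityMeasure P]
    (hS : MeasurePreserving (shift (1 : ℤ)) P P) {α : ℝ} (hα : 0 ≤ α) (hmix : IsPsiMixing P α)
    {V : (ℤ → A) → ℝ} {r : ℝ} (hr0 : 0 < r) (hr1 : r < 1) (hV : IsQuasiLocal r V)
    (hV0 : ∫ ω, V ω ∂P = 0) :
    ∃ K : ℝ, 1 ≤ K ∧ PotentialBound r K V ∧ ∀ m : ℕ, 1 ≤ m → ∀ j n' n : ℕ, j + 3 * m ≤ n' → n' ≤ n →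
      ∀ (f : (ℤ → A) → ℝ) (b : ℝ), Measurable f → (∀ ω, |f ω| ≤ b) →
        VariesBy (b * r ^ m) (-((j : ℤ) + m)) (j + m) f →
        |∫ ω, f ω * potential V ω n ∂P| ≤ K * b * (m : ℝ) ^ (-α) ∧
        |∫ ω, f ω * (potential V ω n' * potential V ω n) ∂P
          - (∫ ω, f ω ∂P) * correlation P V ((n - n' : ℕ) : ℤ)| ≤ K * b * (m : ℝ) ^ (-α) := by
  obtain ⟨K, hK1, hVK⟩ := hV.exists_bound hr0
  obtain ⟨C, hC0, hC⟩ := hmix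
  have hC' : PsiMixingWith P α C := hC
  obtain ⟨R, hR0, hR⟩ := exists_pow_le_rpow_neg hr0 hr1 α
  have hK0 : 0 ≤ K := by linarith
  have hmono : ∀ K', K ≤ K' → PotentialBound r K' V := fun K' h =>
    ⟨hVK.measurable, fun ω => (hVK.bound ω).trans h, fun m hm ω ω' hω =>
      (hVK.variation m hm ω ω' hω).trans (by gcongr)⟩
  set L := C * (K + K ^ 2) + 2 * R * (K + K ^ 2) + 2 * R * (K + 2 * K ^ 2) + K with hL
  have hKL : K ≤ L := by
    have : 0 ≤ C * (K + K ^ 2) + 2 * R * (K + K ^ 2) + 2 * R * (K + 2 * K ^ 2) := by positivity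
    linarith
  refine ⟨L, hK1.trans hKL, hmono L hKL, ?_⟩
  intro m hm j n' n hj hn f b hf hb hfv
  have hm' : (1 : ℝ) ≤ m := by exact_mod_cast hm
  obtain ⟨ω₀⟩ : Nonempty (ℤ → A) := P.nonempty_of_neZero
  have hb0 : 0 ≤ b := (abs_nonneg _).trans (hb ω₀)
  have hrm := hR m hm
  have hrm0 : 0 < r ^ m := by positivity
  set μ := (m : ℝ) ^ (-α) with hμ
  have hμ0 : 0 < μ := by positivity
  have hwin : ∀ (q : ℤ), (m : ℤ) ≤ q → ((q : ℤ) : ℝ) ^ (-α) ≤ μ := by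
    intro q hq
    have : (m : ℝ) ≤ (q : ℝ) := by exact_mod_cast hq
    exact Real.rpow_le_rpow_of_nonpos (by linarith) this (by linarith)
  constructor
  -- The observable lives up to its error on [-(j+m), j+m] and the potential at n on [n-m, n+m];
  -- since n ≥ j + 3m, the gap between the windows is at least m.
  · have h := abs_cov_le hC' (k := -((j : ℤ) + m)) (l := j + m) (m := n - m) (n := n + m)
      (by omega) (by omega) (by omega) hf (hVK.measurable_potential n) hb
      (hVK.abs_potential_le n) hfv (hVK.variesBy_potential hm n (by omega) (by omega))
    have e : ∫ ω, potential V ω n ∂P = 0 := by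
      rw [← hV0]
      exact integral_comp_shift hS hVK.measurable n
    rw [e, mul_zero, sub_zero] at h
    refine h.trans ?_
    have h1 := hwin ((n - m : ℤ) - (j + m)) (by omega)
    have h2 : C * (((n - m : ℤ) - (j + m) : ℤ) : ℝ) ^ (-α) * (b * K) ≤ C * μ * (b * K) := by gcongr
    have h3 : 2 * (b * r ^ m * K + b * (K * r ^ m)) ≤ 2 * (b * (R * μ) * K + b * (K * (R * μ))) := by
      gcongr
    refine (add_le_add h2 h3).trans ?_
    rw [hL]
    have : 0 ≤ b * μ := by positivity
    have h4 : 0 ≤ (C * K ^ 2 + 4 * R * K ^ 2 + 2 * R * K ^ 2 + K) * (b * μ) := by positivity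
    nlinarith
  · have hg : ∀ ω, |potential V ω n' * potential V ω n| ≤ K ^ 2 := by
      intro ω
      rw [abs_mul, sq]
      exact mul_le_mul (hVK.abs_potential_le _ _) (hVK.abs_potential_le _ _) (abs_nonneg _) hK0
    have hgv : VariesBy (2 * K ^ 2 * r ^ m) (n' - m) (n + m)
        (fun ω => potential V ω n' * potential V ω n) := by
      intro ω ω' h
      have h1 := hVK.variesBy_potential hm n' (k := n' - m) (l := n + m) (by omega) (by omega) ω ω' h
      have h2 := hVK.variesBy_potential hm n (k := n' - m) (l := n + m) (by omega) (by omega) ω ω' h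
      have e : potential V ω n' * potential V ω n - potential V ω' n' * potential V ω' n
          = (potential V ω n' - potential V ω' n') * potential V ω n
            + potential V ω' n' * (potential V ω n - potential V ω' n) := by ring
      simp only
      rw [e]
      refine (abs_add_le _ _).trans ?_
      rw [abs_mul, abs_mul]
      have := mul_le_mul h1 (hVK.abs_potential_le n ω) (abs_nonneg _) (by positivity)
      have := mul_le_mul (hVK.abs_potential_le n' ω') h2 (abs_nonneg _) hK0
      nlinarith
    have h := abs_cov_le hC' (k := -((j : ℤ) + m)) (l := j + m) (m := n' - m) (n := n + m)
      (by omega) (by omega) (by omega) hf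
      ((hVK.measurable_potential n').mul (hVK.measurable_potential n)) hb hg hfv hgv
    have e : ∫ ω, potential V ω n' * potential V ω n ∂P = correlation P V ((n - n' : ℕ) : ℤ) := by
      have := integral_potential_mul hS hVK.measurable n' (n - n')
      rwa [Nat.add_sub_cancel' hn] at this
    simp only [Pi.mul_apply] at h
    rw [e] at h
    refine h.trans ?_
    have h1 := hwin ((n' - m : ℤ) - (j + m)) (by omega)
    have h2 : C * (((n' - m : ℤ) - (j + m) : ℤ) : ℝ) ^ (-α) * (b * K ^ 2) ≤ C * μ * (b * K ^ 2) := by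
      gcongr
    have h3 : 2 * (b * r ^ m * K ^ 2 + b * (2 * K ^ 2 * r ^ m))
        ≤ 2 * (b * (R * μ) * K ^ 2 + b * (2 * K ^ 2 * (R * μ))) := by
      gcongr
    refine (add_le_add h2 h3).trans ?_
    rw [hL]
    have : 0 ≤ b * μ := by positivity
    have h4 : 0 ≤ (C * K + 2 * R * K + 2 * R * K + K) * (b * μ) := by positivity
    nlinarith

/-- Decorrelation is applied to the potential at site 0 with m = n/3 (integer division), where n ≤
5(n/3) for n ≥ 3. This explains the factor 5^α, which also covers the remaining n < 3. -/
lemma exists_correlation_le {A : Type*} [Countable A] [MeasurableSpace A]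
    [MeasurableSingletonClass A] {P : Measure (ℤ → A)} [IsProbabilityMeasure P]
    (hS : MeasurePreserving (shift (1 : ℤ)) P P) {α : ℝ} (hα : 0 ≤ α) (hmix : IsPsiMixing P α)
    {V : (ℤ → A) → ℝ} {r : ℝ} (hr0 : 0 < r) (hr1 : r < 1) (hV : IsQuasiLocal r V)
    (hV0 : ∫ ω, V ω ∂P = 0) :
    ∃ K : ℝ, 0 ≤ K ∧ ∀ n : ℕ, |correlation P V n| ≤ K ∧
      (1 ≤ n → |correlation P V n| ≤ K * (n : ℝ) ^ (-α)) := by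
  obtain ⟨K, hK1, hVK, hdec⟩ := exists_decorrelation hS hα hmix hr0 hr1 hV hV0
  have hK0 : 0 ≤ K := by linarith
  have hsq : ∀ n : ℕ, |correlation P V n| ≤ K ^ 2 := by
    intro n
    have := norm_integral_le_of_norm_le_const (μ := P) (f := fun ω => V ω * V (shift n ω))
      (C := K ^ 2) (Eventually.of_forall fun ω => by
        rw [Real.norm_eq_abs, abs_mul, sq]
        exact mul_le_mul (hVK.bound _) (hVK.bound _) (abs_nonneg _) hK0)
    simpa [correlation] using this
  have h5 : (1 : ℝ) ≤ 5 ^ α := Real.one_le_rpow (by norm_num) hα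
  refine ⟨K ^ 2 * 5 ^ α, by positivity, fun n => ⟨(hsq n).trans ?_, fun hn => ?_⟩⟩
  · nlinarith [sq_nonneg K]
  have hn0 : (0 : ℝ) < n := by exact_mod_cast hn
  have key : ∀ m : ℝ, 0 < m → (n : ℝ) ≤ 5 * m → m ^ (-α) ≤ 5 ^ α * (n : ℝ) ^ (-α) := by
    intro m hm h
    have h1 : (5 * m) ^ (-α) ≤ (n : ℝ) ^ (-α) :=
      Real.rpow_le_rpow_of_nonpos hn0 h (by linarith)
    have h2 : m ^ (-α) = 5 ^ α * (5 * m) ^ (-α) := by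
      rw [Real.mul_rpow (by norm_num) hm.le, ← mul_assoc, ← Real.rpow_add (by norm_num)]
      simp
    rw [h2]
    gcongr
  rcases le_or_gt 3 n with h3 | h3
  · have hm : 1 ≤ n / 3 := by omega
    have hf : VariesBy (K * r ^ (n / 3)) (-(((0 : ℕ) : ℤ) + ((n / 3 : ℕ) : ℤ)))
        (((0 : ℕ) : ℤ) + ((n / 3 : ℕ) : ℤ)) (fun ω => potential V ω 0) :=
      hVK.variesBy_potential hm 0 (by omega) (by omega)
    have h := (hdec (n / 3) hm 0 n n (by omega) le_rfl (fun ω => potential V ω 0) K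
      (hVK.measurable_potential 0) (hVK.abs_potential_le 0) hf).1
    have e := integral_potential_mul hS hVK.measurable 0 n
    rw [zero_add] at e
    rw [e] at h
    refine h.trans ?_
    have hm0 : (0 : ℝ) < ((n / 3 : ℕ) : ℝ) := by exact_mod_cast hm
    have := key ((n / 3 : ℕ) : ℝ) hm0 (by exact_mod_cast (by omega : n ≤ 5 * (n / 3)))
    calc _ ≤ K * K * (5 ^ α * (n : ℝ) ^ (-α)) := by gcongr
      _ = _ := by ring
  · refine (hsq n).trans ?_
    have := key 1 one_pos (by have : (n : ℝ) < 3 := by exact_mod_cast h3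
                              linarith)
    rw [Real.one_rpow] at this
    rw [mul_assoc]
    exact le_mul_of_one_le_right (by positivity) this

/-- The one-sided sums of correlations converge to the spectral densities at `0` and `π`. -/
lemma exists_spectralDensity_approx {A : Type*} [Countable A] [MeasurableSpace A]
    [MeasurableSingletonClass A] {P : Measure (ℤ → A)} [IsProbabilityMeasure P]
    (hS : MeasurePreserving (shift (1 : ℤ)) P P) {α : ℝ} (hα : 2 < α) (hmix : IsPsiMixing P α)
    {V : (ℤ → A) → ℝ} {r : ℝ} (hr0 : 0 < r) (hr1 : r < 1) (hV : IsQuasiLocal r V)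
    (hV0 : ∫ ω, V ω ∂P = 0) :
    ∃ K : ℝ, 0 ≤ K ∧ ∀ m : ℕ, 1 ≤ m →
      |correlation P V 0 / 2 + ∑ i ∈ Finset.range m, correlation P V ((i + 1 : ℕ) : ℤ)
        - spectralDensity P V 0 / 2| ≤ K * (m : ℝ) ^ (-(α / 2 - 1)) ∧
      |correlation P V 0 / 2
        + ∑ i ∈ Finset.range m, (-1) ^ (i + 1) * correlation P V ((i + 1 : ℕ) : ℤ)
        - spectralDensity P V Real.pi / 2| ≤ K * (m : ℝ) ^ (-(α / 2 - 1)) := by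
  obtain ⟨K, hK0, hK⟩ := exists_correlation_le hS (by linarith) hmix hr0 hr1 hV hV0
  have hp : Summable fun i : ℕ => ((i : ℝ) + 1) ^ (-(α / 2 + 1)) := by
    have := (summable_nat_add_iff 1).mpr
      (Real.summable_nat_rpow (p := -(α / 2 + 1)) |>.mpr (by linarith))
    simpa using this
  set Z := ∑' i : ℕ, ((i : ℝ) + 1) ^ (-(α / 2 + 1)) with hZ
  have hZ0 : 0 ≤ Z := tsum_nonneg fun i => by positivity
  set c : ℕ → ℝ := fun i => correlation P V ((i + 1 : ℕ) : ℤ) with hc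
  have hcle : ∀ i : ℕ, |c i| ≤ K * ((i : ℝ) + 1) ^ (-α) := fun i => by
    have := (hK (i + 1)).2 (by omega)
    simpa [hc] using this
  have hcle2 : ∀ i : ℕ, |c i| ≤ K * ((i : ℝ) + 1) ^ (-(α / 2 + 1)) := fun i => by
    refine (hcle i).trans ?_
    gcongr
    · linarith [i.cast_nonneg (α := ℝ)]
    · linarith
  -- sums with signs
  have tail : ∀ e : ℕ → ℝ, (∀ i, |e i| ≤ 1) → Summable (fun i => e i * c i) ∧
      ∀ m : ℕ, 1 ≤ m → |∑ i ∈ Finset.range m, e i * c i - ∑' i, e i * c i|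
        ≤ K * Z * (m : ℝ) ^ (-(α / 2 - 1)) := by
    intro e he
    have hb : ∀ i, ‖e i * c i‖ ≤ |c i| := fun i => by
      rw [norm_mul, Real.norm_eq_abs, Real.norm_eq_abs]
      exact mul_le_of_le_one_left (abs_nonneg _) (he i)
    have hs : Summable (fun i => e i * c i) :=
      Summable.of_norm_bounded (hp.mul_left K) fun i => (hb i).trans (hcle2 i)
    refine ⟨hs, fun m hm => ?_⟩
    have hm0 : (0 : ℝ) < m := by exact_mod_cast hm
    rw [← hs.sum_add_tsum_nat_add m, sub_add_cancel_left, abs_neg]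
    have hsum2 : HasSum (fun i : ℕ => K * (m : ℝ) ^ (-(α / 2 - 1)) * ((i : ℝ) + 1) ^ (-(α / 2 + 1)))
        (K * (m : ℝ) ^ (-(α / 2 - 1)) * Z) := hp.hasSum.mul_left _
    have := tsum_of_norm_bounded (f := fun i => e (i + m) * c (i + m)) hsum2 fun i => by
      refine (hb (i + m)).trans ((hcle (i + m)).trans ?_)
      push_cast
      have hi : (0 : ℝ) ≤ i := i.cast_nonneg
      rw [mul_assoc]
      gcongr
      -- The exponent is split into a summable part α/2 + 1 and a decaying part α/2 - 1, positive
      -- since α > 2. The resulting rate is not the sharp one for the tail, but it matches the other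
      -- errors of the method.
      have h1 : ((i : ℝ) + m + 1) ^ (-α) = ((i : ℝ) + m + 1) ^ (-(α / 2 - 1))
          * ((i : ℝ) + m + 1) ^ (-(α / 2 + 1)) := by
        rw [← Real.rpow_add (by positivity)]
        ring_nf
      rw [h1]
      exact mul_le_mul (Real.rpow_le_rpow_of_nonpos hm0 (by linarith) (by linarith))
        (Real.rpow_le_rpow_of_nonpos (by positivity) (by linarith) (by linarith))
        (by positivity) (by positivity)
    rw [Real.norm_eq_abs] at this
    linarith
  -- the two-sided sums
  have two : ∀ (k : ℝ) (e : ℕ → ℝ), (∀ i, |e i| ≤ 1) →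
      (∀ i : ℕ, Complex.exp (Complex.I * (k : ℂ) * (((i + 1 : ℕ) : ℤ) : ℂ)) = e i) →
      (∀ i : ℕ, Complex.exp (Complex.I * (k : ℂ) * ((-((i + 1 : ℕ) : ℤ) : ℤ) : ℂ)) = e i) →
      spectralDensity P V k = correlation P V 0 + 2 * ∑' i, e i * c i := by
    intro k e he h1 h2
    have hs := (tail e he).1
    have hs1 : HasSum (fun n : ℕ => Complex.exp (Complex.I * (k : ℂ) * (((n + 1 : ℕ) : ℤ) : ℂ)) *
        ((correlation P V ((n + 1 : ℕ) : ℤ) : ℝ) : ℂ)) ((∑' i, e i * c i : ℝ) : ℂ) := by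
      have := Complex.hasSum_ofReal.mpr hs.hasSum
      refine this.congr_fun ?_ 
      intro i
      rw [h1]
      push_cast
      rfl
    have hs2 : HasSum (fun n : ℕ => Complex.exp (Complex.I * (k : ℂ) * ((-((n + 1 : ℕ) : ℤ) : ℤ) : ℂ)) *
        ((correlation P V (-((n + 1 : ℕ) : ℤ)) : ℝ) : ℂ)) ((∑' i, e i * c i : ℝ) : ℂ) := by
      have := Complex.hasSum_ofReal.mpr hs.hasSum
      refine this.congr_fun ?_ 
      intro i
      rw [h2, correlation_neg hS hV.measurable]
      push_cast
      rfl
    have h3 := HasSum.of_add_one_of_neg_add_one (f := fun n : ℤ =>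
      Complex.exp (Complex.I * (k : ℂ) * (n : ℂ)) * ((correlation P V n : ℝ) : ℂ))
      (by simpa using hs1) (by simpa using hs2)
    have h4 : spectralDensity P V k = (∑' n : ℤ, Complex.exp (Complex.I * (k : ℂ) * (n : ℂ)) *
      ((correlation P V n : ℝ) : ℂ)).re := rfl
    rw [h4, h3.tsum_eq]
    simp
    ring
  have hD0 := two 0 (fun _ => 1) (by simp) (by simp) (by simp)
  have hDpi := two Real.pi (fun i => (-1) ^ (i + 1)) (by simp) (fun i => by
      have := Complex.exp_nat_mul (Real.pi * Complex.I) (i + 1)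
      rw [Complex.exp_pi_mul_I] at this
      push_cast at this ⊢
      rw [← this]
      congr 1
      ring) (fun i => by
      have := Complex.exp_nat_mul (-(Real.pi * Complex.I)) (i + 1)
      rw [Complex.exp_neg, Complex.exp_pi_mul_I] at this
      have e : ((-1 : ℂ))⁻¹ = -1 := by norm_num
      rw [e] at this
      push_cast at this ⊢
      rw [← this]
      congr 1
      ring)
  refine ⟨K * Z, by positivity, fun m hm => ⟨?_, ?_⟩⟩
  · have := (tail (fun _ => 1) (by simp)).2 m hm
    rw [hD0]
    simp only [one_mul] at this ⊢
    convert this using 2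
    ring
  · have := (tail (fun i => (-1) ^ (i + 1)) (by simp)).2 m hm
    rw [hDpi]
    convert this using 2
    ring

end WeakDisorder

namespace WeakDisorder

/-! ### Averaging along slowly varying random walks -/

/-- Functions bounded by `b` and Lipschitz with constant `b`. -/
structure BddLip (b : ℝ) (H : ℝ → ℝ) : Prop where
  bound : ∀ x, |H x| ≤ b
  lip : ∀ x y, |H x - H y| ≤ b * |x - y|

lemma BddLip.nonneg {b : ℝ} {H : ℝ → ℝ} (h : BddLip b H) : 0 ≤ b :=
  (abs_nonneg _).trans (h.bound 0)

lemma BddLip.continuous {b : ℝ} {H : ℝ → ℝ} (h : BddLip b H) : Continuous H := by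
  have : LipschitzWith b.toNNReal H := LipschitzWith.of_dist_le_mul fun x y => by
    rw [Real.dist_eq, Real.dist_eq, Real.coe_toNNReal _ h.nonneg]
    exact h.lip x y
  exact this.continuous

lemma BddLip.mul {b c : ℝ} {H G : ℝ → ℝ} (h : BddLip b H) (g : BddLip c G) :
    BddLip (2 * (b * c)) fun x => H x * G x := by
  have hb := h.nonneg
  have hc := g.nonneg
  refine ⟨fun x => ?_, fun x y => ?_⟩
  · rw [abs_mul]
    have := mul_le_mul (h.bound x) (g.bound x) (abs_nonneg _) hb
    nlinarith [mul_nonneg hb hc]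
  · have e : H x * G x - H y * G y = (H x - H y) * G x + H y * (G x - G y) := by ring
    rw [e]
    refine (abs_add_le _ _).trans ?_
    rw [abs_mul, abs_mul]
    have h1 := mul_le_mul (h.lip x y) (g.bound x) (abs_nonneg _) (by positivity)
    have h2 := mul_le_mul (h.bound y) (g.lip x y) (abs_nonneg _) hb
    linarith

/-- The coefficients of the expansion of one step of the walk, with period two in the site. -/
structure StepCoefficients (K : ℝ) (s a a1 c Q : ℕ → ℝ → ℝ) (D0 Dpi κ : ℝ) : Prop where
  s_bl : ∀ n, BddLip K (s n)
  a_bl : ∀ n, BddLip K (a n)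
  a1_bl : ∀ n, BddLip K (a1 n)
  c_bl : ∀ n, BddLip K (c n)
  Q_bl : ∀ n, BddLip K (Q n)
  a_deriv : ∀ n θ, HasDerivAt (a n) (a1 n θ) θ
  s_period : ∀ n, s (n + 2) = s n
  Q_eq : ∀ n θ, Q n θ = c n θ + a1 n θ *
    ((s n θ + s (n + 1) θ) / 2 * (D0 / 2) + (s n θ - s (n + 1) θ) / 2 * (Dpi / 2))
  Q_sum : ∀ n θ, Q n θ + Q (n + 1) θ = 2 * κ

/-- A walk `θ` with steps of size `δ`, driven by `v`, whose past is nearly uncorrelated with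
the values of `v` at sites that are at least `3m` steps later. -/
structure DecorrelatedWalk {Ω : Type*} [MeasurableSpace Ω] (P : Measure Ω) (v θ : ℕ → Ω → ℝ)
    (corr : ℕ → ℝ) (s : ℕ → ℝ → ℝ) (K δ e : ℝ) (m : ℕ) : Prop where
  measurable_v : ∀ n, Measurable (v n)
  measurable_θ : ∀ n, Measurable (θ n)
  abs_v_le : ∀ n ω, |v n ω| ≤ K
  abs_corr_le : ∀ n, |corr n| ≤ K
  step : ∀ n ω, |θ (n + 1) ω - θ n ω - δ * v (n + 1) ω * s (n + 1) (θ n ω)| ≤ K * δ ^ 2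
  decor₁ : ∀ (H : ℝ → ℝ) (b : ℝ), BddLip b H → ∀ j n, j + 3 * m ≤ n →
    |∫ ω, H (θ j ω) * v n ω ∂P| ≤ K * b * e
  decor₂ : ∀ (H : ℝ → ℝ) (b : ℝ), BddLip b H → ∀ j n i, j + 3 * m ≤ n →
    |∫ ω, H (θ j ω) * (v n ω * v (n + i) ω) ∂P - (∫ ω, H (θ j ω) ∂P) * corr i| ≤ K * b * e

section

variable {Ω : Type*} [MeasurableSpace Ω] {P : Measure Ω}

lemma DecorrelatedWalk.abs_step_le {v θ : ℕ → Ω → ℝ} {corr : ℕ → ℝ} {s : ℕ → ℝ → ℝ} {K δ e : ℝ}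
    {m : ℕ} (hw : DecorrelatedWalk P v θ corr s K δ e m) (hK : 1 ≤ K)
    (hδ0 : 0 ≤ δ) (hδ1 : δ ≤ 1) (hs : ∀ n, BddLip K (s n)) (n : ℕ) (ω : Ω) :
    |θ (n + 1) ω - θ n ω| ≤ 2 * K ^ 2 * δ := by
  have h1 := hw.step n ω
  have h2 : |δ * v (n + 1) ω * s (n + 1) (θ n ω)| ≤ δ * K * K := by
    rw [abs_mul, abs_mul, abs_of_nonneg hδ0]
    have := hw.abs_v_le (n + 1) ω
    have := (hs (n + 1)).bound (θ n ω)
    gcongr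
  have h3 : |θ (n + 1) ω - θ n ω| ≤ K * δ ^ 2 + δ * K * K := by
    have := abs_add_le (θ (n + 1) ω - θ n ω - δ * v (n + 1) ω * s (n + 1) (θ n ω))
      (δ * v (n + 1) ω * s (n + 1) (θ n ω))
    rw [sub_add_cancel] at this
    linarith
  have h4 : K * δ ^ 2 ≤ K ^ 2 * δ := by
    calc K * δ ^ 2 = K * δ * δ := by ring
      _ ≤ K * δ * K := by gcongr; linarith
      _ = _ := by ring
  nlinarith

lemma DecorrelatedWalk.abs_walk_sub_le {v θ : ℕ → Ω → ℝ} {corr : ℕ → ℝ} {s : ℕ → ℝ → ℝ} {K δ e : ℝ}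
    {m : ℕ} (hw : DecorrelatedWalk P v θ corr s K δ e m) (hK : 1 ≤ K)
    (hδ0 : 0 ≤ δ) (hδ1 : δ ≤ 1) (hs : ∀ n, BddLip K (s n)) (j i : ℕ) (ω : Ω) :
    |θ (j + i) ω - θ j ω| ≤ 2 * K ^ 2 * δ * i := by
  induction i with
  | zero => simp
  | succ i ih =>
    have h := hw.abs_step_le hK hδ0 hδ1 hs (j + i) ω
    have := abs_sub_le (θ (j + i + 1) ω) (θ (j + i) ω) (θ j ω)
    push_cast
    rw [← add_assoc]
    linarith

variable [IsProbabilityMeasure P]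

lemma integrable_of_abs_le {f : Ω → ℝ} {b : ℝ} (hf : Measurable f) (h : ∀ ω, |f ω| ≤ b) :
    Integrable f P :=
  Integrable.of_bound hf.aestronglyMeasurable b (Eventually.of_forall h)

lemma abs_integral_le_of_abs_le {f : Ω → ℝ} {b : ℝ} (h : ∀ ω, |f ω| ≤ b) :
    |∫ ω, f ω ∂P| ≤ b := by
  have := norm_integral_le_of_norm_le_const (μ := P) (f := f) (C := b) (Eventually.of_forall h)
  simpa using this

lemma abs_integral_sub_le {f g : Ω → ℝ} {b : ℝ} (hf : Integrable f P) (hg : Integrable g P)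
    (h : ∀ ω, |f ω - g ω| ≤ b) : |∫ ω, f ω ∂P - ∫ ω, g ω ∂P| ≤ b := by
  rw [← integral_sub hf hg]
  exact abs_integral_le_of_abs_le h

variable {v θ : ℕ → Ω → ℝ} {corr : ℕ → ℝ} {s a a1 c Q : ℕ → ℝ → ℝ} {K δ e D0 Dpi κ : ℝ} {m : ℕ}

/-- The angle is moved back to a time 3m before the first potential, the product of potentials is
decorrelated there, and the angle is moved forward again. Each move costs O(mδ), as the walk takes
steps of order δ. -/
lemma DecorrelatedWalk.abs_integral_pair_sub_le (hw : DecorrelatedWalk P v θ corr s K δ e m)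
    (hK : 1 ≤ K) (hδ0 : 0 ≤ δ) (hδ1 : δ ≤ 1) (he : 0 ≤ e) (hs : ∀ n, BddLip K (s n))
    {H : ℝ → ℝ} {b : ℝ} (hH : BddLip b H) {u i : ℕ} (hu : 3 * m ≤ u + 1) (hm : 1 ≤ m)
    (hi : i ≤ 3 * m) :
    |∫ ω, H (θ u ω) * (v (u + 1) ω * v (u + 1 + i) ω) ∂P - (∫ ω, H (θ (u + i) ω) ∂P) * corr i|
      ≤ 18 * K ^ 4 * b * (m * δ + e) := by
  have hb := hH.nonneg
  have hK0 : 0 ≤ K := by linarith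
  obtain ⟨j, hj⟩ := Nat.exists_eq_add_of_le' hu
  have hju : u = j + (3 * m - 1) := by omega
  have mH : ∀ n, Measurable fun ω => H (θ n ω) := fun n =>
    hH.continuous.measurable.comp (hw.measurable_θ n)
  have iH : ∀ n, Integrable (fun ω => H (θ n ω)) P := fun n =>
    integrable_of_abs_le (mH n) fun ω => hH.bound _
  have bv : ∀ n k ω, |v n ω * v k ω| ≤ K ^ 2 := fun n k ω => by
    rw [abs_mul, sq]
    exact mul_le_mul (hw.abs_v_le n ω) (hw.abs_v_le k ω) (abs_nonneg _) hK0
  have iHv : ∀ l n k, Integrable (fun ω => H (θ l ω) * (v n ω * v k ω)) P := fun l n k =>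
    integrable_of_abs_le (b := b * K ^ 2) ((mH l).mul ((hw.measurable_v n).mul (hw.measurable_v k)))
      fun ω => by
        rw [abs_mul]
        exact mul_le_mul (hH.bound _) (bv _ _ _) (abs_nonneg _) hb
  have hm3 : ((3 * m - 1 : ℕ) : ℝ) ≤ 3 * m := by
    exact_mod_cast (by omega : 3 * m - 1 ≤ 3 * m)
  have h1 : |∫ ω, H (θ u ω) * (v (u + 1) ω * v (u + 1 + i) ω) ∂P
      - ∫ ω, H (θ j ω) * (v (u + 1) ω * v (u + 1 + i) ω) ∂P|
      ≤ b * (2 * K ^ 2 * δ * (3 * m)) * K ^ 2 := by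
    refine abs_integral_sub_le (iHv _ _ _) (iHv _ _ _) fun ω => ?_
    rw [← sub_mul, abs_mul]
    refine mul_le_mul ((hH.lip _ _).trans ?_) (bv _ _ _) (abs_nonneg _) (by positivity)
    gcongr
    rw [hju]
    exact (hw.abs_walk_sub_le hK hδ0 hδ1 hs j _ ω).trans (by gcongr)
  have h2 := hw.decor₂ H b hH j (u + 1) i (by omega)
  have h3 : |∫ ω, H (θ j ω) ∂P - ∫ ω, H (θ (u + i) ω) ∂P| ≤ b * (2 * K ^ 2 * δ * (6 * m)) := by
    refine abs_integral_sub_le (iH _) (iH _) fun ω => (hH.lip _ _).trans ?_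
    gcongr
    rw [abs_sub_comm, show u + i = j + (3 * m - 1 + i) by omega]
    refine (hw.abs_walk_sub_le hK hδ0 hδ1 hs j _ ω).trans ?_
    gcongr
    exact_mod_cast (by omega : 3 * m - 1 + i ≤ 6 * m)
  have h4 : |(∫ ω, H (θ j ω) ∂P) * corr i - (∫ ω, H (θ (u + i) ω) ∂P) * corr i|
      ≤ b * (2 * K ^ 2 * δ * (6 * m)) * K := by
    rw [← sub_mul, abs_mul]
    exact mul_le_mul h3 (hw.abs_corr_le i) (abs_nonneg _) (by positivity)
  have h5 := abs_sub_le (∫ ω, H (θ u ω) * (v (u + 1) ω * v (u + 1 + i) ω) ∂P)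
    (∫ ω, H (θ j ω) * (v (u + 1) ω * v (u + 1 + i) ω) ∂P)
    ((∫ ω, H (θ (u + i) ω) ∂P) * corr i)
  have h6 := abs_sub_le (∫ ω, H (θ j ω) * (v (u + 1) ω * v (u + 1 + i) ω) ∂P)
    ((∫ ω, H (θ j ω) ∂P) * corr i) ((∫ ω, H (θ (u + i) ω) ∂P) * corr i)
  have k1 : K ^ 3 ≤ K ^ 4 := pow_le_pow_right₀ hK (by norm_num)
  have k2 : K ≤ K ^ 4 := le_self_pow₀ hK (by norm_num)
  have p1 : K ^ 3 * (b * (m * δ)) ≤ K ^ 4 * (b * (m * δ)) := by gcongr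
  have p2 : K * (b * e) ≤ K ^ 4 * (b * e) := by gcongr
  have p3 : 0 ≤ K ^ 4 * (b * e) := by positivity
  nlinarith

/-- The angle at time t is correlated with the next potential only through recent steps. Moving the
angle back one step at a time, each displacement δ v s contributes δ a' s times a correlation. After
3m steps the angle is decorrelated from the potential. Each step costs δ² plus δ times the error of
`DecorrelatedWalk.abs_integral_pair_sub_le`; the condition t ≥ 6m leaves room for that lemma at
every backward step. -/
lemma DecorrelatedWalk.abs_integral_linear_sub_le (hw : DecorrelatedWalk P v θ corr s K δ e m)
    (hc : StepCoefficients K s a a1 c Q D0 Dpi κ)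
    (hK : 1 ≤ K) (hδ0 : 0 ≤ δ) (hδ1 : δ ≤ 1) (he : 0 ≤ e) (hm : 1 ≤ m) (hmδ : m * δ ≤ 2)
    (n : ℕ) {t : ℕ} (ht : 6 * m ≤ t) :
    |∫ ω, a n (θ t ω) * v (t + 1) ω ∂P
      - δ * ∑ i ∈ Finset.range (3 * m), (∫ ω, a1 n (θ t ω) * s (t - i) (θ t ω) ∂P) * corr (i + 1)|
      ≤ 217 * K ^ 6 * (e + m ^ 2 * δ ^ 2) := by
  have hK0 : 0 ≤ K := by linarith
  have hm' : (1 : ℝ) ≤ m := by exact_mod_cast hm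
  have iav : ∀ (G : ℝ → ℝ) (b : ℝ), BddLip b G → ∀ l k k', Integrable
      (fun ω => G (θ l ω) * (v k ω * v k' ω)) P := fun G b hG l k k' =>
    integrable_of_abs_le (b := b * (K * K)) ((hG.continuous.measurable.comp (hw.measurable_θ l)).mul
      ((hw.measurable_v k).mul (hw.measurable_v k'))) fun ω => by
        have := hG.nonneg
        rw [abs_mul, abs_mul]
        have := hG.bound (θ l ω)
        have := hw.abs_v_le k ω
        have := hw.abs_v_le k' ω
        gcongr
  have ia : ∀ l k, Integrable (fun ω => a n (θ l ω) * v k ω) P := fun l k =>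
    integrable_of_abs_le (b := K * K)
      (((hc.a_bl n).continuous.measurable.comp (hw.measurable_θ l)).mul (hw.measurable_v k))
      fun ω => by
        rw [abs_mul]
        have := (hc.a_bl n).bound (θ l ω)
        have := hw.abs_v_le k ω
        gcongr
  -- one backward step
  have hstep : ∀ i < 3 * m, |(∫ ω, a n (θ (t - i) ω) * v (t + 1) ω ∂P
        - ∫ ω, a n (θ (t - (i + 1)) ω) * v (t + 1) ω ∂P)
        - δ * ((∫ ω, a1 n (θ t ω) * s (t - i) (θ t ω) ∂P) * corr (i + 1))|
      ≤ 5 * K ^ 6 * δ ^ 2 + 36 * K ^ 6 * δ * (m * δ + e) := by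
    intro i hi
    obtain ⟨u, hu⟩ : ∃ u, t = u + (i + 1) := ⟨t - (i + 1), by omega⟩
    have e1 : t - i = u + 1 := by omega
    have e2 : t - (i + 1) = u := by omega
    rw [e1, e2]
    have hH := (hc.a1_bl n).mul (hc.s_bl (u + 1))
    have h1 := hw.abs_integral_pair_sub_le hK hδ0 hδ1 he hc.s_bl hH (u := u) (i := i + 1)
      (by omega) hm (by omega)
    have h2 : |(∫ ω, a n (θ (u + 1) ω) * v (t + 1) ω ∂P - ∫ ω, a n (θ u ω) * v (t + 1) ω ∂P)
        - ∫ ω, δ * ((a1 n (θ u ω) * s (u + 1) (θ u ω)) * (v (u + 1) ω * v (t + 1) ω)) ∂P|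
        ≤ 5 * K ^ 6 * δ ^ 2 := by
      rw [← integral_sub (ia _ _) (ia _ _)]
      refine abs_integral_sub_le ((ia _ _).sub (ia _ _)) ((iav _ _ hH _ _ _).const_mul δ) fun ω => ?_
      have hst := hw.step u ω
      have hst2 := hw.abs_step_le hK hδ0 hδ1 hc.s_bl u ω
      have ht := taylor_first (hc.a_deriv n) (hc.a1_bl n).lip (θ u ω) (θ (u + 1) ω)
      have hv := hw.abs_v_le (t + 1) ω
      have ha1 := (hc.a1_bl n).bound (θ u ω)
      have e3 : a n (θ (u + 1) ω) * v (t + 1) ω - a n (θ u ω) * v (t + 1) ω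
          - δ * ((a1 n (θ u ω) * s (u + 1) (θ u ω)) * (v (u + 1) ω * v (t + 1) ω))
          = ((a n (θ (u + 1) ω) - a n (θ u ω) - a1 n (θ u ω) * (θ (u + 1) ω - θ u ω))
            + a1 n (θ u ω) * (θ (u + 1) ω - θ u ω - δ * v (u + 1) ω * s (u + 1) (θ u ω)))
            * v (t + 1) ω := by ring
      have h3 : |(a n (θ (u + 1) ω) - a n (θ u ω) - a1 n (θ u ω) * (θ (u + 1) ω - θ u ω))
            + a1 n (θ u ω) * (θ (u + 1) ω - θ u ω - δ * v (u + 1) ω * s (u + 1) (θ u ω))|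
          ≤ K * (2 * K ^ 2 * δ) ^ 2 + K * (K * δ ^ 2) := by
        refine (abs_add_le _ _).trans (add_le_add (ht.trans ?_) ?_)
        · gcongr
        · rw [abs_mul]
          gcongr
      rw [e3, abs_mul]
      calc _ ≤ (K * (2 * K ^ 2 * δ) ^ 2 + K * (K * δ ^ 2)) * K := by gcongr
        _ = (4 * K ^ 6 + K ^ 3) * δ ^ 2 := by ring
        _ ≤ (4 * K ^ 6 + K ^ 6) * δ ^ 2 := by
            gcongr
            norm_num
        _ = _ := by ring
    rw [integral_const_mul, show t + 1 = u + 1 + (i + 1) by omega] at h2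
    rw [show t = u + (i + 1) from hu]
    rw [show u + (i + 1) + 1 = u + 1 + (i + 1) by omega]
    have h4 : |δ * ∫ ω, (a1 n (θ u ω) * s (u + 1) (θ u ω)) * (v (u + 1) ω * v (u + 1 + (i + 1)) ω) ∂P
        - δ * ((∫ ω, a1 n (θ (u + (i + 1)) ω) * s (u + 1) (θ (u + (i + 1)) ω) ∂P) * corr (i + 1))|
        ≤ 36 * K ^ 6 * δ * (m * δ + e) := by
      rw [← mul_sub, abs_mul, abs_of_nonneg hδ0]
      calc _ ≤ δ * (18 * K ^ 4 * (2 * (K * K)) * (m * δ + e)) := by gcongr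
        _ = _ := by ring
    exact (abs_sub_le _ _ _).trans (add_le_add h2 h4)
  -- The sum of the one-step differences telescopes to the value at time t minus the value at time t
  -- - 3m, the latter being bounded by decorrelation.
  have htel := Finset.sum_range_sub' (fun i => ∫ ω, a n (θ (t - i) ω) * v (t + 1) ω ∂P) (3 * m)
  have hfar := hw.decor₁ (a n) K (hc.a_bl n) (t - 3 * m) (t + 1) (by omega)
  have hsum : |∑ i ∈ Finset.range (3 * m), ((∫ ω, a n (θ (t - i) ω) * v (t + 1) ω ∂P
        - ∫ ω, a n (θ (t - (i + 1)) ω) * v (t + 1) ω ∂P)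
        - δ * ((∫ ω, a1 n (θ t ω) * s (t - i) (θ t ω) ∂P) * corr (i + 1)))|
      ≤ (3 * m) * (5 * K ^ 6 * δ ^ 2 + 36 * K ^ 6 * δ * (m * δ + e)) := by
    refine (Finset.abs_sum_le_sum_abs _ _).trans ?_
    refine (Finset.sum_le_sum fun i hi => hstep i (Finset.mem_range.mp hi)).trans ?_
    rw [Finset.sum_const, Finset.card_range, nsmul_eq_mul]
    push_cast
    rfl
  rw [Finset.sum_sub_distrib, htel, ← Finset.mul_sum] at hsum
  simp only [Nat.sub_zero] at hsum
  set S := δ * ∑ i ∈ Finset.range (3 * m),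
    (∫ ω, a1 n (θ t ω) * s (t - i) (θ t ω) ∂P) * corr (i + 1)
  set A := ∫ ω, a n (θ t ω) * v (t + 1) ω ∂P
  set B := ∫ ω, a n (θ (t - 3 * m) ω) * v (t + 1) ω ∂P
  have hA : |A - S| ≤ |A - B - S| + |B| := by
    have := abs_add_le (A - B - S) B
    rwa [show A - B - S + B = A - S by ring] at this
  refine hA.trans ((add_le_add hsum hfar).trans ?_)
  have q1 : K * K * e ≤ K ^ 6 * e := by
    gcongr
    calc K * K = K ^ 2 := by ring
      _ ≤ K ^ 6 := pow_le_pow_right₀ hK (by norm_num)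
  have q2 : K ^ 6 * (m * δ * δ) ≤ K ^ 6 * (m ^ 2 * δ ^ 2) := by
    refine mul_le_mul_of_nonneg_left ?_ (by positivity)
    calc (m : ℝ) * δ * δ = m * 1 * δ ^ 2 := by ring
      _ ≤ m * m * δ ^ 2 := by gcongr
      _ = _ := by ring
  have q3 : K ^ 6 * (m * δ * e) ≤ K ^ 6 * (2 * e) := by gcongr
  have q4 : 0 ≤ K ^ 6 * (m ^ 2 * δ ^ 2) := by positivity
  nlinarith

/-- The linear term supplies the correlations at distances i ≥ 1 and the quadratic term half the
correlation at distance 0. Splitting the two-periodic s into its mean and its alternating part, the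
former meets the plain correlation sum and the latter the alternating sum, hence the halves of D0
and Dpi appearing in Q. -/
lemma DecorrelatedWalk.abs_integral_gain_sub_le (hw : DecorrelatedWalk P v θ corr s K δ e m)
    (hc : StepCoefficients K s a a1 c Q D0 Dpi κ)
    (hK : 1 ≤ K) (hδ0 : 0 ≤ δ) (hδ1 : δ ≤ 1) (he : 0 ≤ e) (hm : 1 ≤ m) (hmδ : m * δ ≤ 2)
    {T : ℝ}
    (hT0 : |corr 0 / 2 + ∑ i ∈ Finset.range (3 * m), corr (i + 1) - D0 / 2| ≤ T)
    (hTpi : |corr 0 / 2 + ∑ i ∈ Finset.range (3 * m), (-1) ^ (i + 1) * corr (i + 1) - Dpi / 2| ≤ T)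
    {t : ℕ} (ht : 6 * m ≤ t) {Y : Ω → ℝ} (hYm : Measurable Y)
    (hY : ∀ ω, |Y ω - (δ * v (t + 1) ω * a (t + 1) (θ t ω) + δ ^ 2 * (v (t + 1) ω ^ 2 *
      (a1 (t + 1) (θ t ω) * s (t + 1) (θ t ω) / 2) + c (t + 1) (θ t ω)))| ≤ K * δ ^ 3) :
    |∫ ω, Y ω ∂P - δ ^ 2 * ∫ ω, Q (t + 1) (θ t ω) ∂P|
      ≤ 300 * K ^ 6 * (δ * e + m ^ 2 * δ ^ 3 + δ ^ 2 * T) := by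
  have hK0 : 0 ≤ K := by linarith
  have hm' : (1 : ℝ) ≤ m := by exact_mod_cast hm
  have hT : 0 ≤ T := (abs_nonneg _).trans hT0
  have iG : ∀ (G : ℝ → ℝ) (b : ℝ), BddLip b G → Integrable (fun ω => G (θ t ω)) P :=
    fun G b hG => integrable_of_abs_le (hG.continuous.measurable.comp (hw.measurable_θ t))
      fun ω => hG.bound _
  have hH := (hc.a1_bl (t + 1)).mul (hc.s_bl (t + 1))
  have i1 : Integrable (fun ω => a (t + 1) (θ t ω) * v (t + 1) ω) P :=
    integrable_of_abs_le (b := K * K) (((hc.a_bl _).continuous.measurable.comp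
      (hw.measurable_θ t)).mul (hw.measurable_v _)) fun ω => by
        rw [abs_mul]
        have := (hc.a_bl (t + 1)).bound (θ t ω)
        have := hw.abs_v_le (t + 1) ω
        gcongr
  have i2 : Integrable (fun ω => a1 (t + 1) (θ t ω) * s (t + 1) (θ t ω) *
      (v (t + 1) ω * v (t + 1 + 0) ω)) P :=
    integrable_of_abs_le (b := 2 * (K * K) * (K * K)) ((hH.continuous.measurable.comp
      (hw.measurable_θ t)).mul ((hw.measurable_v _).mul (hw.measurable_v _))) fun ω => by
        rw [abs_mul, abs_mul (v _ ω)]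
        have := hH.bound (θ t ω)
        have := hw.abs_v_le (t + 1) ω
        gcongr
  have i3 := iG _ _ (hc.c_bl (t + 1))
  have iY : Integrable Y P := by
    have h0 : Integrable (fun ω => δ * v (t + 1) ω * a (t + 1) (θ t ω) + δ ^ 2 *
      (v (t + 1) ω ^ 2 * (a1 (t + 1) (θ t ω) * s (t + 1) (θ t ω) / 2) + c (t + 1) (θ t ω))) P := by
      have := (i1.const_mul δ).add (((i2.const_mul (1 / 2)).add i3).const_mul (δ ^ 2))
      refine this.congr (Eventually.of_forall fun ω => ?_)
      simp only [Pi.add_apply, add_zero]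
      ring
    have h1 : Integrable (fun ω => Y ω - (δ * v (t + 1) ω * a (t + 1) (θ t ω) + δ ^ 2 *
      (v (t + 1) ω ^ 2 * (a1 (t + 1) (θ t ω) * s (t + 1) (θ t ω) / 2) + c (t + 1) (θ t ω)))) P :=
      Integrable.of_bound (hYm.aestronglyMeasurable.sub h0.aestronglyMeasurable) _
        (Eventually.of_forall hY)
    have := h1.add h0
    refine this.congr (Eventually.of_forall fun ω => ?_)
    simp
  have d1 : |∫ ω, Y ω ∂P - (δ * (∫ ω, a (t + 1) (θ t ω) * v (t + 1) ω ∂P) + δ ^ 2 * (1 / 2 *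
      (∫ ω, a1 (t + 1) (θ t ω) * s (t + 1) (θ t ω) * (v (t + 1) ω * v (t + 1 + 0) ω) ∂P)
      + ∫ ω, c (t + 1) (θ t ω) ∂P))| ≤ K * δ ^ 3 := by
    have i4 : Integrable (fun ω => 1 / 2 * (a1 (t + 1) (θ t ω) * s (t + 1) (θ t ω) *
      (v (t + 1) ω * v (t + 1 + 0) ω)) + c (t + 1) (θ t ω)) P := (i2.const_mul _).add i3
    rw [← integral_const_mul, ← integral_const_mul (1 / 2), ← integral_add (i2.const_mul _) i3,
      ← integral_const_mul, ← integral_add (i1.const_mul _) (i4.const_mul _)]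
    refine abs_integral_sub_le iY ((i1.const_mul _).add (i4.const_mul _)) fun ω => ?_
    refine le_trans (le_of_eq ?_) (hY ω)
    congr 1
    simp only [add_zero]
    ring
  have d2 := hw.abs_integral_linear_sub_le hc hK hδ0 hδ1 he hm hmδ (t + 1) ht
  have d3 := hw.abs_integral_pair_sub_le hK hδ0 hδ1 he hc.s_bl hH (u := t) (i := 0) (by omega) hm
    (by omega)
  -- replace the sums over correlations by the spectral densities
  have hpar : ∀ i, i < 3 * m → ∀ x, s (t - i) x = (s (t + 1) x + s (t + 2) x) / 2
      + (-1) ^ (i + 1) * ((s (t + 1) x - s (t + 2) x) / 2) := by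
    intro i
    induction i using Nat.strong_induction_on with
    | _ i ih =>
      intro hi x
      match i, hi, ih with
      | 0, _, _ =>
        rw [hc.s_period t]
        simp
        ring
      | 1, hi, _ =>
        have := hc.s_period (t - 1)
        rw [show t - 1 + 2 = t + 1 by omega] at this
        rw [← this]
        ring
      | k + 2, hi, ih =>
        have h1 := ih k (by omega) (by omega) x
        have h2 := hc.s_period (t - (k + 2))
        rw [show t - (k + 2) + 2 = t - k by omega] at h2
        rw [← h2, h1]
        ring
  have d4 : |(1 / 2 * ((∫ ω, a1 (t + 1) (θ t ω) * s (t + 1) (θ t ω) ∂P) * corr 0)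
      + ∑ i ∈ Finset.range (3 * m),
        (∫ ω, a1 (t + 1) (θ t ω) * s (t - i) (θ t ω) ∂P) * corr (i + 1)
      + ∫ ω, c (t + 1) (θ t ω) ∂P) - ∫ ω, Q (t + 1) (θ t ω) ∂P| ≤ 2 * K ^ 2 * T := by
    have hi : ∀ k, Integrable (fun ω => a1 (t + 1) (θ t ω) * s k (θ t ω)) P := fun k =>
      iG _ _ ((hc.a1_bl (t + 1)).mul (hc.s_bl k))
    have j1 : Integrable (fun ω => 1 / 2 * (a1 (t + 1) (θ t ω) * s (t + 1) (θ t ω) * corr 0)) P :=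
      ((hi _).mul_const _).const_mul _
    have j2 : Integrable (fun ω => ∑ i ∈ Finset.range (3 * m),
        a1 (t + 1) (θ t ω) * s (t - i) (θ t ω) * corr (i + 1)) P :=
      integrable_finsetSum _ fun i _ => (hi _).mul_const _
    have j3 : Integrable (fun ω => 1 / 2 * (a1 (t + 1) (θ t ω) * s (t + 1) (θ t ω) * corr 0)
        + ∑ i ∈ Finset.range (3 * m), a1 (t + 1) (θ t ω) * s (t - i) (θ t ω) * corr (i + 1)) P :=
      j1.add j2
    simp_rw [← integral_mul_const]
    rw [← integral_const_mul, ← integral_finsetSum _ (fun i _ => (hi _).mul_const _),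
      ← integral_add j1 j2, ← integral_add j3 i3]
    refine abs_integral_sub_le (j3.add i3) (iG _ _ (hc.Q_bl _)) fun ω => ?_
    set x := θ t ω
    have e1 : ∑ i ∈ Finset.range (3 * m), a1 (t + 1) x * s (t - i) x * corr (i + 1)
        = a1 (t + 1) x * ((s (t + 1) x + s (t + 2) x) / 2 *
            ∑ i ∈ Finset.range (3 * m), corr (i + 1)
          + (s (t + 1) x - s (t + 2) x) / 2 *
            ∑ i ∈ Finset.range (3 * m), (-1) ^ (i + 1) * corr (i + 1)) := by
      rw [Finset.mul_sum, Finset.mul_sum, ← Finset.sum_add_distrib, Finset.mul_sum]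
      refine Finset.sum_congr rfl fun i hi => ?_
      rw [hpar i (Finset.mem_range.mp hi) x]
      ring
    rw [e1, hc.Q_eq]
    set S0 := ∑ i ∈ Finset.range (3 * m), corr (i + 1)
    set Sp := ∑ i ∈ Finset.range (3 * m), (-1) ^ (i + 1) * corr (i + 1)
    have b1 := (hc.s_bl (t + 1)).bound x
    have b2 := (hc.s_bl (t + 2)).bound x
    have b3 := (hc.a1_bl (t + 1)).bound x
    have e2 : 1 / 2 * (a1 (t + 1) x * s (t + 1) x * corr 0)
        + a1 (t + 1) x * ((s (t + 1) x + s (t + 2) x) / 2 * S0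
          + (s (t + 1) x - s (t + 2) x) / 2 * Sp) + c (t + 1) x
        - (c (t + 1) x + a1 (t + 1) x * ((s (t + 1) x + s (t + 1 + 1) x) / 2 * (D0 / 2)
          + (s (t + 1) x - s (t + 1 + 1) x) / 2 * (Dpi / 2)))
        = a1 (t + 1) x * ((s (t + 1) x + s (t + 2) x) / 2 * (corr 0 / 2 + S0 - D0 / 2)
          + (s (t + 1) x - s (t + 2) x) / 2 * (corr 0 / 2 + Sp - Dpi / 2)) := by
      ring
    rw [e2, abs_mul]
    have b4 : |(s (t + 1) x + s (t + 2) x) / 2| ≤ K := by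
      rw [abs_le] at *
      constructor <;> linarith [b1.1, b1.2, b2.1, b2.2]
    have b5 : |(s (t + 1) x - s (t + 2) x) / 2| ≤ K := by
      rw [abs_le] at *
      constructor <;> linarith [b1.1, b1.2, b2.1, b2.2]
    have b6 : |(s (t + 1) x + s (t + 2) x) / 2 * (corr 0 / 2 + S0 - D0 / 2)
          + (s (t + 1) x - s (t + 2) x) / 2 * (corr 0 / 2 + Sp - Dpi / 2)| ≤ K * T + K * T := by
      refine (abs_add_le _ _).trans (add_le_add ?_ ?_)
      · rw [abs_mul]
        gcongr
      · rw [abs_mul]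
        gcongr
    calc _ ≤ K * (K * T + K * T) := by gcongr
      _ = _ := by ring
  set I1 := ∫ ω, a (t + 1) (θ t ω) * v (t + 1) ω ∂P
  set I2 := ∫ ω, a1 (t + 1) (θ t ω) * s (t + 1) (θ t ω) * (v (t + 1) ω * v (t + 1 + 0) ω) ∂P
  set I3 := ∫ ω, c (t + 1) (θ t ω) ∂P
  set S := ∑ i ∈ Finset.range (3 * m), (∫ ω, a1 (t + 1) (θ t ω) * s (t - i) (θ t ω) ∂P) * corr (i + 1)
  simp only [add_zero] at d3
  set J := (∫ ω, a1 (t + 1) (θ t ω) * s (t + 1) (θ t ω) ∂P) * corr 0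
  set q := ∫ ω, Q (t + 1) (θ t ω) ∂P
  have e3 : ∫ ω, Y ω ∂P - δ ^ 2 * q = (∫ ω, Y ω ∂P - (δ * I1 + δ ^ 2 * (1 / 2 * I2 + I3)))
      + δ * (I1 - δ * S) + δ ^ 2 * (1 / 2) * (I2 - J)
      + δ ^ 2 * ((1 / 2 * J + S + I3) - q) := by ring
  rw [e3]
  have f2 : |δ * (I1 - δ * S)| ≤ δ * (217 * K ^ 6 * (e + m ^ 2 * δ ^ 2)) := by
    rw [abs_mul, abs_of_nonneg hδ0]
    gcongr
  have f3 : |δ ^ 2 * (1 / 2) * (I2 - J)| ≤ δ ^ 2 * (1 / 2) *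
      (18 * K ^ 4 * (2 * (K * K)) * (m * δ + e)) := by
    rw [abs_mul, abs_of_nonneg (by positivity : 0 ≤ δ ^ 2 * (1 / 2))]
    gcongr
  have f4 : |δ ^ 2 * ((1 / 2 * J + S + I3) - q)| ≤ δ ^ 2 * (2 * K ^ 2 * T) := by
    rw [abs_mul, abs_of_nonneg (by positivity : 0 ≤ δ ^ 2)]
    gcongr
  refine (abs_add_le _ _).trans (le_trans (add_le_add ((abs_add_le _ _).trans
    (add_le_add ((abs_add_le _ _).trans (add_le_add d1 f2)) f3)) f4) ?_)
  have g1 : K * δ ^ 3 ≤ K ^ 6 * (m ^ 2 * δ ^ 3) := by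
    calc K * δ ^ 3 = K * (1 * δ ^ 3) := by ring
      _ ≤ K ^ 6 * (m ^ 2 * δ ^ 3) := by
        gcongr
        · exact le_self_pow₀ hK (by norm_num)
        · exact one_le_pow₀ hm'
  have g2 : K ^ 6 * (δ ^ 2 * (m * δ)) ≤ K ^ 6 * (m ^ 2 * δ ^ 3) := by
    calc K ^ 6 * (δ ^ 2 * (m * δ)) = K ^ 6 * (m * 1 * δ ^ 3) := by ring
      _ ≤ K ^ 6 * (m * m * δ ^ 3) := by gcongr
      _ = _ := by ring
  have g3 : K ^ 6 * (δ ^ 2 * e) ≤ K ^ 6 * (δ * e) := by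
    calc K ^ 6 * (δ ^ 2 * e) = K ^ 6 * (δ * δ * e) := by ring
      _ ≤ K ^ 6 * (δ * 1 * e) := by gcongr
      _ = _ := by ring
  have g4 : K ^ 2 * (δ ^ 2 * T) ≤ K ^ 6 * (δ ^ 2 * T) := by
    gcongr
    norm_num
  have g5 : 0 ≤ K ^ 6 * (m ^ 2 * δ ^ 3) := by positivity
  have g6 : 0 ≤ K ^ 6 * (δ * e) := by positivity
  have g7 : 0 ≤ K ^ 6 * (δ ^ 2 * T) := by positivity
  nlinarith

/-- Over two consecutive steps the mean gain is `2 δ² κ` up to the error of the method. -/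
lemma DecorrelatedWalk.abs_integral_two_gains_sub_le
    (hw : DecorrelatedWalk P v θ corr s K δ e m)
    (hc : StepCoefficients K s a a1 c Q D0 Dpi κ)
    (hK : 1 ≤ K) (hδ0 : 0 ≤ δ) (hδ1 : δ ≤ 1) (he : 0 ≤ e) (hm : 1 ≤ m) (hmδ : m * δ ≤ 2)
    {T : ℝ}
    (hT0 : |corr 0 / 2 + ∑ i ∈ Finset.range (3 * m), corr (i + 1) - D0 / 2| ≤ T)
    (hTpi : |corr 0 / 2 + ∑ i ∈ Finset.range (3 * m), (-1) ^ (i + 1) * corr (i + 1) - Dpi / 2| ≤ T)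
    {Y : ℕ → Ω → ℝ} (hYm : ∀ n, Measurable (Y n))
    (hY : ∀ t ω, |Y (t + 1) ω - (δ * v (t + 1) ω * a (t + 1) (θ t ω) + δ ^ 2 * (v (t + 1) ω ^ 2 *
      (a1 (t + 1) (θ t ω) * s (t + 1) (θ t ω) / 2) + c (t + 1) (θ t ω)))| ≤ K * δ ^ 3)
    {t : ℕ} (ht : 6 * m ≤ t) :
    |∫ ω, Y (t + 1) ω ∂P + ∫ ω, Y (t + 2) ω ∂P - 2 * (δ ^ 2 * κ)|
      ≤ 602 * K ^ 6 * (δ * e + m ^ 2 * δ ^ 3 + δ ^ 2 * T) := by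
  have hK0 : 0 ≤ K := by linarith
  have hm' : (1 : ℝ) ≤ m := by exact_mod_cast hm
  have hT : 0 ≤ T := (abs_nonneg _).trans hT0
  have h1 := hw.abs_integral_gain_sub_le hc hK hδ0 hδ1 he hm hmδ hT0 hTpi ht (hYm _) (hY t)
  have h2 := hw.abs_integral_gain_sub_le hc hK hδ0 hδ1 he hm hmδ hT0 hTpi (t := t + 1) (by omega)
    (hYm _) (hY (t + 1))
  have iQ : ∀ n k, Integrable (fun ω => Q n (θ k ω)) P := fun n k =>
    integrable_of_abs_le ((hc.Q_bl n).continuous.measurable.comp (hw.measurable_θ k))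
      fun ω => (hc.Q_bl n).bound _
  -- The cancellation of the angle dependence needs Q at both sites at the same angle; the shift by
  -- one step costs a further factor δ.
  have h3 : |∫ ω, Q (t + 2) (θ (t + 1) ω) ∂P - ∫ ω, Q (t + 2) (θ t ω) ∂P|
      ≤ K * (2 * K ^ 2 * δ) := by
    refine abs_integral_sub_le (iQ _ _) (iQ _ _) fun ω => ((hc.Q_bl _).lip _ _).trans ?_
    gcongr
    exact hw.abs_step_le hK hδ0 hδ1 hc.s_bl t ω
  have h4 : ∫ ω, Q (t + 1) (θ t ω) ∂P + ∫ ω, Q (t + 2) (θ t ω) ∂P = 2 * κ := by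
    rw [← integral_add (iQ _ _) (iQ _ _)]
    have : ∀ ω, Q (t + 1) (θ t ω) + Q (t + 2) (θ t ω) = 2 * κ := fun ω => hc.Q_sum (t + 1) _
    simp_rw [this]
    simp
  set q1 := ∫ ω, Q (t + 1) (θ t ω) ∂P
  set q2 := ∫ ω, Q (t + 2) (θ t ω) ∂P
  set q3 := ∫ ω, Q (t + 2) (θ (t + 1) ω) ∂P
  have e1 : ∫ ω, Y (t + 1) ω ∂P + ∫ ω, Y (t + 2) ω ∂P - 2 * (δ ^ 2 * κ)
      = (∫ ω, Y (t + 1) ω ∂P - δ ^ 2 * q1) + (∫ ω, Y (t + 2) ω ∂P - δ ^ 2 * q3)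
        + δ ^ 2 * (q3 - q2) := by
    linear_combination δ ^ 2 * h4
  rw [e1]
  have h5 : |δ ^ 2 * (q3 - q2)| ≤ δ ^ 2 * (K * (2 * K ^ 2 * δ)) := by
    rw [abs_mul, abs_of_nonneg (by positivity : 0 ≤ δ ^ 2)]
    gcongr
  refine (abs_add_le _ _).trans ((add_le_add ((abs_add_le _ _).trans (add_le_add h1 h2))
    h5).trans ?_)
  have g1 : K ^ 3 * δ ^ 3 ≤ K ^ 6 * (m ^ 2 * δ ^ 3) := by
    calc K ^ 3 * δ ^ 3 = K ^ 3 * (1 * δ ^ 3) := by ring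
      _ ≤ K ^ 6 * (m ^ 2 * δ ^ 3) := by
        gcongr
        · norm_num
        · exact one_le_pow₀ hm'
  have g6 : 0 ≤ K ^ 6 * (δ * e) := by positivity
  have g7 : 0 ≤ K ^ 6 * (δ ^ 2 * T) := by positivity
  nlinarith

end

end WeakDisorder

namespace WeakDisorder

/-! ### Orbits of slow dynamics driven by the potential -/

/-- The orbit of `x` under the maps `F n (u n)`, `n = 1, 2, …`. -/
def orbit (F : ℕ → ℝ → ℝ → ℝ) (u : ℕ → ℝ) (x : ℝ) : ℕ → ℝ
  | 0 => x
  | n + 1 => F (n + 1) (u (n + 1)) (orbit F u x n)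

/-- The field `lip` says that an error in the angle is amplified by at most 1 + Kδ per step, while
an error in the potential enters with a small factor. This makes the orbit nearly a function of the
coordinates near and before the current site. -/
structure SlowDynamics (F : ℕ → ℝ → ℝ → ℝ) (s : ℕ → ℝ → ℝ) (B K δ : ℝ) : Prop where
  measurable : ∀ n, Measurable (Function.uncurry (F n))
  step : ∀ n v θ, |v| ≤ B → |F n v θ - θ - δ * v * s n θ| ≤ K * δ ^ 2
  lip : ∀ n v v' θ θ', |v| ≤ B → |v'| ≤ B →
    |F n v θ - F n v' θ'| ≤ (1 + K * δ) * |θ - θ'| + K * δ * |v - v'|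

section

variable {A : Type*} [MeasurableSpace A] {V : (ℤ → A) → ℝ} {F : ℕ → ℝ → ℝ → ℝ}
  {s : ℕ → ℝ → ℝ} {B K K₀ δ r : ℝ}

lemma SlowDynamics.measurable_orbit (hF : SlowDynamics F s B K δ) (hV : PotentialBound r K₀ V)
    (n : ℕ) : Measurable fun p : ℝ × (ℤ → A) => orbit F (potential V p.2) p.1 n := by
  induction n with
  | zero => exact measurable_fst
  | succ n ih =>
    exact (hF.measurable (n + 1)).comp
      (((hV.measurable_potential (n + 1)).comp measurable_snd).prodMk ih)

/-- The orbit up to the site `j` depends little on the configuration beyond `j + m`. -/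
lemma SlowDynamics.variesBy_orbit (hF : SlowDynamics F s B K δ) (hV : PotentialBound r K₀ V)
    (hKK : K₀ ≤ B) (hK : 1 ≤ K) (hK₀ : 0 ≤ K₀) (hr0 : 0 < r) (hr1 : r < 1) (hδ0 : 0 ≤ δ)
    (hδ1 : δ ≤ 1) (hδr : (1 + K * δ) * r ≤ (1 + r) / 2) (x : ℝ) {m : ℕ} (hm : 1 ≤ m) (j : ℕ) :
    VariesBy (2 * K * K₀ / (1 - r) * r ^ m) (-((j : ℤ) + m)) (j + m)
      (fun ω => orbit F (potential V ω) x j) := by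
  intro ω ω' hω
  set D := 2 * K * K₀ / (1 - r) with hD
  have h1r : 0 < 1 - r := by linarith
  have hD0 : 0 ≤ D := by positivity
  have hDr : D * (1 - r) / 2 = K * K₀ := by rw [hD]; field_simp
  -- At time k the potential is determined by the fixed coordinates up to an error r^{j+m-k}. The
  -- amplification 1 + Kδ is beaten by this geometric gain, because (1+Kδ)r ≤ (1+r)/2, and D is the
  -- constant for which the induction closes.
  have key : ∀ k ≤ j, |orbit F (potential V ω) x k - orbit F (potential V ω') x k|
      ≤ D * r ^ (j + m - k) := by
    intro k
    induction k with
    | zero => intro _; simp [orbit]; positivity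
    | succ k ih =>
      intro hk
      have ih' := ih (by omega)
      obtain ⟨q, hq⟩ : ∃ q, j + m - k = q + 1 := ⟨j + m - k - 1, by omega⟩
      have hq2 : j + m - (k + 1) = q := by omega
      rw [hq] at ih'
      rw [hq2]
      have hv := hV.variesBy_potential (m := q) (by omega) (k + 1) (k := -((j : ℤ) + m))
        (l := j + m) (by push_cast; omega) (by push_cast; omega) ω ω' hω
      have hl := hF.lip (k + 1) (potential V ω (k + 1)) (potential V ω' (k + 1))
        (orbit F (potential V ω) x k) (orbit F (potential V ω') x k)
        ((hV.abs_potential_le _ _).trans hKK) ((hV.abs_potential_le _ _).trans hKK)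
      simp only [orbit]
      refine hl.trans ?_
      calc _ ≤ (1 + K * δ) * (D * r ^ (q + 1)) + K * δ * (K₀ * r ^ q) := by gcongr
        _ = ((1 + K * δ) * r * D + K * δ * K₀) * r ^ q := by ring
        _ ≤ ((1 + r) / 2 * D + K * 1 * K₀) * r ^ q := by gcongr
        _ = D * r ^ q := by rw [mul_one, ← hDr]; ring
  have := key j le_rfl
  rwa [Nat.add_sub_cancel_left] at this

end

/-- A Lipschitz function of the angle at time j is an observable nearly determined by the
coordinates up to j + m, so decorrelation of past observables applies to it. -/
lemma decorrelatedWalk_orbit {A : Type*} [MeasurableSpace A] {P : Measure (ℤ → A)}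
    {V : (ℤ → A) → ℝ} {F : ℕ → ℝ → ℝ → ℝ} {s : ℕ → ℝ → ℝ} {B K K₀ K' δ r α : ℝ}
    (hF : SlowDynamics F s B K δ) (hV : PotentialBound r K₀ V)
    (hdec : ∀ m : ℕ, 1 ≤ m → ∀ j n' n : ℕ, j + 3 * m ≤ n' → n' ≤ n →
      ∀ (f : (ℤ → A) → ℝ) (b : ℝ), Measurable f → (∀ ω, |f ω| ≤ b) →
        VariesBy (b * r ^ m) (-((j : ℤ) + m)) (j + m) f →
        |∫ ω, f ω * potential V ω n ∂P| ≤ K₀ * b * (m : ℝ) ^ (-α) ∧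
        |∫ ω, f ω * (potential V ω n' * potential V ω n) ∂P
          - (∫ ω, f ω ∂P) * correlation P V ((n - n' : ℕ) : ℤ)| ≤ K₀ * b * (m : ℝ) ^ (-α))
    (hcorr : ∀ n : ℕ, |correlation P V n| ≤ K')
    (hKK : K₀ ≤ B) (hK : 1 ≤ K) (hK₀ : 0 ≤ K₀) (hr0 : 0 < r) (hr1 : r < 1) (hδ0 : 0 ≤ δ)
    (hδ1 : δ ≤ 1) (hδr : (1 + K * δ) * r ≤ (1 + r) / 2) (hK' : K ≤ K')
    (hK'' : K₀ * (1 + 2 * K * K₀ / (1 - r)) ≤ K') (x : ℝ) {m : ℕ} (hm : 1 ≤ m) :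
    DecorrelatedWalk P (fun n ω => potential V ω n) (fun n ω => orbit F (potential V ω) x n)
      (fun n => correlation P V n) s K' δ ((m : ℝ) ^ (-α)) m := by
  have hmeas : ∀ n, Measurable fun ω => orbit F (potential V ω) x n := fun n =>
    (hF.measurable_orbit hV n).comp measurable_prodMk_left
  have h1r : 0 < 1 - r := by linarith
  have hD0 : 0 ≤ 2 * K * K₀ / (1 - r) := by positivity
  have hobs : ∀ (H : ℝ → ℝ) (b : ℝ), BddLip b H → ∀ j n' n : ℕ, j + 3 * m ≤ n' → n' ≤ n →
      |∫ ω, H (orbit F (potential V ω) x j) * potential V ω n ∂P| ≤ K' * b * (m : ℝ) ^ (-α) ∧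
      |∫ ω, H (orbit F (potential V ω) x j) * (potential V ω n' * potential V ω n) ∂P
          - (∫ ω, H (orbit F (potential V ω) x j) ∂P) * correlation P V ((n - n' : ℕ) : ℤ)|
          ≤ K' * b * (m : ℝ) ^ (-α) := by
    intro H b hH j n' n h1 h2
    have hb := hH.nonneg
    -- Decorrelation uses one constant for both the size and the variation of the observable; b is
    -- enlarged to dominate both.
    have hle : b ≤ b * (1 + 2 * K * K₀ / (1 - r)) := le_mul_of_one_le_right hb (by linarith)
    have h := hdec m hm j n' n h1 h2 (fun ω => H (orbit F (potential V ω) x j))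
      (b * (1 + 2 * K * K₀ / (1 - r))) (hH.continuous.measurable.comp (hmeas j))
      (fun ω => (hH.bound _).trans hle) (fun ω ω' hω => by
        refine (hH.lip _ _).trans ?_
        have := hF.variesBy_orbit hV hKK hK hK₀ hr0 hr1 hδ0 hδ1 hδr x hm j ω ω' hω
        calc _ ≤ b * (2 * K * K₀ / (1 - r) * r ^ m) := by gcongr
          _ ≤ b * ((1 + 2 * K * K₀ / (1 - r)) * r ^ m) := by gcongr; linarith
          _ = _ := by ring)
    have hK3 : K₀ * (b * (1 + 2 * K * K₀ / (1 - r))) * (m : ℝ) ^ (-α) ≤ K' * b * (m : ℝ) ^ (-α) := by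
      have : K₀ * (b * (1 + 2 * K * K₀ / (1 - r))) = K₀ * (1 + 2 * K * K₀ / (1 - r)) * b := by ring
      rw [this]
      gcongr
    exact ⟨h.1.trans hK3, h.2.trans hK3⟩
  refine ⟨hV.measurable_potential, hmeas, fun n ω => (hV.abs_potential_le n ω).trans ((le_mul_of_one_le_right hK₀ (by linarith)).trans hK''),
    hcorr, fun n ω => ?_, fun H b hH j n hj => (hobs H b hH j n n hj le_rfl).1,
    fun H b hH j n i hj => ?_⟩
  · refine (hF.step (n + 1) _ _ ((hV.abs_potential_le _ _).trans hKK)).trans ?_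
    gcongr
  · have := (hobs H b hH j n (n + i) hj (by omega)).2
    rwa [Nat.add_sub_cancel_left] at this

/-! ### Infinitesimal shears of the plane in polar coordinates -/

/-- Coefficients of the relative increment `ζ` of a vector `|z| e^{iθ}` in one step,
`ζ = δ v (cA + i sA) + δ² (cB + i sB) + δ³ (v + ε δ) (cR + i sR)`. -/
structure StepData where
  cA : ℕ → ℝ → ℝ
  sA : ℕ → ℝ → ℝ
  cB : ℕ → ℝ → ℝ
  sB : ℕ → ℝ → ℝ
  cR : ℕ → ℝ → ℝ
  sR : ℕ → ℝ → ℝ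

namespace StepData

noncomputable def zeta (S : StepData) (δ ε : ℝ) (n : ℕ) (v θ : ℝ) : ℂ :=
  (δ * v : ℝ) * ⟨S.cA n θ, S.sA n θ⟩ + (δ ^ 2 : ℝ) * ⟨S.cB n θ, S.sB n θ⟩
    + (δ ^ 3 * (v + ε * δ) : ℝ) * ⟨S.cR n θ, S.sR n θ⟩

/-- The new angle after one step. -/
noncomputable def angleStep (S : StepData) (δ ε : ℝ) (n : ℕ) (v θ : ℝ) : ℝ :=
  θ + (Complex.log (1 + S.zeta δ ε n v θ)).im

/-- The logarithmic growth in one step. -/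
noncomputable def gainStep (S : StepData) (δ ε : ℝ) (n : ℕ) (v θ : ℝ) : ℝ :=
  (Complex.log (1 + S.zeta δ ε n v θ)).re

noncomputable def angle (S : StepData) (δ ε : ℝ) (u : ℕ → ℝ) (x : ℝ) : ℕ → ℝ :=
  orbit (S.angleStep δ ε) u x

/-- The accumulated logarithmic growth. -/
noncomputable def growth (S : StepData) (δ ε : ℝ) (u : ℕ → ℝ) (x : ℝ) : ℕ → ℝ
  | 0 => 0
  | n + 1 => growth S δ ε u x n + S.gainStep δ ε (n + 1) (u (n + 1)) (S.angle δ ε u x n)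

/-- Uniform bounds on the coefficients. -/
structure IsBounded (S : StepData) (M : ℝ) : Prop where
  cA : ∀ n, BddLip M (S.cA n)
  sA : ∀ n, BddLip M (S.sA n)
  cB : ∀ n, BddLip M (S.cB n)
  sB : ∀ n, BddLip M (S.sB n)
  cR : ∀ n, BddLip M (S.cR n)
  sR : ∀ n, BddLip M (S.sR n)

end StepData

lemma norm_mk_le (a b : ℝ) : ‖(⟨a, b⟩ : ℂ)‖ ≤ |a| + |b| := Complex.norm_le_abs_re_add_abs_im _

lemma norm_mk_le_of_bddLip {M : ℝ} {f g : ℝ → ℝ} (hf : BddLip M f) (hg : BddLip M g) (θ : ℝ) :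
    ‖(⟨f θ, g θ⟩ : ℂ)‖ ≤ 2 * M := by
  have := norm_mk_le (f θ) (g θ)
  have := hf.bound θ
  have := hg.bound θ
  linarith

lemma norm_mk_sub_le_of_bddLip {M : ℝ} {f g : ℝ → ℝ} (hf : BddLip M f) (hg : BddLip M g)
    (θ θ' : ℝ) : ‖(⟨f θ, g θ⟩ : ℂ) - ⟨f θ', g θ'⟩‖ ≤ 2 * M * |θ - θ'| := by
  have h := Complex.norm_le_abs_re_add_abs_im ((⟨f θ, g θ⟩ : ℂ) - ⟨f θ', g θ'⟩)
  simp only [Complex.sub_re, Complex.sub_im] at h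
  have := hf.lip θ θ'
  have := hg.lip θ θ'
  linarith

lemma measurable_mk {X : Type*} [MeasurableSpace X] {f g : X → ℝ} (hf : Measurable f)
    (hg : Measurable g) : Measurable fun x => (⟨f x, g x⟩ : ℂ) := by
  have : (fun x => (⟨f x, g x⟩ : ℂ)) = fun x => (f x : ℂ) + (g x : ℂ) * Complex.I := by
    funext x
    exact Complex.mk_eq_add_mul_I _ _
  rw [this]
  fun_prop

/-- Expansion of the complex logarithm of one step, for abstract complex coefficients. -/
lemma norm_log_step_le {M δ ε v : ℝ} {zA zB zR : ℂ} (hM : 1 ≤ M) (hA : ‖zA‖ ≤ M) (hB : ‖zB‖ ≤ M)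
    (hR : ‖zR‖ ≤ M) (hv : |v| ≤ M) (hε : |ε| ≤ M) (hδ0 : 0 ≤ δ) (hδ : 8 * M ^ 2 * δ ≤ 1) :
    ‖(δ * v : ℝ) * zA + (δ ^ 2 : ℝ) * zB + (δ ^ 3 * (v + ε * δ) : ℝ) * zR‖ ≤ 1 / 2 ∧
    ‖Complex.log (1 + ((δ * v : ℝ) * zA + (δ ^ 2 : ℝ) * zB + (δ ^ 3 * (v + ε * δ) : ℝ) * zR))
      - ((δ * v : ℝ) * zA + (δ ^ 2 : ℝ) * (zB - (v ^ 2 / 2 : ℝ) * zA ^ 2))‖ ≤ 80 * M ^ 6 * δ ^ 3 := by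
  have hM0 : 0 ≤ M := by linarith
  have hM2 : 1 ≤ M ^ 2 := one_le_pow₀ hM
  have hδ1 : δ ≤ 1 := by nlinarith
  set x : ℂ := (δ * v : ℝ) * zA with hx
  set ρ : ℂ := (δ ^ 3 * (v + ε * δ) : ℝ) * zR with hρ
  set y : ℂ := (δ ^ 2 : ℝ) * zB with hy
  have nx : ‖x‖ ≤ M ^ 2 * δ := by
    rw [hx, norm_mul, Complex.norm_real, Real.norm_eq_abs, abs_mul, abs_of_nonneg hδ0]
    calc δ * |v| * ‖zA‖ ≤ δ * M * M := by gcongr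
      _ = _ := by ring
  have ny : ‖y‖ ≤ M * δ ^ 2 := by
    rw [hy, norm_mul, Complex.norm_real, Real.norm_eq_abs, abs_of_nonneg (by positivity)]
    calc δ ^ 2 * ‖zB‖ ≤ δ ^ 2 * M := by gcongr
      _ = _ := by ring
  have nρ : ‖ρ‖ ≤ 2 * M ^ 2 * δ ^ 3 := by
    rw [hρ, norm_mul, Complex.norm_real, Real.norm_eq_abs, abs_mul,
      abs_of_nonneg (by positivity : 0 ≤ δ ^ 3)]
    have h1 : |v + ε * δ| ≤ M + M * 1 := by
      refine (abs_add_le _ _).trans ?_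
      rw [abs_mul, abs_of_nonneg hδ0]
      gcongr
    calc δ ^ 3 * |v + ε * δ| * ‖zR‖ ≤ δ ^ 3 * (M + M * 1) * M := by gcongr
      _ = _ := by ring
  have d2 : δ ^ 2 ≤ δ := by nlinarith
  have d3 : δ ^ 3 ≤ δ ^ 2 := pow_le_pow_of_le_one hδ0 hδ1 (by norm_num)
  have nyρ : ‖y + ρ‖ ≤ 3 * M ^ 2 * δ ^ 2 := by
    refine (norm_add_le _ _).trans ?_
    have a1 : M * δ ^ 2 ≤ M ^ 2 * δ ^ 2 := by
      gcongr
      nlinarith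
    have a2 : 2 * M ^ 2 * δ ^ 3 ≤ 2 * M ^ 2 * δ ^ 2 := by gcongr
    linarith
  have nz : ‖x + y + ρ‖ ≤ 4 * M ^ 2 * δ := by
    rw [add_assoc]
    refine (norm_add_le _ _).trans ?_
    have : 3 * M ^ 2 * δ ^ 2 ≤ 3 * M ^ 2 * δ := by gcongr
    linarith
  have hhalf : ‖x + y + ρ‖ ≤ 1 / 2 := by linarith
  refine ⟨hhalf, ?_⟩
  have hlog := norm_log_one_add_sub_quadratic_le hhalf
  -- Of the quadratic term only x²/2 is of order δ²; the difference ((x+y+ρ)² - x²)/2 factors as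
  -- (y+ρ)(2x+y+ρ)/2, which is of order δ³.
  have e1 : Complex.log (1 + (x + y + ρ)) - (x + (δ ^ 2 : ℝ) * (zB - (v ^ 2 / 2 : ℝ) * zA ^ 2))
      = (Complex.log (1 + (x + y + ρ)) - (x + y + ρ - (x + y + ρ) ^ 2 / 2))
        + (ρ - (y + ρ) * (x + y + ρ + x) / 2) := by
    rw [hx, hy]
    push_cast
    ring
  rw [e1]
  have t1 : ‖x + y + ρ‖ ^ 3 ≤ (4 * M ^ 2 * δ) ^ 3 := by gcongr
  have t2 : ‖(y + ρ) * (x + y + ρ + x) / 2‖ ≤ (3 * M ^ 2 * δ ^ 2) * (4 * M ^ 2 * δ + M ^ 2 * δ) / 2 := by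
    rw [norm_div, norm_mul, Complex.norm_ofNat]
    gcongr
    exact (norm_add_le _ _).trans (add_le_add nz nx)
  refine (norm_add_le _ _).trans ((add_le_add (hlog.trans t1) ((norm_sub_le _ _).trans
    (add_le_add nρ t2))).trans ?_)
  have b1 : M ^ 2 * δ ^ 3 ≤ M ^ 6 * δ ^ 3 := by
    gcongr
    norm_num
  have b2 : M ^ 4 * δ ^ 3 ≤ M ^ 6 * δ ^ 3 := by
    gcongr
    norm_num
  have b3 : 0 ≤ M ^ 6 * δ ^ 3 := by positivity
  nlinarith

section

variable {S : StepData} {M δ ε : ℝ}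

lemma StepData.measurable_zeta (hS : S.IsBounded M) (n : ℕ) :
    Measurable fun p : ℝ × ℝ => S.zeta δ ε n p.1 p.2 := by
  have m : ∀ f : ℝ → ℝ, BddLip M f → Measurable fun p : ℝ × ℝ => f p.2 := fun f hf =>
    hf.continuous.measurable.comp measurable_snd
  have m1 := measurable_mk (m _ (hS.cA n)) (m _ (hS.sA n))
  have m2 := measurable_mk (m _ (hS.cB n)) (m _ (hS.sB n))
  have m3 := measurable_mk (m _ (hS.cR n)) (m _ (hS.sR n))
  unfold StepData.zeta
  fun_prop

lemma StepData.log_expansion (hS : S.IsBounded M) (hM : 1 ≤ M) (hε : |ε| ≤ M) (hδ0 : 0 ≤ δ)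
    (hδ : 32 * M ^ 2 * δ ≤ 1) (n : ℕ) {v : ℝ} (hv : |v| ≤ M) (θ : ℝ) :
    ‖S.zeta δ ε n v θ‖ ≤ 1 / 2 ∧
    |S.gainStep δ ε n v θ - (δ * v * S.cA n θ
      + δ ^ 2 * (S.cB n θ - v ^ 2 / 2 * (S.cA n θ ^ 2 - S.sA n θ ^ 2)))| ≤ 5120 * M ^ 6 * δ ^ 3 ∧
    |S.angleStep δ ε n v θ - θ - (δ * v * S.sA n θ
      + δ ^ 2 * (S.sB n θ - v ^ 2 * (S.cA n θ * S.sA n θ)))| ≤ 5120 * M ^ 6 * δ ^ 3 := by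
  -- Complex coefficients with real and imaginary parts bounded by M have norm at most 2M; this is
  -- the origin of 32 = 8·2² and 5120 = 80·2⁶.
  have h := norm_log_step_le (M := 2 * M) (δ := δ) (ε := ε) (v := v) (by linarith)
    (norm_mk_le_of_bddLip (hS.cA n) (hS.sA n) θ) (norm_mk_le_of_bddLip (hS.cB n) (hS.sB n) θ)
    (norm_mk_le_of_bddLip (hS.cR n) (hS.sR n) θ) (by linarith) (by linarith) hδ0 (by linarith)
  have e : 80 * (2 * M) ^ 6 * δ ^ 3 = 5120 * M ^ 6 * δ ^ 3 := by ring
  rw [e] at h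
  refine ⟨h.1, ?_, ?_⟩
  · refine le_trans (le_of_eq ?_) ((Complex.abs_re_le_norm _).trans h.2)
    congr 1
    simp only [StepData.gainStep, StepData.zeta, Complex.sub_re, Complex.add_re,
      Complex.mul_re, Complex.mul_im, Complex.ofReal_re, Complex.ofReal_im, pow_two (Complex.mk _ _)]
    ring
  · refine le_trans (le_of_eq ?_) ((Complex.abs_im_le_norm _).trans h.2)
    congr 1
    simp only [StepData.angleStep, StepData.zeta, Complex.sub_im, Complex.add_im,
      Complex.sub_re, Complex.mul_re, Complex.mul_im, Complex.ofReal_re,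
      Complex.ofReal_im, pow_two (Complex.mk _ _)]
    ring

lemma StepData.norm_zeta_sub_le (hS : S.IsBounded M) (hM : 1 ≤ M) (hε : |ε| ≤ M) (hδ0 : 0 ≤ δ)
    (hδ1 : δ ≤ 1) (n : ℕ) {v v' : ℝ} (hv' : |v'| ≤ M) (θ θ' : ℝ) :
    ‖S.zeta δ ε n v θ - S.zeta δ ε n v' θ'‖ ≤ δ * (8 * M ^ 2 * |θ - θ'| + 4 * M * |v - v'|) := by
  have hM0 : 0 ≤ M := by linarith
  have e : S.zeta δ ε n v θ - S.zeta δ ε n v' θ' =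
      (δ * (v - v') : ℝ) * ⟨S.cA n θ, S.sA n θ⟩
        + (δ ^ 3 * (v - v') : ℝ) * ⟨S.cR n θ, S.sR n θ⟩
        + (δ * v' : ℝ) * (⟨S.cA n θ, S.sA n θ⟩ - ⟨S.cA n θ', S.sA n θ'⟩)
        + (δ ^ 2 : ℝ) * (⟨S.cB n θ, S.sB n θ⟩ - ⟨S.cB n θ', S.sB n θ'⟩)
        + (δ ^ 3 * (v' + ε * δ) : ℝ) * (⟨S.cR n θ, S.sR n θ⟩ - ⟨S.cR n θ', S.sR n θ'⟩) := by
    simp only [StepData.zeta]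
    push_cast
    ring
  have d2 : δ ^ 2 ≤ δ := by nlinarith
  have d3 : δ ^ 3 ≤ δ := by nlinarith [mul_nonneg hδ0 hδ0]
  have nr : ∀ (x : ℝ) (z : ℂ), ‖(x : ℂ) * z‖ = |x| * ‖z‖ := fun x z => by
    rw [norm_mul, Complex.norm_real, Real.norm_eq_abs]
  have h1 : ‖((δ * (v - v') : ℝ) : ℂ) * ⟨S.cA n θ, S.sA n θ⟩‖ ≤ δ * |v - v'| * (2 * M) := by
    rw [nr, abs_mul, abs_of_nonneg hδ0]
    have := norm_mk_le_of_bddLip (hS.cA n) (hS.sA n) θ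
    gcongr
  have h2 : ‖((δ ^ 3 * (v - v') : ℝ) : ℂ) * ⟨S.cR n θ, S.sR n θ⟩‖ ≤ δ * |v - v'| * (2 * M) := by
    rw [nr, abs_mul, abs_of_nonneg (by positivity : 0 ≤ δ ^ 3)]
    have := norm_mk_le_of_bddLip (hS.cR n) (hS.sR n) θ
    gcongr
  have h3 : ‖((δ * v' : ℝ) : ℂ) * (⟨S.cA n θ, S.sA n θ⟩ - ⟨S.cA n θ', S.sA n θ'⟩)‖
      ≤ δ * M * (2 * M * |θ - θ'|) := by
    rw [nr, abs_mul, abs_of_nonneg hδ0]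
    have := norm_mk_sub_le_of_bddLip (hS.cA n) (hS.sA n) θ θ'
    gcongr
  have h4 : ‖((δ ^ 2 : ℝ) : ℂ) * (⟨S.cB n θ, S.sB n θ⟩ - ⟨S.cB n θ', S.sB n θ'⟩)‖
      ≤ δ * (2 * M * |θ - θ'|) := by
    rw [nr, abs_of_nonneg (by positivity : 0 ≤ δ ^ 2)]
    have := norm_mk_sub_le_of_bddLip (hS.cB n) (hS.sB n) θ θ'
    gcongr
  have h5 : ‖((δ ^ 3 * (v' + ε * δ) : ℝ) : ℂ) * (⟨S.cR n θ, S.sR n θ⟩ - ⟨S.cR n θ', S.sR n θ'⟩)‖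
      ≤ δ * (M + M * 1) * (2 * M * |θ - θ'|) := by
    rw [nr, abs_mul, abs_of_nonneg (by positivity : 0 ≤ δ ^ 3)]
    have := norm_mk_sub_le_of_bddLip (hS.cR n) (hS.sR n) θ θ'
    have h1 : |v' + ε * δ| ≤ M + M * 1 := by
      refine (abs_add_le _ _).trans ?_
      rw [abs_mul, abs_of_nonneg hδ0]
      gcongr
    gcongr
  rw [e]
  refine (norm_add_le_of_le (norm_add_le_of_le (norm_add_le_of_le (norm_add_le_of_le h1 h2) h3) h4)
    h5).trans ?_
  have a1 : δ * M * |θ - θ'| ≤ δ * M ^ 2 * |θ - θ'| := by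
    gcongr
    nlinarith
  nlinarith

lemma StepData.slowDynamics (hS : S.IsBounded M) (hM : 1 ≤ M) (hε : |ε| ≤ M) (hδ0 : 0 ≤ δ)
    (hδ : 32 * M ^ 2 * δ ≤ 1) :
    SlowDynamics (S.angleStep δ ε) S.sA M (200 * M ^ 4) δ := by
  have hM0 : 0 ≤ M := by linarith
  have hM2 : 1 ≤ M ^ 2 := one_le_pow₀ hM
  have hδ1 : δ ≤ 1 := by nlinarith
  refine ⟨fun n => ?_, fun n v θ hv => ?_, fun n v v' θ θ' hv hv' => ?_⟩
  · have := S.measurable_zeta (δ := δ) (ε := ε) hS n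
    have h : Measurable fun p : ℝ × ℝ => p.2 + (Complex.log (1 + S.zeta δ ε n p.1 p.2)).im :=
      measurable_snd.add (Complex.measurable_im.comp
        (Complex.measurable_log.comp (measurable_const.add this)))
    exact h
  · have h := (S.log_expansion hS hM hε hδ0 hδ n hv θ).2.2
    have e1 : |δ ^ 2 * (S.sB n θ - v ^ 2 * (S.cA n θ * S.sA n θ))| ≤ δ ^ 2 * (M + M ^ 2 * (M * M)) := by
      rw [abs_mul, abs_of_nonneg (by positivity : 0 ≤ δ ^ 2)]
      refine mul_le_mul_of_nonneg_left ?_ (by positivity)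
      refine (abs_sub _ _).trans (add_le_add ((hS.sB n).bound θ) ?_)
      rw [abs_mul, abs_mul, abs_pow]
      have := (hS.cA n).bound θ
      have := (hS.sA n).bound θ
      gcongr
    have e2 : S.angleStep δ ε n v θ - θ - δ * v * S.sA n θ =
      (S.angleStep δ ε n v θ - θ - (δ * v * S.sA n θ
        + δ ^ 2 * (S.sB n θ - v ^ 2 * (S.cA n θ * S.sA n θ))))
        + δ ^ 2 * (S.sB n θ - v ^ 2 * (S.cA n θ * S.sA n θ)) := by ring
    rw [e2]
    refine (abs_add_le _ _).trans ((add_le_add h e1).trans ?_)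
    have a1 : M ≤ M ^ 4 := le_self_pow₀ hM (by norm_num)
    have a2 : 5120 * M ^ 6 * δ ^ 3 ≤ 160 * M ^ 4 * δ ^ 2 := by
      calc 5120 * M ^ 6 * δ ^ 3 = 160 * M ^ 4 * δ ^ 2 * (32 * M ^ 2 * δ) := by ring
        _ ≤ 160 * M ^ 4 * δ ^ 2 * 1 := by gcongr
        _ = _ := by ring
    nlinarith [sq_nonneg δ, mul_le_mul_of_nonneg_left a1 (sq_nonneg δ)]
  · have h1 := (S.log_expansion hS hM hε hδ0 hδ n hv θ).1
    have h2 := (S.log_expansion hS hM hε hδ0 hδ n hv' θ').1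
    have h3 := (Complex.abs_im_le_norm _).trans ((norm_log_one_add_sub_le h1 h2).trans
      (mul_le_mul_of_nonneg_left (S.norm_zeta_sub_le hS hM hε hδ0 hδ1 n (v := v) hv' θ θ') zero_le_two))
    rw [Complex.sub_im] at h3
    have e : S.angleStep δ ε n v θ - S.angleStep δ ε n v' θ' = (θ - θ')
        + ((Complex.log (1 + S.zeta δ ε n v θ)).im - (Complex.log (1 + S.zeta δ ε n v' θ')).im) := by
      simp only [StepData.angleStep]
      ring
    rw [e]
    refine (abs_add_le _ _).trans ((add_le_add_right h3 _).trans ?_)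
    have a1 : M ≤ M ^ 4 := le_self_pow₀ hM (by norm_num)
    have a2 : M ^ 2 ≤ M ^ 4 := pow_le_pow_right₀ hM (by norm_num)
    have b1 : M ^ 2 * (δ * |θ - θ'|) ≤ M ^ 4 * (δ * |θ - θ'|) := by gcongr
    have b2 : M * (δ * |v - v'|) ≤ M ^ 4 * (δ * |v - v'|) := by gcongr
    have b3 : 0 ≤ M ^ 4 * (δ * |θ - θ'|) := by positivity
    have b4 : 0 ≤ M ^ 4 * (δ * |v - v'|) := by positivity
    nlinarith

end

end WeakDisorder

namespace WeakDisorder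

/-! ### Growth of the corrected logarithm -/

lemma BddLip.mono {b c : ℝ} {H : ℝ → ℝ} (h : BddLip b H) (hbc : b ≤ c) : BddLip c H :=
  ⟨fun x => (h.bound x).trans hbc, fun x y => (h.lip x y).trans (by gcongr)⟩

lemma BddLip.add {b c : ℝ} {H G : ℝ → ℝ} (h : BddLip b H) (g : BddLip c G) :
    BddLip (b + c) fun x => H x + G x := by
  refine ⟨fun x => (abs_add_le _ _).trans (add_le_add (h.bound x) (g.bound x)), fun x y => ?_⟩
  have e : H x + G x - (H y + G y) = (H x - H y) + (G x - G y) := by ring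
  rw [e]
  refine (abs_add_le _ _).trans ((add_le_add (h.lip x y) (g.lip x y)).trans (le_of_eq ?_))
  ring

/-- A corrector `g` (with derivatives `g1`, `g2`) for nilpotent step data, for which the averaged
second order gain is the constant `κ`. -/
structure StepData.IsCorrected (S : StepData) (M : ℝ) (g g1 g2 : ℝ → ℝ) (cA1 sA1 Q : ℕ → ℝ → ℝ)
    (D0 Dpi κ : ℝ) : Prop extends S.IsBounded M where
  g_bl : BddLip M g
  g1_bl : BddLip M g1
  g2_bl : BddLip M g2
  cA1_bl : ∀ n, BddLip M (cA1 n)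
  sA1_bl : ∀ n, BddLip M (sA1 n)
  Q_bl : ∀ n, BddLip M (Q n)
  g_deriv : ∀ θ, HasDerivAt g (g1 θ) θ
  g1_deriv : ∀ θ, HasDerivAt g1 (g2 θ) θ
  cA_deriv : ∀ n θ, HasDerivAt (S.cA n) (cA1 n θ) θ
  sA_deriv : ∀ n θ, HasDerivAt (S.sA n) (sA1 n θ) θ
  cA1_mul : ∀ n θ, cA1 n θ * S.sA n θ = S.sA n θ ^ 2 - S.cA n θ ^ 2
  sA1_mul : ∀ n θ, sA1 n θ * S.sA n θ = -(2 * S.cA n θ * S.sA n θ)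
  period : ∀ n, S.sA (n + 2) = S.sA n
  Q_eq : ∀ n θ, Q n θ = S.cB n θ + g1 θ * S.sB n θ
    + (cA1 n θ + (g2 θ * S.sA n θ + g1 θ * sA1 n θ)) *
    ((S.sA n θ + S.sA (n + 1) θ) / 2 * (D0 / 2) + (S.sA n θ - S.sA (n + 1) θ) / 2 * (Dpi / 2))
  Q_sum : ∀ n θ, Q n θ + Q (n + 1) θ = 2 * κ

section

variable {S : StepData} {M δ ε D0 Dpi κ : ℝ} {g g1 g2 : ℝ → ℝ} {cA1 sA1 Q : ℕ → ℝ → ℝ}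

lemma StepData.IsCorrected.mono {M' : ℝ} (h : S.IsCorrected M g g1 g2 cA1 sA1 Q D0 Dpi κ)
    (hM : M ≤ M') : S.IsCorrected M' g g1 g2 cA1 sA1 Q D0 Dpi κ :=
  { h with
    cA := fun n => (h.cA n).mono hM
    sA := fun n => (h.sA n).mono hM
    cB := fun n => (h.cB n).mono hM
    sB := fun n => (h.sB n).mono hM
    cR := fun n => (h.cR n).mono hM
    sR := fun n => (h.sR n).mono hM
    g_bl := h.g_bl.mono hM
    g1_bl := h.g1_bl.mono hM
    g2_bl := h.g2_bl.mono hM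
    cA1_bl := fun n => (h.cA1_bl n).mono hM
    sA1_bl := fun n => (h.sA1_bl n).mono hM
    Q_bl := fun n => (h.Q_bl n).mono hM }

lemma StepData.IsCorrected.stepCoefficients (h : S.IsCorrected M g g1 g2 cA1 sA1 Q D0 Dpi κ)
    (hM : 1 ≤ M) : StepCoefficients (5 * M ^ 2) S.sA (fun n θ => S.cA n θ + g1 θ * S.sA n θ)
      (fun n θ => cA1 n θ + (g2 θ * S.sA n θ + g1 θ * sA1 n θ))
      (fun n θ => S.cB n θ + g1 θ * S.sB n θ) Q D0 Dpi κ := by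
  have hMM : M ≤ M ^ 2 := le_self_pow₀ hM (by norm_num)
  refine ⟨fun n => (h.sA n).mono (by linarith), fun n => ?_, fun n => ?_, fun n => ?_,
    fun n => (h.Q_bl n).mono (by linarith), fun n θ => ?_, h.period, h.Q_eq, h.Q_sum⟩
  · exact ((h.cA n).add (h.g1_bl.mul (h.sA n))).mono (by nlinarith)
  · exact ((h.cA1_bl n).add ((h.g2_bl.mul (h.sA n)).add (h.g1_bl.mul (h.sA1_bl n)))).mono
      (by nlinarith)
  · exact ((h.cB n).add (h.g1_bl.mul (h.sB n))).mono (by nlinarith)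
  · exact (h.cA_deriv n θ).add ((h.g1_deriv θ).mul (h.sA_deriv n θ))

/-- Second order expansion of the corrected gain of one step. -/
lemma StepData.IsCorrected.abs_gain_sub_le (h : S.IsCorrected M g g1 g2 cA1 sA1 Q D0 Dpi κ)
    (hM : 1 ≤ M) (hε : |ε| ≤ M) (hδ0 : 0 ≤ δ) (hδ : 32 * M ^ 2 * δ ≤ 1) (n : ℕ) {v : ℝ}
    (hv : |v| ≤ M) (θ : ℝ) :
    |S.gainStep δ ε n v θ + (g (S.angleStep δ ε n v θ) - g θ) -
      (δ * v * (S.cA n θ + g1 θ * S.sA n θ) + δ ^ 2 * (v ^ 2 *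
        ((cA1 n θ + (g2 θ * S.sA n θ + g1 θ * sA1 n θ)) * S.sA n θ / 2)
        + (S.cB n θ + g1 θ * S.sB n θ)))| ≤ 12000 * M ^ 7 * δ ^ 3 := by
  have hM0 : 0 ≤ M := by linarith
  obtain ⟨-, hg, ha⟩ := S.log_expansion h.toIsBounded hM hε hδ0 hδ n hv θ
  have hst := (S.slowDynamics h.toIsBounded hM hε hδ0 hδ).step n v θ hv
  have hT := taylor_second h.g_deriv h.g1_deriv h.g2_bl.lip θ (S.angleStep δ ε n v θ)
  -- The perturbation is nilpotent: the second order terms -(cA² - sA²)/2 and -cA sA of the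
  -- logarithm equal cA' sA/2 and sA' sA/2. So the v² term of the corrected gain is half of a' s,
  -- with a the coefficient of its linear term, which is the form needed to complete the correlation
  -- sums.
  have e1 := h.cA1_mul n θ
  have e2 := h.sA1_mul n θ
  have b1 := h.g1_bl.bound θ
  have b2 := h.g2_bl.bound θ
  have bs := (h.sA n).bound θ
  set w := S.angleStep δ ε n v θ with hw
  set G := S.gainStep δ ε n v θ
  set c := S.cA n θ
  set s := S.sA n θ
  set y := w - θ with hy
  set x := δ * v * s with hx
  set X := S.sB n θ - v ^ 2 * (c * s) with hX
  have nx : |x| ≤ M ^ 2 * δ := by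
    rw [hx, abs_mul, abs_mul, abs_of_nonneg hδ0]
    calc δ * |v| * |s| ≤ δ * M * M := by gcongr
      _ = _ := by ring
  have p1 : M ^ 4 * δ ^ 2 ≤ M ^ 2 * δ / 32 := by
    have : M ^ 4 * δ ^ 2 = M ^ 2 * δ * (32 * M ^ 2 * δ) / 32 := by ring
    rw [this]
    have : M ^ 2 * δ * (32 * M ^ 2 * δ) ≤ M ^ 2 * δ * 1 := by gcongr
    linarith
  have ny : |y| ≤ 8 * M ^ 2 * δ := by
    have := abs_add_le (y - x) x
    rw [sub_add_cancel] at this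
    have : 0 ≤ M ^ 2 * δ := by positivity
    linarith
  have ey : |y ^ 2 - x ^ 2| ≤ 1800 * M ^ 6 * δ ^ 3 := by
    have : y ^ 2 - x ^ 2 = (y - x) * (y + x) := by ring
    rw [this, abs_mul]
    have : |y + x| ≤ 9 * M ^ 2 * δ := (abs_add_le _ _).trans (by linarith)
    calc |y - x| * |y + x| ≤ 200 * M ^ 4 * δ ^ 2 * (9 * M ^ 2 * δ) := by gcongr
      _ = _ := by ring
  have n3 : |y| ^ 3 ≤ 512 * M ^ 6 * δ ^ 3 := by
    calc |y| ^ 3 ≤ (8 * M ^ 2 * δ) ^ 3 := by gcongr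
      _ = _ := by ring
  have e : G + (g w - g θ) - (δ * v * (c + g1 θ * s) + δ ^ 2 * (v ^ 2 *
        ((cA1 n θ + (g2 θ * s + g1 θ * sA1 n θ)) * s / 2) + (S.cB n θ + g1 θ * S.sB n θ)))
      = (G - (δ * v * c + δ ^ 2 * (S.cB n θ - v ^ 2 / 2 * (c ^ 2 - s ^ 2))))
        + (g w - g θ - g1 θ * y - g2 θ * y ^ 2 / 2)
        + g1 θ * (y - (δ * v * s + δ ^ 2 * X))
        + g2 θ * (y ^ 2 - x ^ 2) / 2 := by
    rw [hX, hx]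
    linear_combination (-(δ ^ 2 * v ^ 2 / 2)) * e1 - (δ ^ 2 * v ^ 2 / 2) * g1 θ * e2
  rw [e]
  have t3 : |g1 θ * (y - (δ * v * s + δ ^ 2 * X))| ≤ M * (5120 * M ^ 6 * δ ^ 3) := by
    rw [abs_mul]
    gcongr
  have t4 : |g2 θ * (y ^ 2 - x ^ 2) / 2| ≤ M * (1800 * M ^ 6 * δ ^ 3) / 2 := by
    rw [abs_div, abs_mul, abs_two]
    gcongr
  have t2 : M * |y| ^ 3 ≤ M * (512 * M ^ 6 * δ ^ 3) := by gcongr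
  refine (abs_add_le _ _).trans ((add_le_add ((abs_add_le _ _).trans (add_le_add
    ((abs_add_le _ _).trans (add_le_add hg (hT.trans t2))) t3)) t4).trans ?_)
  have : M ^ 6 * δ ^ 3 ≤ M ^ 7 * δ ^ 3 := by
    gcongr
    norm_num
  have : 0 ≤ M ^ 7 * δ ^ 3 := by positivity
  nlinarith

end

/-! ### The choice of the block length -/

/-- With m of order δ^{-2/(α+2)} all three errors have the exponent 1 + 2α/(α+2) = 3 - 4/(α+2) = 2 +
(α-2)/(α+2) = (3α+2)/(α+2). Rounding m up costs constants only. -/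
lemma exists_block_length {α : ℝ} (hα : 2 < α) {δ : ℝ} (hδ0 : 0 < δ) (hδ1 : δ ≤ 1) {K T : ℝ}
    (hT : 0 ≤ T) (hK : 0 ≤ K) :
    ∃ m : ℕ, 1 ≤ m ∧ m * δ ≤ 2 ∧
      K * (δ * (m : ℝ) ^ (-α) + m ^ 2 * δ ^ 3 + δ ^ 2 * (T * ((3 * m : ℕ) : ℝ) ^ (-(α / 2 - 1))))
        ≤ K * (5 + T) * δ ^ ((3 * α + 2) / (α + 2)) := by
  set x : ℝ := δ ^ (-(2 / (α + 2))) with hx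
  have hα2 : 0 < α + 2 := by linarith
  have hx1 : 1 ≤ x := Real.one_le_rpow_of_pos_of_le_one_of_nonpos hδ0 hδ1
    (by rw [neg_nonpos]; positivity)
  have hx0 : 0 < x := by linarith
  have hxm : x ≤ ⌈x⌉₊ := Nat.le_ceil x
  have hmx : (⌈x⌉₊ : ℝ) ≤ 2 * x := by
    have := Nat.ceil_lt_add_one hx0.le
    linarith
  have hm1 : 1 ≤ ⌈x⌉₊ := by
    exact_mod_cast hx1.trans hxm
  have pw : ∀ (a b : ℝ), δ ^ a * x ^ b = δ ^ (a + -(2 / (α + 2)) * b) := fun a b => by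
    rw [hx, ← Real.rpow_mul hδ0.le, ← Real.rpow_add hδ0]
  refine ⟨⌈x⌉₊, hm1, ?_, ?_⟩
  · have h1 : x * δ ≤ 1 := by
      have := pw 1 1
      rw [Real.rpow_one, Real.rpow_one] at this
      rw [mul_comm, this]
      refine Real.rpow_le_one hδ0.le hδ1 ?_
      have : 2 / (α + 2) ≤ 1 := by rw [div_le_one hα2]; linarith
      linarith
    calc (⌈x⌉₊ : ℝ) * δ ≤ 2 * x * δ := by gcongr
      _ ≤ 2 := by linarith
  · have hm0 : (0 : ℝ) < ⌈x⌉₊ := by linarith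
    set E := δ ^ ((3 * α + 2) / (α + 2)) with hE
    have t1 : δ * (⌈x⌉₊ : ℝ) ^ (-α) ≤ E := by
      have : (⌈x⌉₊ : ℝ) ^ (-α) ≤ x ^ (-α) :=
        Real.rpow_le_rpow_of_nonpos hx0 hxm (by linarith)
      calc δ * (⌈x⌉₊ : ℝ) ^ (-α) ≤ δ ^ (1 : ℝ) * x ^ (-α) := by
            rw [Real.rpow_one]
            gcongr
        _ = E := by
            rw [pw, hE]
            congr 1
            field_simp
            ring
    have t2 : (⌈x⌉₊ : ℝ) ^ 2 * δ ^ 3 ≤ 4 * E := by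
      calc (⌈x⌉₊ : ℝ) ^ 2 * δ ^ 3 ≤ (2 * x) ^ 2 * δ ^ 3 := by gcongr
        _ = 4 * (δ ^ (3 : ℝ) * x ^ (2 : ℝ)) := by norm_cast; ring
        _ = 4 * E := by
            rw [pw, hE]
            congr 2
            field_simp
            ring
    have t3 : δ ^ 2 * (T * ((3 * ⌈x⌉₊ : ℕ) : ℝ) ^ (-(α / 2 - 1))) ≤ T * E := by
      have : ((3 * ⌈x⌉₊ : ℕ) : ℝ) ^ (-(α / 2 - 1)) ≤ x ^ (-(α / 2 - 1)) :=
        Real.rpow_le_rpow_of_nonpos hx0 (by push_cast; linarith) (by linarith)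
      calc _ ≤ δ ^ 2 * (T * x ^ (-(α / 2 - 1))) := by gcongr
        _ = T * (δ ^ (2 : ℝ) * x ^ (-(α / 2 - 1))) := by norm_cast; ring
        _ = T * E := by
            rw [pw, hE]
            congr 2
            field_simp
            ring
    calc _ ≤ K * (E + 4 * E + T * E) := by gcongr
      _ = _ := by ring

end WeakDisorder

namespace WeakDisorder

/-! ### Averaged growth -/

section

variable {A : Type*} [MeasurableSpace A] {V : (ℤ → A) → ℝ} {S : StepData}
  {M δ ε r K₀ : ℝ}

lemma StepData.abs_gainStep_le (hS : S.IsBounded M) (hM : 1 ≤ M) (hε : |ε| ≤ M) (hδ0 : 0 ≤ δ)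
    (hδ : 32 * M ^ 2 * δ ≤ 1) (n : ℕ) {v : ℝ} (hv : |v| ≤ M) (θ : ℝ) :
    |S.gainStep δ ε n v θ| ≤ 1 := by
  have h := (S.log_expansion hS hM hε hδ0 hδ n hv θ).1
  have h2 := (Complex.abs_re_le_norm _).trans
    (norm_log_one_add_sub_le h (w := 0) (by rw [norm_zero]; norm_num))
  simp only [add_zero, Complex.log_one, sub_zero] at h2
  simp only [StepData.gainStep]
  linarith

lemma StepData.measurable_growth (hS : S.IsBounded M) (hM : 1 ≤ M) (hε : |ε| ≤ M) (hδ0 : 0 ≤ δ)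
    (hδ : 32 * M ^ 2 * δ ≤ 1) (hV : PotentialBound r K₀ V) (n : ℕ) :
    Measurable fun p : ℝ × (ℤ → A) => S.growth δ ε (potential V p.2) p.1 n := by
  induction n with
  | zero => exact measurable_const
  | succ n ih =>
    have h1 : Measurable fun p : ℝ × ℝ => (Complex.log (1 + S.zeta δ ε (n + 1) p.1 p.2)).re :=
      Complex.measurable_re.comp (Complex.measurable_log.comp
        (measurable_const.add (S.measurable_zeta (δ := δ) (ε := ε) hS (n + 1))))
    have h2 : Measurable fun p : ℝ × (ℤ → A) =>
        (potential V p.2 (n + 1), orbit (S.angleStep δ ε) (potential V p.2) p.1 n) :=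
      ((hV.measurable_potential (n + 1)).comp measurable_snd).prodMk
        ((S.slowDynamics hS hM hε hδ0 hδ).measurable_orbit hV n)
    have h3 := h1.comp h2
    exact ih.add h3

lemma StepData.abs_growth_le (hS : S.IsBounded M) (hM : 1 ≤ M) (hε : |ε| ≤ M) (hδ0 : 0 ≤ δ)
    (hδ : 32 * M ^ 2 * δ ≤ 1) {u : ℕ → ℝ} (hu : ∀ n, |u n| ≤ M) (x : ℝ) (n : ℕ) :
    |S.growth δ ε u x n| ≤ n := by
  induction n with
  | zero => simp [StepData.growth]
  | succ n ih =>
    simp only [StepData.growth]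
    refine (abs_add_le _ _).trans ?_
    have := S.abs_gainStep_le hS hM hε hδ0 hδ (n + 1) (hu (n + 1)) (S.angle δ ε u x n)
    push_cast
    linarith

end

/-- Up to errors of order `δ^((3α+2)/(α+2))` per step, the logarithmic growth is `δ² κ` per step. -/
theorem StepData.IsCorrected.exists_growth_bound {A : Type*} [Countable A] [MeasurableSpace A]
    [MeasurableSingletonClass A] {P : Measure (ℤ → A)} [IsProbabilityMeasure P]
    (hS : MeasurePreserving (shift (1 : ℤ)) P P) {α : ℝ} (hα : 2 < α) (hmix : IsPsiMixing P α)
    {V : (ℤ → A) → ℝ} {r : ℝ} (hr0 : 0 < r) (hr1 : r < 1) (hV : IsQuasiLocal r V)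
    (hV0 : ∫ ω, V ω ∂P = 0) {S : StepData} {M₀ κ : ℝ} {g g1 g2 : ℝ → ℝ} {cA1 sA1 Q : ℕ → ℝ → ℝ}
    (h : S.IsCorrected M₀ g g1 g2 cA1 sA1 Q (spectralDensity P V 0) (spectralDensity P V Real.pi) κ)
    (ε : ℝ) :
    ∃ C M : ℝ, 1 ≤ M ∧ S.IsBounded M ∧ |ε| ≤ M ∧ PotentialBound r M V ∧ ∃ δ₀ : ℝ, 0 < δ₀ ∧
      ∀ δ : ℝ, 0 < δ → δ < δ₀ → 32 * M ^ 2 * δ ≤ 1 ∧ ∃ n₀ : ℕ, ∀ (k : ℕ) (x : ℝ),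
        |∫ ω, S.growth δ ε (potential V ω) x (n₀ + 2 * k) ∂P
          - ∫ ω, S.growth δ ε (potential V ω) x n₀ ∂P - 2 * k * (δ ^ 2 * κ)|
          ≤ k * (C * δ ^ ((3 * α + 2) / (α + 2))) + 2 * M := by
  obtain ⟨K₀, hK₀1, hV₀, hdec⟩ := exists_decorrelation hS (by linarith) hmix hr0 hr1 hV hV0
  obtain ⟨K₁, hK₁0, hcorr⟩ := exists_correlation_le hS (by linarith) hmix hr0 hr1 hV hV0
  obtain ⟨T, hT0, hT⟩ := exists_spectralDensity_approx hS hα hmix hr0 hr1 hV hV0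
  have hK₀0 : 0 ≤ K₀ := by linarith
  obtain ⟨M, hM1, hMM₀, hMK, hMε⟩ : ∃ M : ℝ, 1 ≤ M ∧ M₀ ≤ M ∧ K₀ ≤ M ∧ |ε| ≤ M :=
    ⟨1 + |M₀| + K₀ + |ε|, by linarith [abs_nonneg M₀, abs_nonneg ε],
      by linarith [abs_nonneg ε, le_abs_self M₀], by linarith [abs_nonneg ε, abs_nonneg M₀],
      by linarith [abs_nonneg M₀]⟩
  have hM0 : 0 ≤ M := by linarith
  have hc := h.mono hMM₀
  have h1r : 0 < 1 - r := by linarith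
  set D := K₀ * (1 + 2 * (200 * M ^ 4) * K₀ / (1 - r)) with hD
  have hD0 : 0 ≤ D := by positivity
  set K := 12000 * M ^ 7 + K₁ + D with hK
  have q0 : 1 ≤ M ^ 7 := one_le_pow₀ hM1
  have q1 : M ^ 4 ≤ M ^ 7 := pow_le_pow_right₀ hM1 (by norm_num)
  have q2 : M ^ 2 ≤ M ^ 7 := pow_le_pow_right₀ hM1 (by norm_num)
  have q4 : 1 ≤ M ^ 4 := one_le_pow₀ hM1
  have hK1 : 1 ≤ K := by linarith
  have hK0 : 0 ≤ K := by linarith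
  have hsc : StepCoefficients K S.sA (fun n θ => S.cA n θ + g1 θ * S.sA n θ)
      (fun n θ => cA1 n θ + (g2 θ * S.sA n θ + g1 θ * sA1 n θ))
      (fun n θ => S.cB n θ + g1 θ * S.sB n θ) Q (spectralDensity P V 0)
      (spectralDensity P V Real.pi) κ := by
    have h0 := hc.stepCoefficients hM1
    have hle : 5 * M ^ 2 ≤ K := by linarith
    exact { h0 with
      s_bl := fun n => (h0.s_bl n).mono hle
      a_bl := fun n => (h0.a_bl n).mono hle
      a1_bl := fun n => (h0.a1_bl n).mono hle
      c_bl := fun n => (h0.c_bl n).mono hle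
      Q_bl := fun n => (h0.Q_bl n).mono hle }
  have hVM : PotentialBound r M V := ⟨hV₀.measurable, fun ω => (hV₀.bound ω).trans hMK,
    fun m hm ω ω' hω => (hV₀.variation m hm ω ω' hω).trans (by gcongr)⟩
  -- The first bound on δ makes the expansion of the logarithm valid; the second lets the ratio r
  -- absorb the amplification of errors along the orbit.
  refine ⟨602 * K ^ 6 * (5 + T), M, hM1, hc.toIsBounded, hMε, hVM,
    min (1 / (32 * M ^ 2)) ((1 - r) / (2 * r * (200 * M ^ 4))), by positivity, ?_⟩
  intro δ hδ0 hδ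
  have hδM : 32 * M ^ 2 * δ ≤ 1 := by
    have := (hδ.trans_le (min_le_left _ _)).le
    rw [le_div_iff₀ (by positivity)] at this
    linarith
  have hδr : (1 + 200 * M ^ 4 * δ) * r ≤ (1 + r) / 2 := by
    have := (hδ.trans_le (min_le_right _ _)).le
    rw [le_div_iff₀ (by positivity)] at this
    linarith
  have hδ1 : δ ≤ 1 := by nlinarith [one_le_pow₀ hM1 (n := 2)]
  refine ⟨hδM, ?_⟩
  obtain ⟨m, hm1, hmδ, hm⟩ := exists_block_length hα hδ0 hδ1 (K := 602 * K ^ 6) hT0 (by positivity)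
  -- The averaging argument needs 6m earlier steps, so these are left out at the start.
  refine ⟨6 * m, fun k x => ?_⟩
  have hF := S.slowDynamics hc.toIsBounded hM1 hMε hδ0.le hδM
  have hw := decorrelatedWalk_orbit hF hV₀ hdec (K' := K)
    (fun n => (hcorr n).1.trans (by linarith)) hMK (by linarith)
    hK₀0 hr0 hr1 hδ0.le hδ1 hδr (by linarith) (by rw [← hD]; linarith) x hm1
  have hbv : ∀ (ω : ℤ → A) (n : ℕ), |potential V ω n| ≤ M := fun ω n => hVM.abs_potential_le n ω
  set θ : ℕ → (ℤ → A) → ℝ := fun n ω => orbit (S.angleStep δ ε) (potential V ω) x n with hθ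
  set L : ℕ → (ℤ → A) → ℝ := fun n ω => S.growth δ ε (potential V ω) x n with hL
  have mθ : ∀ n, Measurable (θ n) := hw.measurable_θ
  have mL : ∀ n, Measurable (L n) := fun n =>
    (S.measurable_growth hc.toIsBounded hM1 hMε hδ0.le hδM hVM n).comp measurable_prodMk_left
  have iL : ∀ n, Integrable (L n) P := fun n => integrable_of_abs_le (mL n) fun ω =>
    S.abs_growth_le hc.toIsBounded hM1 hMε hδ0.le hδM (hbv ω) x n
  have mg : ∀ n, Measurable fun ω => g (θ n ω) := fun n =>
    hc.g_bl.continuous.measurable.comp (mθ n)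
  have ig : ∀ n, Integrable (fun ω => g (θ n ω)) P := fun n =>
    integrable_of_abs_le (mg n) fun ω => hc.g_bl.bound _
  -- Increments of the growth corrected by g. Their means telescope, and removing g at the two ends
  -- costs at most 2M.
  set Y : ℕ → (ℤ → A) → ℝ := fun n ω => L n ω + g (θ n ω) - (L (n - 1) ω + g (θ (n - 1) ω)) with hY
  have hpair := fun t (ht : 6 * m ≤ t) => hw.abs_integral_two_gains_sub_le hsc hK1 hδ0.le hδ1
    (by positivity) hm1 hmδ (hT (3 * m) (by omega)).1 (hT (3 * m) (by omega)).2 (Y := Y)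
    (fun n => ((mL n).add (mg n)).sub ((mL (n - 1)).add (mg (n - 1))))
    (fun t ω => by
      have := hc.abs_gain_sub_le hM1 hMε hδ0.le hδM (t + 1) (hbv ω (t + 1)) (θ t ω)
      refine le_trans (le_of_eq ?_) (this.trans (by gcongr; linarith))
      congr 1
      simp only [hY, hL, hθ, Nat.add_sub_cancel, StepData.growth, StepData.angle, orbit]
      ring) ht
  set J : ℕ → ℝ := fun n => ∫ ω, L n ω ∂P + ∫ ω, g (θ n ω) ∂P with hJ
  have hYJ : ∀ n, ∫ ω, Y n ω ∂P = J n - J (n - 1) := fun n => by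
    simp only [hY, hJ]
    rw [← integral_add (iL n) (ig n), ← integral_add (iL (n - 1)) (ig (n - 1))]
    exact integral_sub ((iL n).add (ig n)) ((iL (n - 1)).add (ig (n - 1)))
  have hstep : ∀ t, 6 * m ≤ t → |J (t + 2) - J t - 2 * (δ ^ 2 * κ)|
      ≤ 602 * K ^ 6 * (5 + T) * δ ^ ((3 * α + 2) / (α + 2)) := by
    intro t ht
    refine le_trans (le_of_eq ?_) ((hpair t ht).trans hm)
    rw [hYJ, hYJ, show t + 2 - 1 = t + 1 from rfl, Nat.add_sub_cancel]
    congr 1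
    ring
  have hJk : |J (6 * m + 2 * k) - J (6 * m) - 2 * k * (δ ^ 2 * κ)|
      ≤ k * (602 * K ^ 6 * (5 + T) * δ ^ ((3 * α + 2) / (α + 2))) := by
    induction k with
    | zero => simp
    | succ k ih =>
      have h1 := hstep (6 * m + 2 * k) (by omega)
      have e : J (6 * m + 2 * (k + 1)) - J (6 * m) - 2 * ((k + 1 : ℕ) : ℝ) * (δ ^ 2 * κ)
        = (J (6 * m + 2 * k + 2) - J (6 * m + 2 * k) - 2 * (δ ^ 2 * κ))
          + (J (6 * m + 2 * k) - J (6 * m) - 2 * k * (δ ^ 2 * κ)) := by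
        rw [show 6 * m + 2 * (k + 1) = 6 * m + 2 * k + 2 by ring]
        push_cast
        ring
      rw [e]
      refine (abs_add_le _ _).trans ((add_le_add h1 ih).trans (le_of_eq ?_))
      push_cast
      ring
  have hgb : ∀ n, |∫ ω, g (θ n ω) ∂P| ≤ M := fun n =>
    abs_integral_le_of_abs_le fun ω => hc.g_bl.bound _
  have h1 := abs_le.mp (hgb (6 * m))
  have h2 := abs_le.mp (hgb (6 * m + 2 * k))
  have h3 := abs_le.mp hJk
  simp only [hJ] at h3
  rw [abs_le]
  constructor <;> linarith [h3.1, h3.2, h1.1, h1.2, h2.1, h2.2]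

end WeakDisorder

namespace WeakDisorder

/-! ### Existence of the Lyapunov exponent -/

/-- The operator norm of a `2 × 2` matrix. -/
noncomputable def opNorm (T : Matrix (Fin 2) (Fin 2) ℝ) : ℝ :=
  ‖Matrix.toEuclideanCLM (n := Fin 2) (𝕜 := ℝ) T‖

lemma abs_entry_le_opNorm (T : Matrix (Fin 2) (Fin 2) ℝ) (i j : Fin 2) : |T i j| ≤ opNorm T := by
  have h := (Matrix.toEuclideanCLM (n := Fin 2) (𝕜 := ℝ) T).le_opNorm (EuclideanSpace.single j 1)
  rw [PiLp.norm_single, norm_one, mul_one] at h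
  have h2 := (PiLp.norm_apply_le
    (Matrix.toEuclideanCLM (n := Fin 2) (𝕜 := ℝ) T (EuclideanSpace.single j 1)) i).trans h
  rw [Matrix.ofLp_toEuclideanCLM] at h2
  simpa [opNorm] using h2

lemma opNorm_mul_le (T U : Matrix (Fin 2) (Fin 2) ℝ) : opNorm (T * U) ≤ opNorm T * opNorm U := by
  unfold opNorm
  rw [map_mul]
  exact norm_mul_le _ _

lemma opNorm_le_sum (T : Matrix (Fin 2) (Fin 2) ℝ) :
    opNorm T ≤ |T 0 0| + |T 0 1| + |T 1 0| + |T 1 1| := by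
  refine ContinuousLinearMap.opNorm_le_bound _ (by positivity) fun x => ?_
  have hn : ∀ y : EuclideanSpace ℝ (Fin 2), ‖y‖ ≤ |y 0| + |y 1| := fun y => by
    rw [EuclideanSpace.norm_eq, Fin.sum_univ_two]
    refine Real.sqrt_le_iff.mpr ⟨by positivity, ?_⟩
    simp only [Real.norm_eq_abs]
    nlinarith [mul_nonneg (abs_nonneg (y 0)) (abs_nonneg (y 1))]
  have hx : ∀ i, |x i| ≤ ‖x‖ := fun i => PiLp.norm_apply_le x i
  refine (hn _).trans ?_
  simp only [Matrix.ofLp_toEuclideanCLM, Matrix.mulVec, dotProduct, Fin.sum_univ_two]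
  have h : ∀ i, |T i 0 * x 0 + T i 1 * x 1| ≤ |T i 0| * ‖x‖ + |T i 1| * ‖x‖ := fun i => by
    refine (abs_add_le _ _).trans ?_
    rw [abs_mul, abs_mul]
    gcongr
    exacts [hx 0, hx 1]
  have := h 0
  have := h 1
  linarith

lemma continuous_opNorm : Continuous opNorm := by
  let f : Matrix (Fin 2) (Fin 2) ℝ →ₗ[ℝ] EuclideanSpace ℝ (Fin 2) →L[ℝ] EuclideanSpace ℝ (Fin 2) :=
    { toFun := Matrix.toEuclideanCLM (n := Fin 2) (𝕜 := ℝ)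
      map_add' := map_add _
      map_smul' := map_smul _ }
  exact (LinearMap.continuous_of_finiteDimensional f).norm

lemma half_le_opNorm_of_det {T : Matrix (Fin 2) (Fin 2) ℝ} (h : T.det = 1) : 1 / 2 ≤ opNorm T := by
  by_contra! hlt
  rw [Matrix.det_fin_two] at h
  have h0 := fun i j => (abs_entry_le_opNorm T i j).trans hlt.le
  have h1 : |T 0 0 * T 1 1| ≤ 1 / 2 * (1 / 2) := by
    rw [abs_mul]
    exact mul_le_mul (h0 0 0) (h0 1 1) (abs_nonneg _) (by norm_num)
  have h2 : |T 0 1 * T 1 0| ≤ 1 / 2 * (1 / 2) := by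
    rw [abs_mul]
    exact mul_le_mul (h0 0 1) (h0 1 0) (abs_nonneg _) (by norm_num)
  rw [abs_le] at h1 h2
  linarith [h1.2, h2.1]

section

variable {A : Type*} {V : (ℤ → A) → ℝ} {lam E : ℝ}

lemma det_transferProduct (ω : ℤ → A) (N : ℕ) : (transferProduct V lam E ω N).det = 1 := by
  induction N with
  | zero => simp [transferProduct]
  | succ N ih =>
    rw [transferProduct, Matrix.det_mul, ih, transferMatrix, Matrix.det_fin_two_of]
    ring

lemma transferProduct_add (ω : ℤ → A) (m n : ℕ) :
    transferProduct V lam E ω (m + n)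
      = transferProduct V lam E (shift m ω) n * transferProduct V lam E ω m := by
  induction n with
  | zero => simp [transferProduct]
  | succ n ih =>
    rw [← add_assoc, transferProduct, ih, transferProduct, shift_shift, mul_assoc]
    congr 4
    push_cast
    congr 1
    ring

/-- `log ‖T_N ⋯ T_1‖`. -/
noncomputable def logNorm (V : (ℤ → A) → ℝ) (lam E : ℝ) (N : ℕ) (ω : ℤ → A) : ℝ :=
  Real.log (opNorm (transferProduct V lam E ω N))

lemma opNorm_transferProduct_pos (ω : ℤ → A) (N : ℕ) : 0 < opNorm (transferProduct V lam E ω N) :=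
  lt_of_lt_of_le (by norm_num) (half_le_opNorm_of_det (det_transferProduct ω N))

lemma neg_one_le_logNorm (ω : ℤ → A) (N : ℕ) : -1 ≤ logNorm V lam E N ω := by
  have h := half_le_opNorm_of_det (det_transferProduct (V := V) (lam := lam) (E := E) ω N)
  refine le_trans ?_ (Real.log_le_log (by norm_num) h)
  rw [one_div, Real.log_inv]
  linarith [Real.log_two_lt_d9]

lemma opNorm_transferMatrix_le (E v : ℝ) : opNorm (transferMatrix E v) ≤ |E| + |v| + 2 := by
  refine (opNorm_le_sum _).trans ?_
  have := abs_sub E v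
  simp [transferMatrix]
  linarith

lemma logNorm_le {B : ℝ} (hB : ∀ ω, |V ω| ≤ B) (ω : ℤ → A) (N : ℕ) :
    logNorm V lam E N ω ≤ (N + 1) * (|E| + |lam| * B + 2) := by
  have hc : ∀ n : ℕ, opNorm (transferMatrix E (lam * V (shift ((n : ℤ) + 1) ω)))
      ≤ |E| + |lam| * B + 2 := fun n => by
    refine (opNorm_transferMatrix_le _ _).trans ?_
    rw [abs_mul]
    have := hB (shift ((n : ℤ) + 1) ω)
    gcongr
  have hB0 : 0 ≤ B := (abs_nonneg _).trans (hB ω)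
  set c := |E| + |lam| * B + 2
  have hc2 : 2 ≤ c := by
    have : 0 ≤ |E| + |lam| * B := by positivity
    linarith
  have h : opNorm (transferProduct V lam E ω N) ≤ c ^ (N + 1) := by
    induction N with
    | zero =>
      refine (opNorm_le_sum _).trans ?_
      simp [transferProduct]
      linarith
    | succ N ih =>
      rw [transferProduct, pow_succ']
      exact (opNorm_mul_le _ _).trans (mul_le_mul (hc N) ih (opNorm_transferProduct_pos ω N).le
        (by linarith))
  refine (Real.log_le_log (opNorm_transferProduct_pos ω N) h).trans ?_
  rw [Real.log_pow]
  push_cast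
  have := Real.log_le_sub_one_of_pos (show 0 < c by linarith)
  gcongr
  linarith

lemma logNorm_add_le (ω : ℤ → A) (m n : ℕ) :
    logNorm V lam E (m + n) ω ≤ logNorm V lam E n (shift m ω) + logNorm V lam E m ω := by
  unfold logNorm
  rw [← Real.log_mul (opNorm_transferProduct_pos _ _).ne' (opNorm_transferProduct_pos _ _).ne']
  refine Real.log_le_log (opNorm_transferProduct_pos _ _) ?_
  rw [transferProduct_add]
  exact opNorm_mul_le _ _

variable [MeasurableSpace A]

lemma measurable_transferProduct (hV : Measurable V) (N : ℕ) (i j : Fin 2) :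
    Measurable fun ω => transferProduct V lam E ω N i j := by
  induction N generalizing i j with
  | zero => exact measurable_const
  | succ N ih =>
    simp only [transferProduct, Matrix.mul_apply, Fin.sum_univ_two]
    have h : ∀ i j, Measurable fun ω => transferMatrix E (lam * V (shift ((N : ℤ) + 1) ω)) i j := by
      intro i j
      have hc : Measurable fun ω : ℤ → A => E - lam * V (shift ((N : ℤ) + 1) ω) :=
        measurable_const.sub ((hV.comp (measurable_shift ((N : ℤ) + 1))).const_mul lam)
      fin_cases i <;> fin_cases j <;> simp [transferMatrix, hc]
    exact ((h i 0).mul (ih 0 j)).add ((h i 1).mul (ih 1 j))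

lemma measurable_logNorm (hV : Measurable V) (N : ℕ) : Measurable (logNorm V lam E N) := by
  refine Real.measurable_log.comp ?_
  have h : Measurable fun ω => (fun i j => transferProduct V lam E ω N i j : Fin 2 → Fin 2 → ℝ) :=
    measurable_pi_lambda _ fun i => measurable_pi_lambda _ fun j => measurable_transferProduct hV N i j
  have h2 : Continuous fun T : Fin 2 → Fin 2 → ℝ => opNorm (Matrix.of T) := continuous_opNorm
  exact h2.measurable.comp h

variable {P : Measure (ℤ → A)} [IsProbabilityMeasure P]

lemma integrable_logNorm (hV : Measurable V) {B : ℝ} (hB : ∀ ω, |V ω| ≤ B) (N : ℕ) :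
    Integrable (logNorm V lam E N) P := by
  refine integrable_of_abs_le (b := 1 + |(N + 1) * (|E| + |lam| * B + 2)|)
    (measurable_logNorm hV N) fun ω => ?_
  have h1 := neg_one_le_logNorm (V := V) (lam := lam) (E := E) ω N
  have h2 := (logNorm_le (lam := lam) (E := E) hB ω N).trans (le_abs_self _)
  rw [abs_le]
  constructor
  · linarith [abs_nonneg ((N + 1) * (|E| + |lam| * B + 2))]
  · linarith

/-- The limit defining the Lyapunov exponent exists. -/
theorem tendsto_finiteLyapunov (hS : MeasurePreserving (shift (1 : ℤ)) P P) (hV : Measurable V)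
    {B : ℝ} (hB : ∀ ω, |V ω| ≤ B) (lam E : ℝ) :
    Tendsto (finiteLyapunov P V lam E) atTop (𝓝 (lyapunov P V lam E)) := by
  have hI := fun N => integrable_logNorm (P := P) (lam := lam) (E := E) hV hB N
  have hsub : Subadditive fun N => ∫ ω, logNorm V lam E N ω ∂P := fun m n => by
    have hm := measurePreserving_shift_nat hS m
    have e : ∫ ω, logNorm V lam E n (shift m ω) ∂P = ∫ ω, logNorm V lam E n ω ∂P :=
      integral_comp_shift hS (measurable_logNorm hV n) m
    have i : Integrable (fun ω => logNorm V lam E n (shift m ω)) P :=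
      hm.integrable_comp_of_integrable (hI n)
    beta_reduce
    rw [add_comm (∫ ω, logNorm V lam E m ω ∂P), ← e, ← integral_add i (hI m)]
    exact integral_mono (hI _) (i.add (hI m)) fun ω => logNorm_add_le ω m n
  have hbdd : BddBelow (Set.range fun N : ℕ => (∫ ω, logNorm V lam E N ω ∂P) / N) := by
    refine ⟨-1, ?_⟩
    rintro _ ⟨N, rfl⟩
    have h : -1 ≤ ∫ ω, logNorm V lam E N ω ∂P := by
      have := integral_mono (μ := P) (integrable_const (-1)) (hI N)
        fun ω => neg_one_le_logNorm ω N
      simpa using this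
    rcases Nat.eq_zero_or_pos N with rfl | hN
    · simp
    · have : (1 : ℝ) ≤ N := by exact_mod_cast hN
      simp only
      rw [le_div_iff₀ (by linarith)]
      linarith
  have hT := hsub.tendsto_lim hbdd
  have e : finiteLyapunov P V lam E = fun N : ℕ => (∫ ω, logNorm V lam E N ω ∂P) / N := by
    funext N
    unfold finiteLyapunov
    rw [one_div, inv_mul_eq_div]
    rfl
  rw [lyapunov, e]
  exact tendsto_nhds_limUnder ⟨_, hT⟩

end

end WeakDisorder

namespace WeakDisorder

/-! ### Comparison of the growth with the transfer matrices -/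

/-- Growth and angle form a continued logarithm of the moving vector: the principal branch is used
only for the factor 1+ζ, which stays away from zero. -/
lemma StepData.exp_growth_add_angle_succ {S : StepData} {δ ε : ℝ} {u : ℕ → ℝ} {x : ℝ} {n : ℕ}
    (h : ‖S.zeta δ ε (n + 1) (u (n + 1)) (S.angle δ ε u x n)‖ ≤ 1 / 2) :
    Complex.exp (S.growth δ ε u x (n + 1) + S.angle δ ε u x (n + 1) * Complex.I)
      = Complex.exp (S.growth δ ε u x n + S.angle δ ε u x n * Complex.I)
        * (1 + S.zeta δ ε (n + 1) (u (n + 1)) (S.angle δ ε u x n)) := by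
  set ζ := S.zeta δ ε (n + 1) (u (n + 1)) (S.angle δ ε u x n) with hζ
  have hne : 1 + ζ ≠ 0 := fun h0 => by
    have : ζ = -1 := by linear_combination h0
    rw [this, norm_neg, norm_one] at h
    norm_num at h
  have e : (S.growth δ ε u x (n + 1) + S.angle δ ε u x (n + 1) * Complex.I : ℂ)
      = (S.growth δ ε u x n + S.angle δ ε u x n * Complex.I) + Complex.log (1 + ζ) := by
    have h1 : S.growth δ ε u x (n + 1) = S.growth δ ε u x n + (Complex.log (1 + ζ)).re := rfl
    have h2 : S.angle δ ε u x (n + 1) = S.angle δ ε u x n + (Complex.log (1 + ζ)).im := rfl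
    rw [h1, h2]
    conv_rhs => rw [← Complex.re_add_im (Complex.log (1 + ζ))]
    push_cast
    ring
  rw [e, Complex.exp_add, Complex.exp_log hne]

lemma StepData.growth_eq_log_norm {S : StepData} {δ ε : ℝ} {u : ℕ → ℝ} {x : ℝ} {n : ℕ} :
    S.growth δ ε u x n
      = Real.log ‖Complex.exp (S.growth δ ε u x n + S.angle δ ε u x n * Complex.I)‖ := by
  rw [Complex.norm_exp]
  simp

/-- Averaging the growth over the initial angles controls both columns. -/
lemma log_norm_add_norm_le_average {f : ℝ → ℝ} {a b : ℂ} (hab : a ≠ 0)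
    (hf : ∀ x : ℝ, f x = Real.log ‖(Real.cos x : ℂ) * a + (Real.sin x : ℂ) * b‖) :
    Real.log (‖a‖ + ‖b‖)
      ≤ Real.log 4 + (2 * Real.pi)⁻¹ * ∫ t in (0 : ℝ)..2 * Real.pi, f (t / 2) := by
  -- With these, cos x · a + sin x · b = e^{-ix}(c e^{2ix} + d). The average over t = 2x is thus a
  -- circle average, equal to log max(‖c‖, ‖d‖), and ‖a‖ + ‖b‖ ≤ 4 max(‖c‖, ‖d‖).
  set c := (a - b * Complex.I) / 2 with hc
  set d := (a + b * Complex.I) / 2 with hd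
  have ha : a = c + d := by rw [hc, hd]; ring
  have hb : b = (c - d) * Complex.I := by
    rw [hc, hd]
    linear_combination b * Complex.I_mul_I
  have hcd : c ≠ 0 ∨ d ≠ 0 := by
    by_contra! h
    rw [h.1, h.2, add_zero] at ha
    exact hab ha
  have h1 := circleAverage_log_norm_mul_add hcd
  have h2 : (2 * Real.pi)⁻¹ * ∫ t in (0 : ℝ)..2 * Real.pi, f (t / 2)
      = Real.log (max ‖c‖ ‖d‖) := by
    rw [← h1, Real.circleAverage, smul_eq_mul]
    congr 1
    refine intervalIntegral.integral_congr fun t _ => ?_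
    simp only [hf, circleMap, zero_add, Complex.ofReal_one, one_mul]
    congr 1
    have e : c * Complex.exp (t * Complex.I) + d = Complex.exp ((t / 2 : ℝ) * Complex.I) *
        (((Real.cos (t / 2) : ℝ) : ℂ) * a + ((Real.sin (t / 2) : ℝ) : ℂ) * b) := by
      have h3 : Complex.exp (t * Complex.I)
          = Complex.exp ((t / 2 : ℝ) * Complex.I) * Complex.exp ((t / 2 : ℝ) * Complex.I) := by
        rw [← Complex.exp_add]
        congr 1
        push_cast
        ring
      rw [h3, Complex.exp_mul_I, Complex.ofReal_cos, Complex.ofReal_sin, ha, hb]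
      have h4 := Complex.cos_sq_add_sin_sq ((t / 2 : ℝ) : ℂ)
      set C := Complex.cos ((t / 2 : ℝ) : ℂ)
      set s := Complex.sin ((t / 2 : ℝ) : ℂ)
      linear_combination (-d) * h4 + (s ^ 2 * d) * Complex.I_mul_I
    rw [e, norm_mul, Complex.norm_exp_ofReal_mul_I, one_mul]
  rw [h2, ← Real.log_mul (by norm_num) (by
    rcases hcd with h | h
    · exact (lt_max_of_lt_left (norm_pos_iff.mpr h)).ne'
    · exact (lt_max_of_lt_right (norm_pos_iff.mpr h)).ne')]
  refine Real.log_le_log (add_pos_of_pos_of_nonneg (norm_pos_iff.mpr hab) (norm_nonneg _)) ?_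
  have n1 : ‖a‖ ≤ ‖c‖ + ‖d‖ := by rw [ha]; exact norm_add_le _ _
  have n2 : ‖b‖ ≤ ‖c‖ + ‖d‖ := by
    rw [hb, norm_mul, Complex.norm_I, mul_one]
    exact norm_sub_le _ _
  have := le_max_left ‖c‖ ‖d‖
  have := le_max_right ‖c‖ ‖d‖
  linarith

/-- Along n₀ + 2k, division by k turns the hypothesis into 2|γ - a| ≤ c in the limit, the constant
C₁ disappearing. -/
lemma abs_sub_le_of_linear_bound {F : ℕ → ℝ} {γ c a C₁ : ℝ} (hF : Tendsto F atTop (𝓝 γ)) (n₀ : ℕ)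
    (h : ∀ k : ℕ, |((n₀ + 2 * k : ℕ) : ℝ) * F (n₀ + 2 * k) - 2 * k * a| ≤ k * c + C₁) :
    |γ - a| ≤ c := by
  have hsub : Tendsto (fun k : ℕ => n₀ + 2 * k) atTop atTop :=
    tendsto_atTop_mono (fun k => show k ≤ n₀ + 2 * k by omega) tendsto_id
  have h1 : Tendsto (fun k : ℕ => ((n₀ : ℝ) / k + 2) * F (n₀ + 2 * k) - 2 * a) atTop
      (𝓝 ((0 + 2) * γ - 2 * a)) :=
    (((tendsto_const_div_atTop_nhds_zero_nat (n₀ : ℝ)).add_const 2).mul (hF.comp hsub)).sub_const _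
  have h2 : Tendsto (fun k : ℕ => c + C₁ / k) atTop (𝓝 (c + 0)) :=
    (tendsto_const_div_atTop_nhds_zero_nat C₁).const_add c
  have h3 := le_of_tendsto_of_tendsto h1.abs h2 ((eventually_ge_atTop 1).mono fun k hk => by
    have hk0 : (0 : ℝ) < k := by exact_mod_cast hk
    have e : ((n₀ : ℝ) / k + 2) * F (n₀ + 2 * k) - 2 * a
        = (((n₀ + 2 * k : ℕ) : ℝ) * F (n₀ + 2 * k) - 2 * k * a) / k := by
      push_cast
      field_simp
    beta_reduce
    rw [e, abs_div, abs_of_pos hk0, div_le_iff₀ hk0]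
    refine (h k).trans (le_of_eq ?_)
    field_simp)
  have e : (0 + 2) * γ - 2 * a = 2 * (γ - a) := by ring
  rw [e, abs_mul, abs_two, add_zero] at h3
  linarith [abs_nonneg (γ - a)]

/-- The polar data `S` describe the action of the transfer matrices, up to a change of basis. -/
def StepData.Realizes {A : Type*} (S : StepData) (V : (ℤ → A) → ℝ) (δ ε lam E : ℝ) : Prop :=
  ∃ c : ℝ, 1 ≤ c ∧ ∀ ω : ℤ → A,
    (∀ n θ, ‖S.zeta δ ε n (potential V ω n) θ‖ ≤ 1 / 2) → ∀ N : ℕ, ∃ a b : ℂ,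
      (∀ x : ℝ, Complex.exp (S.growth δ ε (potential V ω) x N
        + S.angle δ ε (potential V ω) x N * Complex.I)
          = (Real.cos x : ℂ) * a + (Real.sin x : ℂ) * b) ∧
      ‖a‖ ≤ c * opNorm (transferProduct V lam E ω N) ∧
      opNorm (transferProduct V lam E ω N) ≤ c * (‖a‖ + ‖b‖)

/-- Perturbation theory of the Lyapunov exponent for corrected polar data. -/
theorem StepData.IsCorrected.exists_lyapunov_bound {A : Type*} [Countable A] [MeasurableSpace A]
    [MeasurableSingletonClass A] {P : Measure (ℤ → A)} [IsProbabilityMeasure P]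
    (hS : MeasurePreserving (shift (1 : ℤ)) P P) {α : ℝ} (hα : 2 < α) (hmix : IsPsiMixing P α)
    {V : (ℤ → A) → ℝ} {r : ℝ} (hr0 : 0 < r) (hr1 : r < 1) (hV : IsQuasiLocal r V)
    (hV0 : ∫ ω, V ω ∂P = 0) {S : StepData} {M₀ κ : ℝ} {g g1 g2 : ℝ → ℝ} {cA1 sA1 Q : ℕ → ℝ → ℝ}
    (h : S.IsCorrected M₀ g g1 g2 cA1 sA1 Q (spectralDensity P V 0) (spectralDensity P V Real.pi) κ)
    (ε : ℝ) {lam E : ℝ → ℝ} (hreal : ∀ δ, 0 < δ → S.Realizes V δ ε (lam δ) (E δ)) :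
    ∃ C δ₀ : ℝ, 0 < δ₀ ∧ ∀ δ : ℝ, 0 < δ → δ < δ₀ →
      |lyapunov P V (lam δ) (E δ) - δ ^ 2 * κ| ≤ C * δ ^ ((3 * α + 2) / (α + 2)) := by
  obtain ⟨C, M, hM1, hSM, hMε, hVM, δ₀, hδ₀, hC⟩ :=
    h.exists_growth_bound hS hα hmix hr0 hr1 hV hV0 ε
  refine ⟨C, δ₀, hδ₀, fun δ hδ0 hδ => ?_⟩
  obtain ⟨hδM, n₀, hn₀⟩ := hC δ hδ0 hδ
  obtain ⟨c, hc1, hc⟩ := hreal δ hδ0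
  have hbv : ∀ (ω : ℤ → A) (n : ℕ), |potential V ω n| ≤ M := fun ω n => hVM.abs_potential_le n ω
  have hz : ∀ (ω : ℤ → A) n θ, ‖S.zeta δ ε n (potential V ω n) θ‖ ≤ 1 / 2 := fun ω n θ =>
    (S.log_expansion hSM hM1 hMε hδ0.le hδM n (hbv ω n) θ).1
  set L : ℝ → ℕ → (ℤ → A) → ℝ := fun x n ω => S.growth δ ε (potential V ω) x n with hL
  have mL2 := fun n => S.measurable_growth hSM hM1 hMε hδ0.le hδM hVM n
  have mL : ∀ x n, Measurable (L x n) := fun x n => (mL2 n).comp measurable_prodMk_left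
  have bL : ∀ x n ω, |L x n ω| ≤ n := fun x n ω =>
    S.abs_growth_le hSM hM1 hMε hδ0.le hδM (hbv ω) x n
  have iL : ∀ x n, Integrable (L x n) P := fun x n => integrable_of_abs_le (mL x n) (bL x n)
  have iN : ∀ n, Integrable (logNorm V (lam δ) (E δ) n) P := fun n =>
    integrable_logNorm hVM.measurable hVM.bound n
  have hc0 : 0 < c := by linarith
  -- The single initial angle 0 already bounds the norm of the product from below.
  have hlow : ∀ n ω, L 0 n ω ≤ Real.log c + logNorm V (lam δ) (E δ) n ω := fun n ω => by
    obtain ⟨a, b, hab, ha, -⟩ := hc ω (hz ω) n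
    have h0 := hab 0
    simp only [Real.cos_zero, Real.sin_zero, Complex.ofReal_one, Complex.ofReal_zero, one_mul,
      zero_mul, add_zero] at h0
    have hane : a ≠ 0 := h0 ▸ Complex.exp_ne_zero _
    simp only [hL]
    rw [StepData.growth_eq_log_norm, h0, logNorm,
      ← Real.log_mul hc0.ne' (opNorm_transferProduct_pos ω n).ne']
    exact Real.log_le_log (norm_pos_iff.mpr hane) ha
  -- A fixed direction may happen to be contracted, so the upper bound uses the average over all
  -- initial angles.
  have hup : ∀ n ω, logNorm V (lam δ) (E δ) n ω ≤ Real.log c + Real.log 4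
      + (2 * Real.pi)⁻¹ * ∫ t in (0 : ℝ)..2 * Real.pi, L (t / 2) n ω := fun n ω => by
    obtain ⟨a, b, hab, -, ha⟩ := hc ω (hz ω) n
    have h0 := hab 0
    simp only [Real.cos_zero, Real.sin_zero, Complex.ofReal_one, Complex.ofReal_zero, one_mul,
      zero_mul, add_zero] at h0
    have hane : a ≠ 0 := h0 ▸ Complex.exp_ne_zero _
    have h1 := log_norm_add_norm_le_average (f := fun x => L x n ω) hane fun x => by
      rw [← hab x, ← StepData.growth_eq_log_norm]
    have h2 := Real.log_le_log (opNorm_transferProduct_pos ω n) ha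
    rw [Real.log_mul hc0.ne' (add_pos_of_pos_of_nonneg (norm_pos_iff.mpr hane)
      (norm_nonneg b)).ne'] at h2
    rw [logNorm]
    linarith
  have hbound : ∀ (k : ℕ) x, |∫ ω, L x (n₀ + 2 * k) ω ∂P - 2 * k * (δ ^ 2 * κ)|
      ≤ k * (C * δ ^ ((3 * α + 2) / (α + 2))) + (2 * M + n₀) := fun k x => by
    have h1 := abs_le.mp (hn₀ k x)
    have h2 := abs_le.mp (abs_integral_le_of_abs_le (P := P) (bL x n₀))
    rw [abs_le]
    constructor <;> linarith [h1.1, h1.2, h2.1, h2.2]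
  refine abs_sub_le_of_linear_bound (C₁ := 2 * M + n₀ + Real.log c + Real.log 4)
    (tendsto_finiteLyapunov hS hVM.measurable hVM.bound (lam δ) (E δ)) n₀ fun k => ?_
  set N := n₀ + 2 * k with hN
  have hFN : (N : ℝ) * finiteLyapunov P V (lam δ) (E δ) N
      = ∫ ω, logNorm V (lam δ) (E δ) N ω ∂P := by
    rcases Nat.eq_zero_or_pos N with h0 | h0
    · rw [h0]
      simp [logNorm, transferProduct, opNorm]
    · have : (N : ℝ) ≠ 0 := by positivity
      rw [finiteLyapunov, ← mul_assoc, mul_one_div_cancel this, one_mul]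
      rfl
  have hlc : 0 ≤ Real.log c := Real.log_nonneg hc1
  have hl4 : 0 ≤ Real.log 4 := Real.log_nonneg (by norm_num)
  rw [hFN, abs_le]
  constructor
  · have h1 := integral_mono (iL 0 N) ((integrable_const _).add (iN N)) (hlow N)
    have h2 : ∫ ω, (Real.log c + logNorm V (lam δ) (E δ) N ω) ∂P
        = Real.log c + ∫ ω, logNorm V (lam δ) (E δ) N ω ∂P := by
      rw [integral_add (integrable_const _) (iN N)]
      simp
    have h3 := (abs_le.mp (hbound k 0)).1
    simp only [Pi.add_apply] at h1
    linarith
  -- Since the growth estimate is uniform in the initial angle, Fubini lets the angular average be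
  -- taken after the expectation.
  · set μ := (volume : Measure ℝ).restrict (Set.Ioc 0 (2 * Real.pi)) with hμ
    have hpi : 0 < 2 * Real.pi := by positivity
    have mprod : Measurable fun p : (ℤ → A) × ℝ => L (p.2 / 2) N p.1 :=
      (mL2 N).comp ((measurable_snd.div_const 2).prodMk measurable_fst)
    have iprod : Integrable (fun p : (ℤ → A) × ℝ => L (p.2 / 2) N p.1) (P.prod μ) :=
      Integrable.of_bound mprod.aestronglyMeasurable N
        (Eventually.of_forall fun p => bL _ _ _)
    have iavg : Integrable (fun ω => ∫ t in (0 : ℝ)..2 * Real.pi, L (t / 2) N ω) P := by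
      simp only [intervalIntegral.integral_of_le hpi.le]
      exact iprod.integral_prod_left
    have h1 := integral_mono (iN N) ((integrable_const (Real.log c + Real.log 4)).add
      (iavg.const_mul _)) (hup N)
    simp only [Pi.add_apply] at h1
    rw [integral_add (integrable_const _) (iavg.const_mul _), integral_const_mul] at h1
    have hswap : ∫ ω, (∫ t in (0 : ℝ)..2 * Real.pi, L (t / 2) N ω) ∂P
        = ∫ t in (0 : ℝ)..2 * Real.pi, ∫ ω, L (t / 2) N ω ∂P := by
      simp only [intervalIntegral.integral_of_le hpi.le]
      exact integral_integral_swap (f := fun ω t => L (t / 2) N ω) iprod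
    have iI : IntervalIntegrable (fun t => ∫ ω, L (t / 2) N ω ∂P) volume 0 (2 * Real.pi) := by
      rw [intervalIntegrable_iff_integrableOn_Ioc_of_le hpi.le]
      exact iprod.integral_prod_right
    have h2 := intervalIntegral.integral_mono_on hpi.le iI
      (intervalIntegrable_const (c := 2 * k * (δ ^ 2 * κ)
        + (k * (C * δ ^ ((3 * α + 2) / (α + 2))) + (2 * M + n₀))))
      fun t _ => by linarith [(abs_le.mp (hbound k (t / 2))).2]
    rw [intervalIntegral.integral_const, smul_eq_mul, sub_zero] at h2
    rw [hswap] at h1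
    have h3 := mul_le_mul_of_nonneg_left h2 (inv_pos.mpr hpi).le
    rw [inv_mul_cancel_left₀ hpi.ne'] at h3
    simp only [integral_const, probReal_univ, smul_eq_mul, one_mul] at h1
    linarith

end WeakDisorder
section

open scoped ContDiff

namespace WeakDisorder

/-! ### Smooth periodic step data -/

/-- Smooth `π`-periodic functions depending only on the parity of the site. -/
structure SmoothFamily (f : ℕ → ℝ → ℝ) : Prop where
  smooth : ∀ n, ContDiff ℝ ∞ (f n)
  periodic : ∀ n, Function.Periodic (f n) Real.pi
  period : ∀ n, f (n + 2) = f n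

lemma periodic_deriv {f : ℝ → ℝ} {c : ℝ} (hf : Function.Periodic f c) :
    Function.Periodic (deriv f) c := fun x => by
  rw [← deriv_comp_add_const, hf.funext]

lemma SmoothFamily.deriv {f : ℕ → ℝ → ℝ} (hf : SmoothFamily f) :
    SmoothFamily fun n => deriv (f n) :=
  ⟨fun n => (contDiff_infty_iff_deriv.mp (hf.smooth n)).2, fun n => periodic_deriv (hf.periodic n),
    fun n => by rw [hf.period]⟩

lemma exists_bddLip {f : ℝ → ℝ} (hf : ContDiff ℝ ∞ f) (hp : Function.Periodic f Real.pi) :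
    ∃ b, BddLip b f := by
  obtain ⟨K, hK0, hK⟩ := exists_bound_of_periodic hf.continuous hp
  obtain ⟨L, hL0, hL⟩ := exists_bound_of_periodic (contDiff_infty_iff_deriv.mp hf).2.continuous
    (periodic_deriv hp)
  refine ⟨K + L, fun x => (hK x).trans (by linarith), fun x y => ?_⟩
  have := Convex.norm_image_sub_le_of_norm_deriv_le (𝕜 := ℝ) (s := Set.univ) (f := f) (C := L)
    (x := y) (y := x) (fun z _ => hf.differentiable (by simp) z) (fun z _ => hL z) convex_univ
    (Set.mem_univ _) (Set.mem_univ _)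
  simp only [Real.norm_eq_abs] at this
  refine this.trans ?_
  gcongr
  linarith

lemma SmoothFamily.exists_bddLip {f : ℕ → ℝ → ℝ} (hf : SmoothFamily f) :
    ∃ b, 0 ≤ b ∧ ∀ n, BddLip b (f n) := by
  obtain ⟨b, hb⟩ := WeakDisorder.exists_bddLip (hf.smooth 0) (hf.periodic 0)
  obtain ⟨c, hc⟩ := WeakDisorder.exists_bddLip (hf.smooth 1) (hf.periodic 1)
  have h0 := hb.nonneg
  have h1 := hc.nonneg
  have : ∀ n, BddLip (b + c) (f n) ∧ BddLip (b + c) (f (n + 1)) := fun n => by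
    induction n with
    | zero => exact ⟨hb.mono (by linarith), hc.mono (by linarith)⟩
    | succ n ih => exact ⟨ih.2, by rw [hf.period]; exact ih.1⟩
  exact ⟨b + c, by linarith, fun n => (this n).1⟩

/-- The conditional second order gain at the angle `θ` with corrector derivative `h`. -/
noncomputable def StepData.meanGain (S : StepData) (h : ℝ → ℝ) (D0 Dpi : ℝ) (n : ℕ) (θ : ℝ) : ℝ :=
  S.cB n θ + h θ * S.sB n θ
    + (deriv (S.cA n) θ + (deriv h θ * S.sA n θ + h θ * deriv (S.sA n) θ)) *
    ((S.sA n θ + S.sA (n + 1) θ) / 2 * (D0 / 2) + (S.sA n θ - S.sA (n + 1) θ) / 2 * (Dpi / 2))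

lemma StepData.smoothFamily_meanGain {S : StepData} (hcA : SmoothFamily S.cA)
    (hsA : SmoothFamily S.sA) (hcB : SmoothFamily S.cB) (hsB : SmoothFamily S.sB)
    {h : ℝ → ℝ} (hh : ContDiff ℝ ∞ h) (hp : Function.Periodic h Real.pi) (D0 Dpi : ℝ) :
    SmoothFamily (S.meanGain h D0 Dpi) := by
  have hh' := (contDiff_infty_iff_deriv.mp hh).2
  have hp' := periodic_deriv hp
  refine ⟨fun n => ?_, fun n θ => ?_, fun n => ?_⟩
  · have h1 := hcA.deriv.smooth n
    have h2 := hsA.deriv.smooth n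
    have h3 := hcB.smooth n
    have h4 := hsB.smooth n
    have h5 := hsA.smooth n
    have h6 := hsA.smooth (n + 1)
    unfold StepData.meanGain
    fun_prop
  · simp only [StepData.meanGain]
    rw [hcB.periodic, hsB.periodic, hp, hp', hcA.deriv.periodic, hsA.deriv.periodic, hsA.periodic,
      hsA.periodic]
  · funext θ
    simp only [StepData.meanGain, hcB.period, hsB.period, hcA.period, hsA.period]

lemma StepData.exists_isCorrected {S : StepData} (hcA : SmoothFamily S.cA)
    (hsA : SmoothFamily S.sA) (hcB : SmoothFamily S.cB) (hsB : SmoothFamily S.sB)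
    (hcR : SmoothFamily S.cR) (hsR : SmoothFamily S.sR)
    {h : ℝ → ℝ} (hh : ContDiff ℝ ∞ h) (hp : Function.Periodic h Real.pi)
    (h0 : ∫ θ in (0 : ℝ)..Real.pi, h θ = 0) {D0 Dpi κ : ℝ}
    (e1 : ∀ n θ, deriv (S.cA n) θ * S.sA n θ = S.sA n θ ^ 2 - S.cA n θ ^ 2)
    (e2 : ∀ n θ, deriv (S.sA n) θ * S.sA n θ = -(2 * S.cA n θ * S.sA n θ))
    (hQ : ∀ n θ, S.meanGain h D0 Dpi n θ + S.meanGain h D0 Dpi (n + 1) θ = 2 * κ) :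
    ∃ M, S.IsCorrected M (fun x => ∫ t in (0 : ℝ)..x, h t) h (deriv h) (fun n => deriv (S.cA n))
      (fun n => deriv (S.sA n)) (S.meanGain h D0 Dpi) D0 Dpi κ := by
  obtain ⟨b1, p1, hb1⟩ := hcA.exists_bddLip
  obtain ⟨b2, p2, hb2⟩ := hsA.exists_bddLip
  obtain ⟨b3, p3, hb3⟩ := hcB.exists_bddLip
  obtain ⟨b4, p4, hb4⟩ := hsB.exists_bddLip
  obtain ⟨b5, p5, hb5⟩ := hcR.exists_bddLip
  obtain ⟨b6, p6, hb6⟩ := hsR.exists_bddLip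
  obtain ⟨b7, p7, hb7⟩ := hcA.deriv.exists_bddLip
  obtain ⟨b8, p8, hb8⟩ := hsA.deriv.exists_bddLip
  obtain ⟨b9, p9, hb9⟩ := (S.smoothFamily_meanGain hcA hsA hcB hsB hh hp D0 Dpi).exists_bddLip
  obtain ⟨c1, hc1⟩ := exists_bddLip (contDiff_primitive hh) (periodic_primitive hh.continuous hp h0)
  obtain ⟨c2, hc2⟩ := exists_bddLip hh hp
  have hh' := (contDiff_infty_iff_deriv.mp hh).2
  obtain ⟨c3, hc3⟩ := exists_bddLip hh' (periodic_deriv hp)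
  have q1 := hc1.nonneg
  have q2 := hc2.nonneg
  have q3 := hc3.nonneg
  have hd : ∀ {f : ℝ → ℝ}, ContDiff ℝ ∞ f → ∀ θ, HasDerivAt f (deriv f θ) θ := fun hf θ =>
    (hf.differentiable (by simp) θ).hasDerivAt
  exact ⟨b1 + b2 + b3 + b4 + b5 + b6 + b7 + b8 + b9 + c1 + c2 + c3,
    { cA := fun n => (hb1 n).mono (by linarith)
      sA := fun n => (hb2 n).mono (by linarith)
      cB := fun n => (hb3 n).mono (by linarith)
      sB := fun n => (hb4 n).mono (by linarith)
      cR := fun n => (hb5 n).mono (by linarith)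
      sR := fun n => (hb6 n).mono (by linarith)
      g_bl := hc1.mono (by linarith)
      g1_bl := hc2.mono (by linarith)
      g2_bl := hc3.mono (by linarith)
      cA1_bl := fun n => (hb7 n).mono (by linarith)
      sA1_bl := fun n => (hb8 n).mono (by linarith)
      Q_bl := fun n => (hb9 n).mono (by linarith)
      g_deriv := fun θ => hasDerivAt_primitive hh.continuous θ
      g1_deriv := hd hh
      cA_deriv := fun n => hd (hcA.smooth n)
      sA_deriv := fun n => hd (hsA.smooth n)
      cA1_mul := e1
      sA1_mul := e2
      period := hsA.period
      Q_eq := fun n θ => rfl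
      Q_sum := hQ }⟩

end WeakDisorder
end

namespace WeakDisorder

/-! ### The transfer matrices in polar coordinates -/

lemma exp_polar_re (L θ : ℝ) : (Complex.exp (L + θ * Complex.I)).re = Real.exp L * Real.cos θ := by
  rw [Complex.exp_re]
  simp

lemma exp_polar_im (L θ : ℝ) : (Complex.exp (L + θ * Complex.I)).im = Real.exp L * Real.sin θ := by
  rw [Complex.exp_im]
  simp

/-- Step data at the band center, where the free transfer matrix is a rotation by `π/2`. -/
noncomputable def centerData (ε : ℝ) : StepData where
  cA n θ := if Even n then -(Real.sin θ * Real.cos θ) else Real.sin θ * Real.cos θ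
  sA n θ := if Even n then Real.sin θ ^ 2 else Real.cos θ ^ 2
  cB n θ := -ε * if Even n then -(Real.sin θ * Real.cos θ) else Real.sin θ * Real.cos θ
  sB n θ := -ε * if Even n then Real.sin θ ^ 2 else Real.cos θ ^ 2
  cR _ _ := 0
  sR _ _ := 0

/-- Step data at the band edge, where the free transfer matrix is a shear. -/
noncomputable def edgeData (ε : ℝ) : StepData where
  cA _ θ := -(Real.sin θ * Real.cos θ)
  sA _ θ := -(Real.cos θ ^ 2)
  cB _ θ := (1 - ε) * (Real.sin θ * Real.cos θ)
  sB _ θ := -ε * Real.cos θ ^ 2 - Real.sin θ ^ 2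
  cR _ θ := -(Real.sin θ ^ 2)
  sR _ θ := -(Real.sin θ * Real.cos θ)

section

variable {A : Type*} {V : (ℤ → A) → ℝ}

lemma transferProduct_succ_zero {lam E : ℝ} {ω : ℤ → A} {N : ℕ} (j : Fin 2) :
    transferProduct V lam E ω (N + 1) 0 j = (E - lam * potential V ω (N + 1))
      * transferProduct V lam E ω N 0 j - transferProduct V lam E ω N 1 j := by
  simp [transferProduct, transferMatrix, Matrix.mul_apply, Fin.sum_univ_two, potential,
    sub_eq_add_neg]

lemma transferProduct_succ_one {lam E : ℝ} {ω : ℤ → A} {N : ℕ} (j : Fin 2) :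
    transferProduct V lam E ω (N + 1) 1 j = transferProduct V lam E ω N 0 j := by
  simp [transferProduct, transferMatrix, Matrix.mul_apply, Fin.sum_univ_two]

lemma norm_ofReal_add_ofReal_mul_I_le (x y : ℝ) : ‖(x + y * Complex.I : ℂ)‖ ≤ |x| + |y| := by
  have := Complex.norm_le_abs_re_add_abs_im (x + y * Complex.I : ℂ)
  simpa using this

lemma abs_le_norm_ofReal_add (x y : ℝ) :
    |x| ≤ ‖(x + y * Complex.I : ℂ)‖ ∧ |y| ≤ ‖(x + y * Complex.I : ℂ)‖ := by
  have h1 := Complex.abs_re_le_norm (x + y * Complex.I : ℂ)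
  have h2 := Complex.abs_im_le_norm (x + y * Complex.I : ℂ)
  exact ⟨by simpa using h1, by simpa using h2⟩

lemma exp_polar_mul_centerData (ε L θ δ v : ℝ) (n : ℕ) :
    Complex.exp (L + θ * Complex.I) * (1 + (centerData ε).zeta δ ε n v θ)
      = Complex.exp (L + θ * Complex.I) + (δ * v - ε * δ ^ 2 : ℝ) *
        (if Even n then -((Complex.exp (L + θ * Complex.I)).im : ℂ)
          else (Complex.exp (L + θ * Complex.I)).re * Complex.I) := by
  have h1 := exp_polar_re L θ
  have h2 := exp_polar_im L θ
  have h3 := Real.sin_sq_add_cos_sq θ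
  split_ifs with hn
  all_goals
    refine Complex.ext ?_ ?_
    all_goals
      simp only [StepData.zeta, centerData, hn, if_true, if_false, Complex.mul_re, Complex.mul_im,
        Complex.add_re, Complex.add_im, Complex.neg_re, Complex.neg_im, Complex.ofReal_re,
        Complex.ofReal_im, Complex.I_re, Complex.I_im, Complex.one_re, Complex.one_im, h1, h2]
      set s := Real.sin θ
      set c := Real.cos θ
      first
        | ring1
        | linear_combination (-(Real.exp L * s * (δ * v - ε * δ ^ 2))) * h3
        | linear_combination (Real.exp L * c * (δ * v - ε * δ ^ 2)) * h3

lemma neg_I_pow_of_even {n : ℕ} (hn : Even n) : ∃ σ : ℝ, (-Complex.I) ^ n = σ := by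
  obtain ⟨k, rfl⟩ := hn
  refine ⟨(-1) ^ k, ?_⟩
  rw [← two_mul, pow_mul, neg_sq, Complex.I_sq]
  push_cast
  rfl

/-- With the column (x₀, x₁) read as z = x₀ + i x₁, the free step is z ↦ iz, undone by the factor
(-i)^N. The perturbation of each step becomes a shear along one of the two coordinate axes,
alternating with the parity of the site. -/
lemma realizes_centerData (ε δ : ℝ) : (centerData ε).Realizes V δ ε δ (ε * δ ^ 2) := by
  refine ⟨2, by norm_num, fun ω hz N => ?_⟩
  set T := transferProduct V δ (ε * δ ^ 2) ω with hT
  refine ⟨(-Complex.I) ^ N * (T N 0 0 + T N 1 0 * Complex.I),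
    (-Complex.I) ^ N * (T N 0 1 + T N 1 1 * Complex.I), fun x => ?_, ?_, ?_⟩
  · induction N with
    | zero =>
      have h0 : T 0 = 1 := rfl
      simp only [h0, StepData.growth, StepData.angle, orbit, pow_zero, one_mul]
      simp [Complex.exp_mul_I]
    | succ N ih =>
      rw [StepData.exp_growth_add_angle_succ (hz _ _), exp_polar_mul_centerData]
      set W := Complex.exp ((centerData ε).growth δ ε (potential V ω) x N
        + (centerData ε).angle δ ε (potential V ω) x N * Complex.I)
      have hs0 := fun j => transferProduct_succ_zero (V := V) (lam := δ) (E := ε * δ ^ 2) (ω := ω)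
        (N := N) j
      have hs1 := fun j => transferProduct_succ_one (V := V) (lam := δ) (E := ε * δ ^ 2) (ω := ω)
        (N := N) j
      rw [← hT] at hs0 hs1
      simp only [hs0, hs1]
      -- The factor (-i)^N is real or imaginary according to parity, which decides whether the
      -- perturbed coordinate x₀ is the real or the imaginary part of W.
      rcases Nat.even_or_odd N with hN | hN
      · have hN1 : ¬ Even (N + 1) := by simpa [Nat.even_add_one] using hN
        obtain ⟨σ, hσ⟩ := neg_I_pow_of_even hN
        have hre : W.re = σ * (Real.cos x * T N 0 0 + Real.sin x * T N 0 1) := by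
          rw [ih, hσ]
          simp [-Complex.ofReal_cos, -Complex.ofReal_sin]
          ring
        rw [if_neg hN1, hre, ih, pow_succ (-Complex.I), hσ]
        push_cast
        linear_combination ((σ : ℂ) * (Complex.cos x * T N 0 0 + Complex.sin x * T N 0 1)) *
          Complex.I_sq
      · have hN1 : Even (N + 1) := hN.add_one
        obtain ⟨σ, hσ⟩ := neg_I_pow_of_even hN1
        have hσ' : (-Complex.I) ^ N = σ * Complex.I := by
          rw [pow_succ] at hσ
          linear_combination Complex.I * hσ + (-Complex.I) ^ N * Complex.I_sq
        have him : W.im = σ * (Real.cos x * T N 0 0 + Real.sin x * T N 0 1) := by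
          rw [ih, hσ']
          simp [-Complex.ofReal_cos, -Complex.ofReal_sin]
          ring
        rw [if_pos hN1, him, ih, hσ', hσ]
        push_cast
        linear_combination ((σ : ℂ) * (Complex.cos x * T N 1 0 + Complex.sin x * T N 1 1)) *
          Complex.I_sq
  · rw [norm_mul, norm_pow, norm_neg, Complex.norm_I, one_pow, one_mul]
    have := norm_ofReal_add_ofReal_mul_I_le (T N 0 0) (T N 1 0)
    have := abs_entry_le_opNorm (T N) 0 0
    have := abs_entry_le_opNorm (T N) 1 0
    linarith
  · rw [norm_mul, norm_mul, norm_pow, norm_neg, Complex.norm_I, one_pow, one_mul, one_mul]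
    have := opNorm_le_sum (T N)
    have h1 := abs_le_norm_ofReal_add (T N 0 0) (T N 1 0)
    have h2 := abs_le_norm_ofReal_add (T N 0 1) (T N 1 1)
    linarith [h1.1, h1.2, h2.1, h2.2]

lemma exp_polar_mul_edgeData (ε L θ δ v : ℝ) (n : ℕ) :
    Complex.exp (L + θ * Complex.I) * (1 + (edgeData ε).zeta δ ε n v θ)
      = Complex.exp (L + θ * Complex.I)
        + (δ ^ 2 * (Complex.exp (L + θ * Complex.I)).im : ℝ)
        - ((δ * v + ε * δ ^ 2) * (Complex.exp (L + θ * Complex.I)).re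
          + δ ^ 3 * (v + ε * δ) * (Complex.exp (L + θ * Complex.I)).im : ℝ) * Complex.I := by
  have h1 := exp_polar_re L θ
  have h2 := exp_polar_im L θ
  have h3 := Real.sin_sq_add_cos_sq θ
  refine Complex.ext ?_ ?_
  · simp only [StepData.zeta, edgeData, Complex.mul_re, Complex.mul_im, Complex.sub_re,
      Complex.add_re, Complex.add_im, Complex.ofReal_re,
      Complex.ofReal_im, Complex.I_re, Complex.I_im, Complex.one_re, Complex.one_im, h1, h2]
    linear_combination (δ ^ 2 * Real.exp L * Real.sin θ) * h3
  · simp only [StepData.zeta, edgeData, Complex.mul_re, Complex.mul_im, Complex.sub_im,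
      Complex.add_re, Complex.add_im, Complex.ofReal_re,
      Complex.ofReal_im, Complex.I_re, Complex.I_im, Complex.one_re, Complex.one_im, h1, h2]
    linear_combination (-(Real.exp L * ((δ * v + ε * δ ^ 2) * Real.cos θ
      + δ ^ 3 * (v + ε * δ) * Real.sin θ))) * h3

/-- In the coordinates y₁ = x₁, y₂ = (x₀ - x₁)/δ² the Jordan block becomes a shear of strength δ²,
the noise λ/δ² = δ and the energy shift εδ⁴/δ² = εδ². These are the scales of a diffusion with drift
of the same order. The comparison constant blows up like δ^{-2}, which is harmless because N → ∞ at
fixed δ. -/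
lemma realizes_edgeData (ε : ℝ) {δ : ℝ} (hδ : 0 < δ) :
    (edgeData ε).Realizes V δ ε (δ ^ 3) (2 - ε * δ ^ 4) := by
  have hδ2 : 0 < δ ^ 2 := by positivity
  have hi : 0 ≤ 1 / δ ^ 2 := by positivity
  refine ⟨4 + δ ^ 2 + 4 * (1 / δ ^ 2), by linarith, fun ω hz N => ?_⟩
  set T := transferProduct V (δ ^ 3) (2 - ε * δ ^ 4) ω with hT
  -- a and b are the images, in the coordinates y, of the initial vectors y = (1,0) and y = (0,1),
  -- that is, of x = (1,1) and x = (δ²,0).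
  set a1 := T N 1 0 + T N 1 1 with ha1
  set a2 := (T N 0 0 + T N 0 1 - (T N 1 0 + T N 1 1)) / δ ^ 2 with ha2
  set b1 := δ ^ 2 * T N 1 0 with hb1
  set b2 := T N 0 0 - T N 1 0 with hb2
  refine ⟨a1 + a2 * Complex.I, b1 + b2 * Complex.I, fun x => ?_, ?_, ?_⟩
  · have key : (Complex.exp ((edgeData ε).growth δ ε (potential V ω) x N
        + (edgeData ε).angle δ ε (potential V ω) x N * Complex.I)).re
          = Real.cos x * a1 + Real.sin x * b1 ∧
        (Complex.exp ((edgeData ε).growth δ ε (potential V ω) x N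
        + (edgeData ε).angle δ ε (potential V ω) x N * Complex.I)).im
          = Real.cos x * a2 + Real.sin x * b2 := by
      rw [ha1, ha2, hb1, hb2]
      clear ha1 ha2 hb1 hb2 a1 a2 b1 b2
      induction N with
      | zero =>
        have h0 : T 0 = 1 := rfl
        rw [exp_polar_re, exp_polar_im]
        simp [h0, StepData.growth, StepData.angle, orbit]
      | succ N ih =>
        rw [StepData.exp_growth_add_angle_succ (hz _ _), exp_polar_mul_edgeData]
        set W := Complex.exp ((edgeData ε).growth δ ε (potential V ω) x N
          + (edgeData ε).angle δ ε (potential V ω) x N * Complex.I)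
        have hs0 := fun j => transferProduct_succ_zero (V := V) (lam := δ ^ 3)
          (E := 2 - ε * δ ^ 4) (ω := ω) (N := N) j
        have hs1 := fun j => transferProduct_succ_one (V := V) (lam := δ ^ 3)
          (E := 2 - ε * δ ^ 4) (ω := ω) (N := N) j
        rw [← hT] at hs0 hs1
        simp only [hs0, hs1, Complex.sub_re, Complex.sub_im, Complex.add_re, Complex.add_im,
          Complex.mul_re, Complex.mul_im, Complex.ofReal_re, Complex.ofReal_im, Complex.I_re,
          Complex.I_im, ih.1, ih.2]
        constructor
        · field_simp
          ring
        · field_simp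
          ring
    refine Complex.ext ?_ ?_
    · rw [key.1]
      simp [-Complex.ofReal_cos, -Complex.ofReal_sin]
    · rw [key.2]
      simp [-Complex.ofReal_cos, -Complex.ofReal_sin]
  · have h1 := norm_ofReal_add_ofReal_mul_I_le a1 a2
    have h2 : |a1| ≤ 2 * opNorm (T N) := by
      refine (abs_add_le _ _).trans ?_
      linarith [abs_entry_le_opNorm (T N) 1 0, abs_entry_le_opNorm (T N) 1 1]
    have h3 : |a2| ≤ 4 * opNorm (T N) * (1 / δ ^ 2) := by
      rw [ha2, abs_div, abs_of_pos hδ2, div_eq_mul_one_div]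
      gcongr
      refine (abs_sub _ _).trans ((add_le_add (abs_add_le _ _) (abs_add_le _ _)).trans ?_)
      linarith [abs_entry_le_opNorm (T N) 1 0, abs_entry_le_opNorm (T N) 1 1,
        abs_entry_le_opNorm (T N) 0 0, abs_entry_le_opNorm (T N) 0 1]
    have h4 : 0 ≤ opNorm (T N) := norm_nonneg _
    have h5 : 0 ≤ δ ^ 2 * opNorm (T N) := by positivity
    linarith
  · obtain ⟨h1, h2⟩ := abs_le_norm_ofReal_add a1 a2
    obtain ⟨h3, h4⟩ := abs_le_norm_ofReal_add b1 b2
    set na := ‖(a1 + a2 * Complex.I : ℂ)‖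
    set nb := ‖(b1 + b2 * Complex.I : ℂ)‖
    have hna : 0 ≤ na := norm_nonneg _
    have hnb : 0 ≤ nb := norm_nonneg _
    have t10 : |T N 1 0| ≤ nb * (1 / δ ^ 2) := by
      rw [hb1, abs_mul, abs_of_pos hδ2] at h3
      rw [mul_one_div, le_div_iff₀ hδ2]
      linarith
    have t00 : |T N 0 0| ≤ nb + nb * (1 / δ ^ 2) := by
      have e : T N 0 0 = b2 + T N 1 0 := by rw [hb2]; ring
      rw [e]
      exact (abs_add_le _ _).trans (add_le_add h4 t10)
    have t11 : |T N 1 1| ≤ na + nb * (1 / δ ^ 2) := by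
      have e : T N 1 1 = a1 - T N 1 0 := by rw [ha1]; ring
      rw [e]
      exact (abs_sub _ _).trans (add_le_add h1 t10)
    have t01 : |T N 0 1| ≤ δ ^ 2 * na + na + (nb + nb * (1 / δ ^ 2)) := by
      have e : T N 0 1 = δ ^ 2 * a2 + a1 - T N 0 0 := by rw [ha2, ha1]; field_simp; ring
      rw [e]
      refine (abs_sub _ _).trans (add_le_add ((abs_add_le _ _).trans (add_le_add ?_ h1)) t00)
      rw [abs_mul, abs_of_pos hδ2]
      gcongr
    have h6 := opNorm_le_sum (T N)
    have q1 : 0 ≤ na * (1 / δ ^ 2) := by positivity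
    have q2 : 0 ≤ nb * δ ^ 2 := by positivity
    linarith

/-! ### Reflection of the spectrum -/

open scoped Matrix.Norms.L2Operator in
lemma opNorm_diagonal_one_neg_one : opNorm (Matrix.diagonal ![1, -1]) ≤ 1 := by
  rw [opNorm, Matrix.l2_opNorm_toEuclideanCLM, Matrix.l2_opNorm_diagonal]
  refine (pi_norm_le_iff_of_nonneg zero_le_one).mpr fun i => ?_
  fin_cases i <;> simp

/-- Conjugation by diag(1,-1) keeps the off-diagonal part up to the overall sign and flips E - v to
its negative; the signs collect in (-1)^N. -/
lemma transferProduct_neg (lam E : ℝ) (ω : ℤ → A) (N : ℕ) :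
    transferProduct V lam (-E) ω N = (-1 : ℝ) ^ N • (Matrix.diagonal ![1, -1]
      * transferProduct (fun ω => -V ω) lam E ω N * Matrix.diagonal ![1, -1]) := by
  have hD : (Matrix.diagonal ![1, -1] : Matrix (Fin 2) (Fin 2) ℝ) * Matrix.diagonal ![1, -1] = 1 := by
    ext i j
    fin_cases i <;> fin_cases j <;> simp
  induction N with
  | zero => simp [transferProduct, hD]
  | succ N ih =>
    rw [transferProduct, ih, transferProduct]
    have h : ∀ v : ℝ, transferMatrix (-E) v
        = -(Matrix.diagonal ![1, -1] * transferMatrix E (-v) * Matrix.diagonal ![1, -1]) := by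
      intro v
      ext i j
      fin_cases i <;> fin_cases j <;> simp [transferMatrix]
      ring
    rw [h, mul_neg, Matrix.mul_smul, pow_succ, mul_neg_one, neg_smul, Matrix.neg_mul, smul_neg]
    congr 2
    simp only [Matrix.mul_assoc]
    rw [← Matrix.mul_assoc (Matrix.diagonal ![1, -1]) (Matrix.diagonal ![1, -1]), hD,
      Matrix.one_mul]

lemma opNorm_transferProduct_neg_le (lam E : ℝ) (ω : ℤ → A) (N : ℕ) :
    opNorm (transferProduct V lam (-E) ω N)
      ≤ opNorm (transferProduct (fun ω => -V ω) lam E ω N) := by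
  rw [transferProduct_neg]
  have h1 : ∀ T : Matrix (Fin 2) (Fin 2) ℝ, opNorm ((-1 : ℝ) ^ N • T) = opNorm T := fun T => by
    rw [opNorm, map_smul, norm_smul, norm_pow, norm_neg, norm_one, one_pow, one_mul, opNorm]
  rw [h1]
  have h2 : ∀ T : Matrix (Fin 2) (Fin 2) ℝ, 0 ≤ opNorm T := fun T => norm_nonneg _
  calc _ ≤ opNorm (Matrix.diagonal ![1, -1]) * opNorm (transferProduct (fun ω => -V ω) lam E ω N)
        * opNorm (Matrix.diagonal ![1, -1]) :=
        (opNorm_mul_le _ _).trans (mul_le_mul_of_nonneg_right (opNorm_mul_le _ _) (h2 _))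
    _ ≤ 1 * opNorm (transferProduct (fun ω => -V ω) lam E ω N) * 1 := by
        have := opNorm_diagonal_one_neg_one
        have := h2 (transferProduct (fun ω => -V ω) lam E ω N)
        gcongr
        exact h2 _
    _ = _ := by ring

lemma lyapunov_neg [MeasurableSpace A] (P : Measure (ℤ → A)) (lam E : ℝ) :
    lyapunov P V lam (-E) = lyapunov P (fun ω => -V ω) lam E := by
  have h : finiteLyapunov P V lam (-E) = finiteLyapunov P (fun ω => -V ω) lam E := by
    funext N
    unfold finiteLyapunov
    congr 2
    funext ω
    congr 1
    refine le_antisymm (opNorm_transferProduct_neg_le lam E ω N) ?_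
    have := opNorm_transferProduct_neg_le (V := fun ω => -V ω) lam (-E) ω N
    simp only [neg_neg] at this
    exact this
  rw [lyapunov, lyapunov, h]

lemma spectralDensity_neg [MeasurableSpace A] (P : Measure (ℤ → A)) (k : ℝ) :
    spectralDensity P (fun ω => -V ω) k = spectralDensity P V k := by
  simp only [spectralDensity, neg_mul_neg]

lemma IsQuasiLocal.neg [MeasurableSpace A] {r : ℝ} (hV : IsQuasiLocal r V) :
    IsQuasiLocal r fun ω => -V ω := by
  obtain ⟨B, hB⟩ := hV.bounded
  obtain ⟨C, hC⟩ := hV.variation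
  refine ⟨hV.measurable.neg, ⟨B, fun ω => by rw [abs_neg]; exact hB ω⟩, ⟨C, fun m n hm hn ω ω' h => ?_⟩⟩
  rw [neg_sub_neg, abs_sub_comm]
  exact hC m n hm hn ω ω' h

end

end WeakDisorder
section

open scoped ContDiff

namespace WeakDisorder

/-! ### Band center and band edges -/

lemma sin_sq_periodic : Function.Periodic (fun θ => Real.sin θ ^ 2) Real.pi := fun θ => by
  simp [Real.sin_add_pi]

lemma cos_sq_periodic : Function.Periodic (fun θ => Real.cos θ ^ 2) Real.pi := fun θ => by
  simp [Real.cos_add_pi]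

lemma sin_mul_cos_periodic : Function.Periodic (fun θ => Real.sin θ * Real.cos θ) Real.pi :=
  fun θ => by simp [Real.sin_add_pi, Real.cos_add_pi]

lemma hasDerivAt_sin_mul_cos (θ : ℝ) : HasDerivAt (fun θ => Real.sin θ * Real.cos θ)
    (Real.cos θ ^ 2 - Real.sin θ ^ 2) θ := by
  refine ((Real.hasDerivAt_sin θ).mul (Real.hasDerivAt_cos θ)).congr_deriv ?_
  ring

lemma hasDerivAt_cos_sq (θ : ℝ) : HasDerivAt (fun θ => Real.cos θ ^ 2)
    (-(2 * Real.sin θ * Real.cos θ)) θ := by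
  refine ((Real.hasDerivAt_cos θ).pow 2).congr_deriv ?_
  simp
  ring

lemma hasDerivAt_sin_sq (θ : ℝ) : HasDerivAt (fun θ => Real.sin θ ^ 2)
    (2 * Real.sin θ * Real.cos θ) θ := by
  refine ((Real.hasDerivAt_sin θ).pow 2).congr_deriv ?_
  simp

lemma smoothFamily_const {f : ℝ → ℝ} (hf : ContDiff ℝ ∞ f) (hp : Function.Periodic f Real.pi) :
    SmoothFamily fun _ => f :=
  ⟨fun _ => hf, fun _ => hp, fun _ => rfl⟩

lemma smoothFamily_ite {f g : ℝ → ℝ} (hf : ContDiff ℝ ∞ f) (hp : Function.Periodic f Real.pi)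
    (hg : ContDiff ℝ ∞ g) (hq : Function.Periodic g Real.pi) :
    SmoothFamily fun n θ => if Even n then f θ else g θ := by
  refine ⟨fun n => ?_, fun n => ?_, fun n => ?_⟩
  · by_cases hn : Even n
    · simpa only [hn, if_true] using hf
    · simpa only [hn, if_false] using hg
  · by_cases hn : Even n
    · simpa only [hn, if_true] using hp
    · simpa only [hn, if_false] using hq
  · funext θ
    have : Even (n + 2) ↔ Even n := by simp [Nat.even_add]
    simp only [this]

lemma SmoothFamily.const_mul {f : ℕ → ℝ → ℝ} (hf : SmoothFamily f) (c : ℝ) :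
    SmoothFamily fun n θ => c * f n θ :=
  ⟨fun n => contDiff_const.mul (hf.smooth n), fun n θ =>
    congrArg (c * ·) (hf.periodic n θ), fun n => by
    funext θ
    simp only [hf.period]⟩

lemma deriv_centerData_cA (ε : ℝ) (n : ℕ) (θ : ℝ) : deriv ((centerData ε).cA n) θ
    = if Even n then -(Real.cos θ ^ 2 - Real.sin θ ^ 2) else Real.cos θ ^ 2 - Real.sin θ ^ 2 := by
  by_cases hn : Even n
  · simp only [centerData, hn, if_true]
    exact (hasDerivAt_sin_mul_cos θ).neg.deriv
  · simp only [centerData, hn, if_false]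
    exact (hasDerivAt_sin_mul_cos θ).deriv

lemma deriv_centerData_sA (ε : ℝ) (n : ℕ) (θ : ℝ) : deriv ((centerData ε).sA n) θ
    = if Even n then 2 * Real.sin θ * Real.cos θ else -(2 * Real.sin θ * Real.cos θ) := by
  by_cases hn : Even n
  · simp only [centerData, hn, if_true]
    exact (hasDerivAt_sin_sq θ).deriv
  · simp only [centerData, hn, if_false]
    exact (hasDerivAt_cos_sq θ).deriv

/-- The coefficients sin² and cos² at neighbouring sites add up to 1, which couples to D0, and
differ by ∓cos 2θ, which couples to Dpi. Only the sum over two sites yields the generator of the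
stated Fokker-Planck operator. -/
lemma meanGain_centerData (ε D0 Dpi : ℝ) (h : ℝ → ℝ) (n : ℕ) (θ : ℝ) :
    (centerData ε).meanGain h D0 Dpi n θ + (centerData ε).meanGain h D0 Dpi (n + 1) θ
      = (centerP D0 Dpi θ * deriv h θ + centerQ Dpi ε θ * h θ) / 2
        + Dpi / 4 * (1 + Real.cos (4 * θ)) := by
  have h3 := Real.sin_sq_add_cos_sq θ
  have e4 : Real.sin (4 * θ) = 2 * (2 * Real.sin θ * Real.cos θ) * (Real.cos θ ^ 2 - Real.sin θ ^ 2) := by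
    rw [show 4 * θ = 2 * (2 * θ) by ring, Real.sin_two_mul, Real.sin_two_mul, Real.cos_two_mul']
  have e5 : Real.cos (4 * θ) = 2 * (Real.cos θ ^ 2 - Real.sin θ ^ 2) ^ 2 - 1 := by
    rw [show 4 * θ = 2 * (2 * θ) by ring, Real.cos_two_mul, Real.cos_two_mul']
  have e2 : Real.sin θ ^ 2 = 1 - Real.cos θ ^ 2 := by linarith
  rcases Nat.even_or_odd n with hn | hn
  · have hn1 : ¬ Even (n + 1) := by simpa [Nat.even_add_one] using hn
    have hn2 : Even (n + 1 + 1) := by simpa [Nat.even_add_one] using hn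
    simp only [StepData.meanGain, deriv_centerData_cA, deriv_centerData_sA]
    simp only [hn, hn1, hn2, if_true, if_false, centerData, centerP, centerQ, e4, e5, Real.cos_two_mul', e2]
    ring
  · have hn1 : Even (n + 1) := hn.add_one
    have hn0 : ¬ Even n := Nat.not_even_iff_odd.mpr hn
    have hn2 : ¬ Even (n + 1 + 1) := by simpa [Nat.even_add_one] using hn0
    simp only [StepData.meanGain, deriv_centerData_cA, deriv_centerData_sA]
    simp only [hn0, hn1, hn2, if_true, if_false, centerData, centerP, centerQ, e4, e5, Real.cos_two_mul', e2]
    ring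

lemma contDiff_centerP (D0 Dpi : ℝ) : ContDiff ℝ ∞ (centerP D0 Dpi) := by
  unfold centerP
  fun_prop

lemma contDiff_centerQ (Dpi ε : ℝ) : ContDiff ℝ ∞ (centerQ Dpi ε) := by
  unfold centerQ
  fun_prop

lemma periodic_cos_four_mul : Function.Periodic (fun θ => Real.cos (4 * θ)) Real.pi := fun θ => by
  simp only
  rw [show 4 * (θ + Real.pi) = 4 * θ + 2 * (2 * Real.pi) by ring]
  exact_mod_cast Real.cos_add_nat_mul_two_pi (4 * θ) 2

lemma periodic_centerP (D0 Dpi : ℝ) : Function.Periodic (centerP D0 Dpi) Real.pi := fun θ => by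
  simp only [centerP]
  rw [show 2 * (θ + Real.pi) = 2 * θ + 2 * Real.pi by ring, Real.cos_add_two_pi]

lemma periodic_centerQ (Dpi ε : ℝ) : Function.Periodic (centerQ Dpi ε) Real.pi := fun θ => by
  simp only [centerQ]
  rw [show 4 * (θ + Real.pi) = 4 * θ + 2 * Real.pi + 2 * Real.pi by ring, Real.sin_add_two_pi,
    Real.sin_add_two_pi]

lemma centerP_pos {D0 Dpi : ℝ} (hD0 : 0 < D0) (hDpi : 0 < Dpi) (θ : ℝ) : 0 < centerP D0 Dpi θ := by
  unfold centerP
  positivity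

lemma exists_isCorrected_centerData {D0 Dpi : ℝ} (hD0 : 0 < D0) (hDpi : 0 < Dpi) (ε : ℝ)
    {ρ : ℝ → ℝ} (hρ : IsGroundState (centerP D0 Dpi) (centerQ Dpi ε) ρ) :
    ∃ M g g1 g2 cA1 sA1 Q, (centerData ε).IsCorrected M g g1 g2 cA1 sA1 Q D0 Dpi
      (Dpi / 8 * ∫ θ in (0 : ℝ)..Real.pi, ρ θ * (1 + Real.cos (4 * θ))) := by
  -- F is twice the gain Dpi/4·(1 + cos 4θ) of a pair of sites, because the generator enters the
  -- pair gain with the factor 1/2.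
  obtain ⟨h, hh, hp, h0, hPoisson⟩ := exists_poisson_of_pos (contDiff_centerP D0 Dpi)
    (contDiff_centerQ Dpi ε) (periodic_centerP D0 Dpi) (periodic_centerQ Dpi ε)
    (centerP_pos hD0 hDpi) hρ (F := fun θ => Dpi / 2 * (1 + Real.cos (4 * θ))) (by fun_prop)
    (fun θ => by
      have := periodic_cos_four_mul θ
      simp only at this ⊢
      rw [this])
  have hint : ∫ t in (0 : ℝ)..Real.pi, ρ t * (Dpi / 2 * (1 + Real.cos (4 * t)))
      = Dpi / 2 * ∫ t in (0 : ℝ)..Real.pi, ρ t * (1 + Real.cos (4 * t)) := by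
    rw [← intervalIntegral.integral_const_mul]
    congr 1
    funext t
    ring
  have hc : ContDiff ℝ ∞ fun θ => Real.sin θ * Real.cos θ := by fun_prop
  have hcA : SmoothFamily (centerData ε).cA :=
    smoothFamily_ite hc.neg (fun θ => congrArg Neg.neg (sin_mul_cos_periodic θ)) hc
      sin_mul_cos_periodic
  have hsA : SmoothFamily (centerData ε).sA :=
    smoothFamily_ite (by fun_prop) sin_sq_periodic (by fun_prop) cos_sq_periodic
  have hz : SmoothFamily fun _ _ => (0 : ℝ) := smoothFamily_const contDiff_const fun _ => rfl
  obtain ⟨M, hM⟩ := StepData.exists_isCorrected hcA hsA (hcA.const_mul (-ε)) (hsA.const_mul (-ε))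
    hz hz hh hp h0 (D0 := D0) (Dpi := Dpi)
    (κ := Dpi / 8 * ∫ θ in (0 : ℝ)..Real.pi, ρ θ * (1 + Real.cos (4 * θ)))
    (fun n θ => by
      rw [deriv_centerData_cA]
      simp only [centerData]
      split_ifs <;> ring)
    (fun n θ => by
      rw [deriv_centerData_sA]
      simp only [centerData]
      split_ifs <;> ring)
    (fun n θ => by
      rw [meanGain_centerData, hPoisson, hint]
      ring)
  exact ⟨M, _, _, _, _, _, _, hM⟩

lemma deriv_edgeData_cA (ε : ℝ) (n : ℕ) (θ : ℝ) :
    deriv ((edgeData ε).cA n) θ = -(Real.cos θ ^ 2 - Real.sin θ ^ 2) :=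
  (hasDerivAt_sin_mul_cos θ).neg.deriv

lemma deriv_edgeData_sA (ε : ℝ) (n : ℕ) (θ : ℝ) :
    deriv ((edgeData ε).sA n) θ = 2 * Real.sin θ * Real.cos θ := by
  rw [← neg_neg (2 * Real.sin θ * Real.cos θ)]
  exact (hasDerivAt_cos_sq θ).neg.deriv

/-- The step data do not depend on the site, so the alternating part vanishes and only D0 survives.
-/
lemma meanGain_edgeData (ε D0 Dpi : ℝ) (h : ℝ → ℝ) (n : ℕ) (θ : ℝ) :
    (edgeData ε).meanGain h D0 Dpi n θ
      = (edgeP D0 θ * deriv h θ + edgeQ D0 ε θ * h θ) / 2 + ((1 - ε) / 2 * Real.sin (2 * θ)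
          + D0 / 8 * (1 + 2 * Real.cos (2 * θ) + Real.cos (4 * θ))) := by
  have e5 : Real.cos (4 * θ) = 2 * (2 * Real.cos θ ^ 2 - 1) ^ 2 - 1 := by
    rw [show 4 * θ = 2 * (2 * θ) by ring, Real.cos_two_mul, Real.cos_two_mul]
  have e2 : Real.sin θ ^ 2 = 1 - Real.cos θ ^ 2 := by linarith [Real.sin_sq_add_cos_sq θ]
  simp only [StepData.meanGain, deriv_edgeData_cA, deriv_edgeData_sA]
  simp only [edgeData, edgeP, edgeQ, e5, Real.cos_two_mul, Real.sin_two_mul, e2]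
  ring

lemma exists_isCorrected_edgeData {D0 : ℝ} (hD0 : 0 < D0) (Dpi ε : ℝ)
    {ρ : ℝ → ℝ} (hρ : IsGroundState (edgeP D0) (edgeQ D0 ε) ρ) :
    ∃ M g g1 g2 cA1 sA1 Q, (edgeData ε).IsCorrected M g g1 g2 cA1 sA1 Q D0 Dpi
      (edgeCoefficient D0 ε ρ) := by
  obtain ⟨h, hh, hp, h0, hPoisson⟩ := exists_edge_poisson hD0 ε hρ
  have pneg : ∀ {f : ℝ → ℝ}, Function.Periodic f Real.pi →
      Function.Periodic (fun θ => -f θ) Real.pi := fun hf θ => congrArg Neg.neg (hf θ)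
  obtain ⟨M, hM⟩ := StepData.exists_isCorrected (S := edgeData ε)
    (smoothFamily_const (by fun_prop) (pneg sin_mul_cos_periodic))
    (smoothFamily_const (by fun_prop) (pneg cos_sq_periodic))
    (smoothFamily_const (by fun_prop) (fun θ => congrArg ((1 - ε) * ·) (sin_mul_cos_periodic θ)))
    (smoothFamily_const (by fun_prop) (fun θ => congrArg₂ (fun x y => -ε * x - y)
      (cos_sq_periodic θ) (sin_sq_periodic θ)))
    (smoothFamily_const (by fun_prop) (pneg sin_sq_periodic))
    (smoothFamily_const (by fun_prop) (pneg sin_mul_cos_periodic))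
    hh hp h0 (D0 := D0) (Dpi := Dpi) (κ := edgeCoefficient D0 ε ρ)
    (fun n θ => by
      rw [deriv_edgeData_cA]
      simp only [edgeData]
      ring)
    (fun n θ => by
      rw [deriv_edgeData_sA]
      simp only [edgeData]
      ring)
    (fun n θ => by
      rw [meanGain_edgeData, meanGain_edgeData, hPoisson]
      ring)
  exact ⟨M, _, _, _, _, _, _, hM⟩

end WeakDisorder
end

/-! ### Asymptotics in the coupling constant -/

namespace WeakDisorder

section

variable {A : Type*} [Countable A] [MeasurableSpace A] [MeasurableSingletonClass A]
  {P : Measure (ℤ → A)} [IsProbabilityMeasure P] {α : ℝ} {V : (ℤ → A) → ℝ} {r : ℝ}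

lemma isBigO_center (hS : MeasurePreserving (shift (1 : ℤ)) P P) (hα : 2 < α)
    (hmix : IsPsiMixing P α) (hr0 : 0 < r) (hr1 : r < 1) (hV : IsQuasiLocal r V)
    (hV0 : ∫ ω, V ω ∂P = 0) (hD0 : 0 < spectralDensity P V 0)
    (hDpi : 0 < spectralDensity P V Real.pi) (ε : ℝ) {ρ : ℝ → ℝ}
    (hρ : IsGroundState (centerP (spectralDensity P V 0) (spectralDensity P V Real.pi))
      (centerQ (spectralDensity P V Real.pi) ε) ρ) :
    (fun lam : ℝ => lyapunov P V lam (ε * lam ^ 2) - lam ^ 2 * (spectralDensity P V Real.pi / 8 *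
      ∫ θ in (0 : ℝ)..Real.pi, ρ θ * (1 + Real.cos (4 * θ))))
        =O[𝓝[>] 0] fun lam : ℝ => lam ^ ((3 * α + 2) / (α + 2)) := by
  obtain ⟨M, g, g1, g2, cA1, sA1, Q, h⟩ := exists_isCorrected_centerData hD0 hDpi ε hρ
  obtain ⟨C, δ₀, hδ₀, hC⟩ := h.exists_lyapunov_bound hS hα hmix hr0 hr1 hV hV0 ε
    (lam := fun δ => δ) (E := fun δ => ε * δ ^ 2) fun δ _ => realizes_centerData ε δ
  refine IsBigO.of_bound C ?_
  filter_upwards [Ioo_mem_nhdsGT hδ₀] with lam hlam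
  rw [Real.norm_eq_abs, Real.norm_eq_abs, abs_of_nonneg (Real.rpow_nonneg hlam.1.le _)]
  exact hC lam hlam.1 hlam.2

lemma isBigO_edge (hS : MeasurePreserving (shift (1 : ℤ)) P P) (hα : 2 < α)
    (hmix : IsPsiMixing P α) (hr0 : 0 < r) (hr1 : r < 1) (hV : IsQuasiLocal r V)
    (hV0 : ∫ ω, V ω ∂P = 0) (hD0 : 0 < spectralDensity P V 0) (ε : ℝ) {ρ : ℝ → ℝ}
    (hρ : IsGroundState (edgeP (spectralDensity P V 0)) (edgeQ (spectralDensity P V 0) ε) ρ) :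
    (fun lam : ℝ => lyapunov P V lam (2 - ε * lam ^ (4 / 3 : ℝ))
      - lam ^ (2 / 3 : ℝ) * edgeCoefficient (spectralDensity P V 0) ε ρ)
        =O[𝓝[>] 0] fun lam : ℝ => lam ^ ((3 * α + 2) / (3 * α + 6)) := by
  obtain ⟨M, g, g1, g2, cA1, sA1, Q, h⟩ :=
    exists_isCorrected_edgeData hD0 (spectralDensity P V Real.pi) ε hρ
  obtain ⟨C, δ₀, hδ₀, hC⟩ := h.exists_lyapunov_bound hS hα hmix hr0 hr1 hV hV0 ε
    (lam := fun δ => δ ^ 3) (E := fun δ => 2 - ε * δ ^ 4) fun δ hδ => realizes_edgeData ε hδ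
  refine IsBigO.of_bound C ?_
  filter_upwards [Ioo_mem_nhdsGT (pow_pos hδ₀ 3)] with lam hlam
  rw [Real.norm_eq_abs, Real.norm_eq_abs, abs_of_nonneg (Real.rpow_nonneg hlam.1.le _)]
  -- In terms of δ = λ^{1/3} the energy is 2 - εδ⁴, the leading term has order δ², and the error
  -- exponent is divided by three.
  set δ := lam ^ (1 / 3 : ℝ) with hδ
  have hδ0 : 0 < δ := Real.rpow_pos_of_pos hlam.1 _
  have hpow : ∀ n : ℕ, δ ^ n = lam ^ ((n : ℝ) / 3) := fun n => by
    rw [hδ, ← Real.rpow_natCast, ← Real.rpow_mul hlam.1.le]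
    congr 1
    ring
  have h3 : δ ^ 3 = lam := by
    rw [hpow]
    norm_num
  have h4 : δ ^ 4 = lam ^ (4 / 3 : ℝ) := by rw [hpow]; norm_num
  have h2 : δ ^ 2 = lam ^ (2 / 3 : ℝ) := by rw [hpow]; norm_num
  have hη : δ ^ ((3 * α + 2) / (α + 2)) = lam ^ ((3 * α + 2) / (3 * α + 6)) := by
    rw [hδ, ← Real.rpow_mul hlam.1.le]
    congr 1
    have : α + 2 ≠ 0 := by linarith
    have : 3 * α + 6 ≠ 0 := by linarith
    field_simp
    ring
  have hlt : δ < δ₀ := lt_of_pow_lt_pow_left₀ 3 hδ₀.le (by rw [h3]; exact hlam.2)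
  have := hC δ hδ0 hlt
  simp only [h3, h4, h2, hη] at this
  exact this

end

end WeakDisorder
theorem theorem1 {A : Type*} [Countable A] [MeasurableSpace A] [MeasurableSingletonClass A]
    (P : Measure (ℤ → A)) [IsProbabilityMeasure P]
    (hS : MeasurePreserving (WeakDisorder.shift (1 : ℤ)) P P)
    (α : ℝ) (hα : 2 < α) (hmix : WeakDisorder.IsPsiMixing P α)
    (V : (ℤ → A) → ℝ) (r : ℝ) (hr0 : 0 < r) (hr1 : r < 1)
    (hV : WeakDisorder.IsQuasiLocal r V) (hV0 : ∫ ω, V ω ∂P = 0)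
    (hD0 : 0 < WeakDisorder.spectralDensity P V 0) :
    -- the limit defining the Lyapunov exponent exists
    (∀ lam E : ℝ, Tendsto (WeakDisorder.finiteLyapunov P V lam E) atTop
      (𝓝 (WeakDisorder.lyapunov P V lam E))) ∧
    -- (i) band center
    (0 < WeakDisorder.spectralDensity P V Real.pi → ∀ ε : ℝ, ∃ ρ : ℝ → ℝ,
      WeakDisorder.IsGroundState
        (WeakDisorder.centerP (WeakDisorder.spectralDensity P V 0)
          (WeakDisorder.spectralDensity P V Real.pi))
        (WeakDisorder.centerQ (WeakDisorder.spectralDensity P V Real.pi) ε) ρ ∧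
      (∀ ρ' : ℝ → ℝ, WeakDisorder.IsGroundState
        (WeakDisorder.centerP (WeakDisorder.spectralDensity P V 0)
          (WeakDisorder.spectralDensity P V Real.pi))
        (WeakDisorder.centerQ (WeakDisorder.spectralDensity P V Real.pi) ε) ρ' → ρ' = ρ) ∧
      (fun lam : ℝ => WeakDisorder.lyapunov P V lam (ε * lam ^ 2)
          - lam ^ 2 * (WeakDisorder.spectralDensity P V Real.pi / 8 *
              ∫ θ in (0 : ℝ)..Real.pi, ρ θ * (1 + Real.cos (4 * θ))))
        =O[𝓝[>] 0] fun lam : ℝ => lam ^ ((3 * α + 2) / (α + 2))) ∧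
    -- (ii) band edges
    (∀ ε : ℝ, ∃ ρ : ℝ → ℝ,
      WeakDisorder.IsGroundState
        (WeakDisorder.edgeP (WeakDisorder.spectralDensity P V 0))
        (WeakDisorder.edgeQ (WeakDisorder.spectralDensity P V 0) ε) ρ ∧
      (∀ ρ' : ℝ → ℝ, WeakDisorder.IsGroundState
        (WeakDisorder.edgeP (WeakDisorder.spectralDensity P V 0))
        (WeakDisorder.edgeQ (WeakDisorder.spectralDensity P V 0) ε) ρ' → ρ' = ρ) ∧
      (∃ C : ℝ, 0 < C ∧ ∀ θ : ℝ, -(Real.pi / 2) < θ → θ < Real.pi / 2 →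
        ρ θ = C * WeakDisorder.edgeDensity (WeakDisorder.spectralDensity P V 0) ε θ) ∧
      ((fun lam : ℝ => WeakDisorder.lyapunov P V lam (2 - ε * lam ^ (4 / 3 : ℝ))
          - lam ^ (2 / 3 : ℝ) *
            WeakDisorder.edgeCoefficient (WeakDisorder.spectralDensity P V 0) ε ρ)
        =O[𝓝[>] 0] fun lam : ℝ => lam ^ ((3 * α + 2) / (3 * α + 6))) ∧
      ((fun lam : ℝ => WeakDisorder.lyapunov P V lam (-2 + ε * lam ^ (4 / 3 : ℝ))
          - lam ^ (2 / 3 : ℝ) *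
            WeakDisorder.edgeCoefficient (WeakDisorder.spectralDensity P V 0) ε ρ)
        =O[𝓝[>] 0] fun lam : ℝ => lam ^ ((3 * α + 2) / (3 * α + 6)))) := by
  obtain ⟨B, hB⟩ := hV.bounded
  refine ⟨fun lam E => WeakDisorder.tendsto_finiteLyapunov hS hV.measurable hB lam E,
    fun hDpi ε => ?_, fun ε => ?_⟩
  · obtain ⟨ρ, hρ⟩ := WeakDisorder.exists_groundState_of_pos (WeakDisorder.contDiff_centerP _ _)
      (WeakDisorder.contDiff_centerQ _ ε) (WeakDisorder.periodic_centerP _ _)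
      (WeakDisorder.periodic_centerQ _ ε) (WeakDisorder.centerP_pos hD0 hDpi)
    exact ⟨ρ, hρ, fun ρ' hρ' => WeakDisorder.groundState_unique_of_pos
      (WeakDisorder.contDiff_centerP _ _) (WeakDisorder.contDiff_centerQ _ ε)
      (WeakDisorder.periodic_centerP _ _) (WeakDisorder.centerP_pos hD0 hDpi) hρ hρ',
      WeakDisorder.isBigO_center hS hα hmix hr0 hr1 hV hV0 hD0 hDpi ε hρ⟩
  · obtain ⟨ρ, hρ, huniq, hform⟩ := WeakDisorder.exists_edge_groundState hD0 ε
    refine ⟨ρ, hρ, huniq, hform,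
      WeakDisorder.isBigO_edge hS hα hmix hr0 hr1 hV hV0 hD0 ε hρ, ?_⟩
    -- The lower edge is the upper edge of the potential -V, which has the same correlations and
    -- hence the same spectral density and the same ρ.
    have hneg := WeakDisorder.spectralDensity_neg (V := V) P 0
    have h := WeakDisorder.isBigO_edge hS hα hmix hr0 hr1 hV.neg
      (by rw [integral_neg, hV0, neg_zero]) (hneg.symm ▸ hD0) ε (ρ := ρ) (by rw [hneg]; exact hρ)
    rw [hneg] at h
    refine h.congr_left fun lam => ?_
    have e : -2 + ε * lam ^ (4 / 3 : ℝ) = -(2 - ε * lam ^ (4 / 3 : ℝ)) := by ring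
    rw [e, WeakDisorder.lyapunov_neg]
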